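/- Let $e\in\mathbb{N}_0$ and let $g:\mathbb{R}^e\times\mathbb{R}^e\to\mathbb{R}$ be a (symmetric, positive semidefinite) kernel with reproducing kernel Hilbert space $\mathcal{H}_g$. Assume that all mixed partial derivatives $\partial_{x^I}\partial_{y^J}g$ with $|I|,|J|\le 4$ exist and that, for all $0\le n,m\le 4$, $$\sup_{x,y\in\mathbb{R}^e}\Big(\sum_{|I|=n,\,|J|=m}\big|\partial_{x^I}\partial_{y^J}g(x,y)\big|^2\Big)^{1/2}<\infty .$$ For $t\le T$ let $\mathrm{BV}_t$ be the space of continuous paths $\gamma:[t,T]\to\mathbb{R}^e$ of bounded variation, with the $1$-variation seminorm $|\gamma|_1$, the $1$-variation norm $\|\gamma\|_1=|\gamma_t|+|\gamma|_1$ and the uniform norm $\|\gamma\|_0=\sup_{u\in[t,T]}|\gamma_u|$. For $\gamma\in\mathrm{BV}_t$ let $G(\gamma)=\gamma^g:[t,T]\to\mathcal{H}_g$, $\gamma^g_u=g(\gamma_u,\cdot)$, be the lifted path. Let $\overline{T(\mathcal{H}_g)}$ be the Hilbert space of sequences $(a_n)_{n\ge0}$ with $a_n$ in the Hilbert tensor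 power $\mathcal{H}_g^{\otimes n}$ and $\sum_n\|a_n\|^2<\infty$, and for $h\in\mathcal{H}_g$ put $(a_0,a_1,\dots)\cdot h=(0,a_0\otimes h,a_1\otimes h,\dots)$. Let $$S(\gamma^g)_{u}=\Big(\int_{t<r_1<\dots<r_n<u}d\gamma^g_{r_1}\otimes\dots\otimes d\gamma^g_{r_n}\Big)_{n\ge0},\qquad u\in[t,T],$$ be the signature of $\gamma^g$ over $[t,u]$, with iterated Riemann–Stieltjes integrals. For a function $F$ on $\mathrm{BV}_t$, write $\partial^\eta_\gamma F(\gamma)=\lim_{\varepsilon\to0}\varepsilon^{-1}(F(\gamma+\varepsilon\eta)-F(\gamma))$ and $\partial^{\eta\bar\eta}_\gamma F=\partial^{\bar\eta}_\gamma(\partial^\eta_\gamma F)$. Then the following hold. 1. For all $t\le T$, all $\gamma,\eta,\bar\eta\in\mathrm{BV}_t$ and all $u\in[t,T]$: the path $\gamma^g$ is continuous and of bounded variation, $S(\gamma^g)_u$ is a well-defined element of $\overline{T(\mathcal{H}_g)}$, and the directional derivatives $\partial^\eta_\gamma G(\gamma)_u$, $\partial^{\eta\bar\eta}_\gamma G(\gamma)_u$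 in $\mathcal{H}_g$ and $\partial^\eta_\gamma S(\gamma^g)_u$, $\partial^{\eta\bar\eta}_\gamma S(\gamma^g)_u$ in $\overline{T(\mathcal{H}_g)}$ exist. They satisfy, with Riemann–Stieltjes integrals in $\overline{T(\mathcal{H}_g)}$ which exist, the linear controlled differential equations $$\partial^\eta_\gamma S(\gamma^g)_u=\int_t^u\partial^\eta_\gamma S(\gamma^g)_r\cdot d\gamma^g_r+\int_t^u S(\gamma^g)_r\cdot d\{\partial^\eta_\gamma G(\gamma)_r\},$$ $$\partial^{\eta\bar\eta}_\gamma S(\gamma^g)_u=\int_t^u\partial^{\eta\bar\eta}_\gamma S(\gamma^g)_r\cdot d\gamma^g_r+\int_t^u\partial^{\eta}_\gamma S(\gamma^g)_r\cdot d\{\partial^{\bar\eta}_\gamma G(\gamma)_r\}+\int_t^u\partial^{\bar\eta}_\gamma S(\gamma^g)_r\cdot d\{\partial^{\eta}_\gamma G(\gamma)_r\}+\int_t^u S(\gamma^g)_r\cdot d\{\partial^{\eta\bar\eta}_\gamma G(\gamma)_r\}.$$ 2. There are continuous functions $\overline{S_k}:\mathbb{R}_+^{k+1}\to\mathbb{R}_+$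 and $\overline{DS_k}:\mathbb{R}_+^{k+2}\to\mathbb{R}_+$, $k=0,1,2$, depending only on $g$, such that for all $t\le T$, all $\gamma,\bar\gamma,\eta,\bar\eta\in\mathrm{BV}_t$ and all $u\in[t,T]$, with norms in $\overline{T(\mathcal{H}_g)}$, $$\|S(\gamma^g)_u\|\le\overline{S_0}(|\gamma|_1),\qquad \|S(\gamma^g)_u-S(\bar\gamma^g)_u\|\le\|\gamma-\bar\gamma\|_0\,\overline{DS_0}(|\gamma|_1,|\bar\gamma|_1),$$ $$\|\partial^\eta_\gamma S(\gamma^g)_u\|\le\overline{S_1}(|\gamma|_1,\|\eta\|_1),\qquad \|\partial^\eta_\gamma S(\gamma^g)_u-\partial^\eta_\gamma S(\bar\gamma^g)_u\|\le\|\gamma-\bar\gamma\|_0\,\overline{DS_1}(|\gamma|_1,|\bar\gamma|_1,\|\eta\|_1),$$ $$\|\partial^{\eta\bar\eta}_\gamma S(\gamma^g)_u\|\le\overline{S_2}(|\gamma|_1,\|\eta\|_1,\|\bar\eta\|_1),\qquad \|\partial^{\eta\bar\eta}_\gamma S(\gamma^g)_u-\partial^{\eta\bar\eta}_\gamma S(\bar\gamma^g)_u\|\le\|\gamma-\bar\gamma\|_0\,\overline{DS_2}(|\gamma|_1,|\bar\gamma|_1,\|\eta\|_1,\|\bar\eta\|_1).$$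 3. On sets of bounded $1$-variation the signature and its first two derivatives are continuous in the uniform norm: if $\gamma,\gamma^n,\eta,\bar\eta\in\mathrm{BV}_t$, $\sup_n|\gamma^n|_1<\infty$ and $\|\gamma^n-\gamma\|_0\to0$, then $S((\gamma^n)^g)_u\to S(\gamma^g)_u$, $\partial^\eta_\gamma S((\gamma^n)^g)_u\to\partial^\eta_\gamma S(\gamma^g)_u$ and $\partial^{\eta\bar\eta}_\gamma S((\gamma^n)^g)_u\to\partial^{\eta\bar\eta}_\gamma S(\gamma^g)_u$, uniformly in $u\in[t,T]$. 4. The directional derivatives are Fréchet derivatives: for every $u\in[t,T]$ the map $\gamma\mapsto S(\gamma^g)_u$ is twice Fréchet differentiable on $(\mathrm{BV}_t,\|\cdot\|_1)$, with first derivative $\eta\mapsto\partial^\eta_\gamma S(\gamma^g)_u$ and second derivative $(\eta,\bar\eta)\mapsto\partial^{\eta\bar\eta}_\gamma S(\gamma^g)_u$. Moreover the remainders are small with respect to the uniform norm: for every $\gamma\in\mathrm{BV}_t$ and $\varepsilon>0$ there is $\delta>0$ such that for all $u\in[t,T]$ and $\eta,\bar\eta\in\mathrm{BV}_t$ with $\|\bar\eta\|_1<\delta$,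 $$\|S((\gamma+\bar\eta)^g)_u-S(\gamma^g)_u-\partial^{\bar\eta}_\gamma S(\gamma^g)_u\|\le\varepsilon\|\bar\eta\|_0,\qquad \|\partial^\eta_\gamma S((\gamma+\bar\eta)^g)_u-\partial^\eta_\gamma S(\gamma^g)_u-\partial^{\eta\bar\eta}_\gamma S(\gamma^g)_u\|\le\varepsilon\|\eta\|_1\|\bar\eta\|_0 .$$ -/

import Mathlib

open Set Filter Topology
open scoped NNReal ENNReal TensorProduct

noncomputable section

/-! ### Continuous paths of bounded variation on `[t, T]` -/

section Variation

variable {α E : Type*} [LinearOrder α] [NormedAddCommGroup E]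

theorem eVariationOn_add_le_add (f g : α → E) (s : Set α) :
    eVariationOn (f + g) s ≤ eVariationOn f s + eVariationOn g s := by
  refine iSup_le fun p => ?_
  calc ∑ i ∈ Finset.range p.1, edist ((f + g) (p.2.1 (i + 1))) ((f + g) (p.2.1 i))
      ≤ ∑ i ∈ Finset.range p.1, (edist (f (p.2.1 (i + 1))) (f (p.2.1 i))
          + edist (g (p.2.1 (i + 1))) (g (p.2.1 i))) :=
        Finset.sum_le_sum fun i _ => edist_add_add_le _ _ _ _
    _ ≤ eVariationOn f s + eVariationOn g s := by
        rw [Finset.sum_add_distrib]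
        exact add_le_add (eVariationOn.sum_le p.2.2.1 p.2.2.2)
          (eVariationOn.sum_le p.2.2.1 p.2.2.2)

theorem eVariationOn_const_smul_eq [NormedSpace ℝ E] (c : ℝ) (f : α → E) (s : Set α) :
    eVariationOn (c • f) s = ‖c‖ₑ * eVariationOn f s := by
  unfold eVariationOn
  rw [ENNReal.mul_iSup]
  refine iSup_congr fun p => ?_
  rw [Finset.mul_sum]
  refine Finset.sum_congr rfl fun i _ => ?_
  simp only [Pi.smul_apply, edist_eq_enorm_sub, ← smul_sub, enorm_smul]

end Variation

section Paths

variable (t T : ℝ) (E : Type*) [NormedAddCommGroup E] [NormedSpace ℝ E]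

/-- The linear space of continuous paths `[t, T] → E` of bounded variation. -/
def bvSubmodule : Submodule ℝ C(Icc t T, E) where
  carrier := {γ | BoundedVariationOn γ univ}
  zero_mem' := by
    change eVariationOn (fun _ : Icc t T => (0 : E)) univ ≠ ∞
    rw [eVariationOn.constant_on (by rintro _ ⟨_, _, rfl⟩ _ ⟨_, _, rfl⟩; rfl)]
    exact ENNReal.zero_ne_top
  add_mem' {γ η} hγ hη :=
    ne_top_of_le_ne_top (ENNReal.add_ne_top.2 ⟨hγ, hη⟩) (eVariationOn_add_le_add γ η univ)
  smul_mem' c γ hγ := by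
    change eVariationOn (c • (γ : Icc t T → E)) univ ≠ ∞
    rw [eVariationOn_const_smul_eq]
    exact ENNReal.mul_ne_top enorm_ne_top hγ

/-- The space `BV([t, T], E)` of continuous paths of bounded variation. It is a type of its own,
so that its norm is the 1-variation norm and not the uniform norm of `C([t, T], E)`. -/
def BVPath : Type _ := ↥(bvSubmodule t T E)

end Paths

namespace BVPath

variable {t T : ℝ} {E : Type*} [NormedAddCommGroup E] [NormedSpace ℝ E]

instance : AddCommGroup (BVPath t T E) := inferInstanceAs (AddCommGroup ↥(bvSubmodule t T E))

instance : Module ℝ (BVPath t T E) := inferInstanceAs (Module ℝ ↥(bvSubmodule t T E))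

/-- The underlying continuous map. -/
def toCM (γ : BVPath t T E) : C(Icc t T, E) := Subtype.val γ

instance : CoeFun (BVPath t T E) fun _ => Icc t T → E := ⟨fun γ => γ.toCM⟩

/-- The 1-variation seminorm `|γ|₁` on `[t, T]`. -/
def var (γ : BVPath t T E) : ℝ≥0 := (eVariationOn γ univ).toNNReal

/-- The uniform norm `‖γ‖₀ = sup_u |γ_u|` on `[t, T]`. -/
def supNorm (γ : BVPath t T E) : ℝ := ‖γ.toCM‖

theorem coe_var (γ : BVPath t T E) : (γ.var : ℝ≥0∞) = eVariationOn γ univ :=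
  ENNReal.coe_toNNReal γ.property

theorem var_add_le (γ η : BVPath t T E) : (γ + η).var ≤ γ.var + η.var := by
  rw [← ENNReal.coe_le_coe, ENNReal.coe_add, coe_var, coe_var, coe_var]
  exact eVariationOn_add_le_add γ η univ

theorem var_smul (c : ℝ) (γ : BVPath t T E) : (c • γ).var = ‖c‖₊ * γ.var := by
  rw [← ENNReal.coe_inj, ENNReal.coe_mul, coe_var, coe_var]
  exact eVariationOn_const_smul_eq c γ univ

variable [Fact (t ≤ T)]

/-- The 1-variation norm `‖γ‖₁ = |γ_t| + |γ|₁`. -/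
instance : Norm (BVPath t T E) := ⟨fun γ => ‖γ ⊥‖ + γ.var⟩

theorem norm_def (γ : BVPath t T E) : ‖γ‖ = ‖γ ⊥‖ + γ.var := rfl

theorem normedSpaceCore : NormedSpace.Core ℝ (BVPath t T E) where
  norm_nonneg γ := by rw [norm_def]; positivity
  norm_smul c γ := by
    have h : (c • γ) ⊥ = c • γ ⊥ := rfl
    rw [norm_def, norm_def, h, norm_smul, var_smul, NNReal.coe_mul, coe_nnnorm, mul_add]
  norm_triangle γ η := by
    have h : (γ + η) ⊥ = γ ⊥ + η ⊥ := rfl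
    have h₁ : ((γ + η).var : ℝ) ≤ γ.var + η.var := by exact_mod_cast var_add_le γ η
    rw [norm_def, norm_def, norm_def, h]
    linarith [norm_add_le (γ ⊥) (η ⊥)]
  norm_eq_zero_iff γ := by
    constructor
    · intro h
      rw [norm_def] at h
      have h₁ : ‖γ ⊥‖ = 0 := le_antisymm (by linarith [γ.var.coe_nonneg]) (norm_nonneg _)
      have h₂ : (γ.var : ℝ) = 0 := by linarith
      have h₃ : eVariationOn γ univ = 0 := by
        rw [← coe_var]; exact_mod_cast h₂
      apply Subtype.ext
      ext u
      have h₄ := (eVariationOn.eq_zero_iff γ).1 h₃ u (mem_univ _) ⊥ (mem_univ _)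
      have h₅ : γ u = γ ⊥ := edist_eq_zero.1 h₄
      exact h₅.trans (norm_eq_zero.1 h₁)
    · rintro rfl
      have h : (0 : BVPath t T E) ⊥ = (0 : E) := rfl
      have h₁ : (0 : BVPath t T E).var = 0 := by
        simpa using var_smul (0 : ℝ) (0 : BVPath t T E)
      rw [norm_def, h, h₁]
      simp

instance : NormedAddCommGroup (BVPath t T E) := NormedAddCommGroup.ofCore normedSpaceCore

instance : NormedSpace ℝ (BVPath t T E) := NormedSpace.ofCore normedSpaceCore

end BVPath

/-! ### The Riemann–Stieltjes integral -/

section RiemannStieltjes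

variable {t T : ℝ} [Fact (t ≤ T)] {F H K : Type*} [NormedAddCommGroup H] [NormedAddCommGroup K]

/-- `I` is the Riemann–Stieltjes integral `∫_t^u B(Y_r, dX_r)`: the sums
`∑ B(Y_{ξ_k}, X_{p_{k+1}} - X_{p_k})` over the tagged partitions `p` of `[t, u]` converge to `I`
as the mesh tends to `0`. -/
def IsRSIntegral (B : F → H → K) (Y : Icc t T → F) (X : Icc t T → H) (u : Icc t T) (I : K) :
    Prop :=
  ∀ ε > (0 : ℝ), ∃ δ > (0 : ℝ), ∀ (n : ℕ) (p ξ : ℕ → Icc t T), Monotone p → p 0 = ⊥ → p n = u →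
    (∀ k < n, p k ≤ ξ k ∧ ξ k ≤ p (k + 1) ∧ dist (p k) (p (k + 1)) < δ) →
    ‖∑ k ∈ Finset.range n, B (Y (ξ k)) (X (p (k + 1)) - X (p k)) - I‖ < ε

open Classical in
/-- The Riemann–Stieltjes integral `∫_t^u B(Y_r, dX_r)`, with value `0` if it does not exist. -/
def rsIntegral (B : F → H → K) (Y : Icc t T → F) (X : Icc t T → H) (u : Icc t T) : K :=
  if h : ∃ I, IsRSIntegral B Y X u I then h.choose else 0

end RiemannStieltjes

/-! ### The Hilbert space of tensor series and the signature -/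

/-- A real Hilbert space, bundled. -/
structure BundledHilbert where
  carrier : Type
  [normed : NormedAddCommGroup carrier]
  [inner : InnerProductSpace ℝ carrier]
  [complete : CompleteSpace carrier]

attribute [instance] BundledHilbert.normed BundledHilbert.inner BundledHilbert.complete

section Signature

variable (H : Type) [NormedAddCommGroup H] [InnerProductSpace ℝ H]

/-- The Hilbert tensor power `H^{⊗n}`: the completion of the `n`-fold tensor product for the
inner product `⟨a₁ ⊗ ⋯ ⊗ aₙ, b₁ ⊗ ⋯ ⊗ bₙ⟩ = ∏ ⟨aᵢ, bᵢ⟩`. -/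
def hilbertTensorPower : ℕ → BundledHilbert
  | 0 => ⟨ℝ⟩
  | n + 1 => ⟨UniformSpace.Completion ((hilbertTensorPower n).carrier ⊗[ℝ] H)⟩

/-- The underlying type of `H^{⊗n}`. -/
abbrev TensorLevel (n : ℕ) : Type := (hilbertTensorPower H n).carrier

/-- The Hilbert space `\overline{T(H)}`: the completion of the space of tensor polynomials for the
inner product `∑ₙ ⟨aₙ, bₙ⟩`, realised as the square-summable tensor series `(aₙ)` with
`aₙ ∈ H^{⊗n}`. -/
abbrev TensorHilbert : Type := lp (fun n : ℕ => TensorLevel H n) 2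

variable {H}

/-- The map `(a, h) ↦ a ⊗ h` from `H^{⊗n} × H` to `H^{⊗(n+1)}`. -/
def tensorRight (n : ℕ) (a : TensorLevel H n) (h : H) : TensorLevel H (n + 1) :=
  ((a ⊗ₜ[ℝ] h : TensorLevel H n ⊗[ℝ] H) :
    UniformSpace.Completion ((hilbertTensorPower H n).carrier ⊗[ℝ] H))

theorem norm_tensorRight (n : ℕ) (a : TensorLevel H n) (h : H) :
    ‖tensorRight n a h‖ = ‖a‖ * ‖h‖ := by
  refine (UniformSpace.Completion.norm_coe (E := TensorLevel H n ⊗[ℝ] H) _).trans ?_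
  exact TensorProduct.norm_tmul a h

/-- The coefficients of the product `(a₀, a₁, a₂, …) · (0, h, 0, …) = (0, a₀ ⊗ h, a₁ ⊗ h, …)`. -/
def mulVecCoeff (a : (n : ℕ) → TensorLevel H n) (h : H) : (n : ℕ) → TensorLevel H n
  | 0 => 0
  | n + 1 => tensorRight n (a n) h

theorem memℓp_mulVecCoeff (a : TensorHilbert H) (h : H) :
    Memℓp (mulVecCoeff (fun n => a n) h) 2 := by
  refine memℓp_gen ((summable_nat_add_iff 1).1 ?_)
  have ha : Summable fun n => ‖a n‖ ^ (2 : ℝ≥0∞).toReal :=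
    (lp.memℓp a).summable (by norm_num)
  refine (ha.mul_right (‖h‖ ^ (2 : ℝ≥0∞).toReal)).congr fun n => ?_
  change _ = ‖tensorRight n (a n) h‖ ^ (2 : ℝ≥0∞).toReal
  rw [norm_tensorRight, Real.mul_rpow (norm_nonneg _) (norm_nonneg _)]

/-- The product `a · h` in `\overline{T(H)}`, where `h ∈ H` is identified with `(0, h, 0, …)`. -/
def mulVec (a : TensorHilbert H) (h : H) : TensorHilbert H :=
  ⟨mulVecCoeff (fun n => a n) h, memℓp_mulVecCoeff a h⟩

variable {t T : ℝ} [Fact (t ≤ T)]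

/-- The `n`-th level of the signature of `X` over `[t, u]`: the iterated Riemann–Stieltjes integral
`∫_{t < r₁ < ⋯ < rₙ < u} dX_{r₁} ⊗ ⋯ ⊗ dX_{rₙ}`. -/
def sigLevel (X : Icc t T → H) : (n : ℕ) → Icc t T → TensorLevel H n
  | 0 => fun _ => (1 : ℝ)
  | n + 1 => fun u => rsIntegral (tensorRight n) (sigLevel X n) X u

open Classical in
/-- The signature `S(X)_u` of `X` over `[t, u]`, an element of `\overline{T(H)}`
(with value `0` if the levels are not square-summable). -/
def sig (X : Icc t T → H) (u : Icc t T) : TensorHilbert H :=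
  if h : Memℓp (fun n => sigLevel X n u) 2 then ⟨fun n => sigLevel X n u, h⟩ else 0

/-- The signature of `X` is well defined: every iterated integral exists, and the resulting tensor
series is square-summable. -/
def SigWellDefined (X : Icc t T → H) : Prop :=
  (∀ n u, IsRSIntegral (tensorRight n) (sigLevel X n) X u (sigLevel X (n + 1) u)) ∧
    ∀ u, Memℓp (fun n => sigLevel X n u) 2

end Signature

/-! ### Static kernels and lifted paths -/

section Kernel

variable {e : ℕ}

/-- The partial derivative of `f(x, y)` in the `i`-th coordinate of `x`. -/
def partialX (i : Fin e) (f : EuclideanSpace ℝ (Fin e) → EuclideanSpace ℝ (Fin e) → ℝ) :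
    EuclideanSpace ℝ (Fin e) → EuclideanSpace ℝ (Fin e) → ℝ :=
  fun x y => lineDeriv ℝ (fun z => f z y) x (EuclideanSpace.single i 1)

/-- The partial derivative of `f(x, y)` in the `i`-th coordinate of `y`. -/
def partialY (i : Fin e) (f : EuclideanSpace ℝ (Fin e) → EuclideanSpace ℝ (Fin e) → ℝ) :
    EuclideanSpace ℝ (Fin e) → EuclideanSpace ℝ (Fin e) → ℝ :=
  fun x y => lineDeriv ℝ (fun z => f x z) y (EuclideanSpace.single i 1)

/-- The mixed partial derivative `∂_{x^I} ∂_{y^J} g` for multi-indices `I`, `J`. -/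
def mixedPartial (g : EuclideanSpace ℝ (Fin e) → EuclideanSpace ℝ (Fin e) → ℝ)
    (I J : List (Fin e)) : EuclideanSpace ℝ (Fin e) → EuclideanSpace ℝ (Fin e) → ℝ :=
  I.foldr partialX (J.foldr partialY g)

/-- All the mixed partial derivatives `∂_{x^I} ∂_{y^J} g` with `|I|, |J| ≤ 4` exist, and
`sup_{x,y} (∑_{|I| = n, |J| = m} |∂_{x^I} ∂_{y^J} g(x, y)|²)^{1/2} < ∞` for all `n, m ≤ 4`. -/
structure IsBoundedFourTimesDiff
    (g : EuclideanSpace ℝ (Fin e) → EuclideanSpace ℝ (Fin e) → ℝ) : Prop where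
  diffY : ∀ J : List (Fin e), J.length < 4 → ∀ i x y,
    LineDifferentiableAt ℝ (fun z => mixedPartial g [] J x z) y (EuclideanSpace.single i 1)
  diffX : ∀ I J : List (Fin e), I.length < 4 → J.length ≤ 4 → ∀ i x y,
    LineDifferentiableAt ℝ (fun z => mixedPartial g I J z y) x (EuclideanSpace.single i 1)
  bounded : ∀ n ≤ 4, ∀ m ≤ 4,
    BddAbove (range fun p : EuclideanSpace ℝ (Fin e) × EuclideanSpace ℝ (Fin e) =>
      √(∑ I : Fin n → Fin e, ∑ J : Fin m → Fin e,
        |mixedPartial g (List.ofFn I) (List.ofFn J) p.1 p.2| ^ 2))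

variable (H : Type) [NormedAddCommGroup H] [InnerProductSpace ℝ H] [CompleteSpace H]
  [RKHS ℝ H (EuclideanSpace ℝ (Fin e)) ℝ]
  {t T : ℝ}

/-- The lift `G(γ) = γ^g` of a path, `γ^g_u = g(γ_u, ·) ∈ H`, where `H` is the reproducing kernel
Hilbert space of `g`. -/
def lift (γ : BVPath t T (EuclideanSpace ℝ (Fin e))) : Icc t T → H :=
  fun u => RKHS.kerFun H (γ u) 1

/-- The directional derivative `∂^η_γ G(γ)_u = lim (G(γ + ε η)_u - G(γ)_u) / ε`. -/
def dLift (γ η : BVPath t T (EuclideanSpace ℝ (Fin e))) : Icc t T → H :=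
  fun u => lineDeriv ℝ (fun γ' => lift H γ' u) γ η

/-- The second directional derivative `∂^{η η'}_γ G(γ)_u`. -/
def ddLift (γ η η' : BVPath t T (EuclideanSpace ℝ (Fin e))) : Icc t T → H :=
  fun u => lineDeriv ℝ (fun γ' => dLift H γ' η u) γ η'

variable [Fact (t ≤ T)]

/-- The signature `S(γ^g)_u` over `[t, u]` of the lifted path. -/
def liftSig (γ : BVPath t T (EuclideanSpace ℝ (Fin e))) (u : Icc t T) : TensorHilbert H :=
  sig (lift H γ) u

/-- The directional derivative
`∂^η_γ S(γ^g)_u = lim (S((γ + ε η)^g)_u - S(γ^g)_u) / ε` in `\overline{T(H)}`. -/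
def dSig (γ η : BVPath t T (EuclideanSpace ℝ (Fin e))) (u : Icc t T) : TensorHilbert H :=
  lineDeriv ℝ (fun γ' => liftSig H γ' u) γ η

/-- The second directional derivative `∂^{η η'}_γ S(γ^g)_u`. -/
def ddSig (γ η η' : BVPath t T (EuclideanSpace ℝ (Fin e))) (u : Icc t T) : TensorHilbert H :=
  lineDeriv ℝ (fun γ' => dSig H γ' η u) γ η'

end Kernel

end

/-!
The feature map `φ(x) = g(x, ·)` satisfies `⟨φ(x), φ(y)⟩ = g(x, y)`. Iterated differences of `φ`
therefore have a Gram matrix consisting of iterated differences of `g` in both variables, and the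
mean value inequality bounds these by the mixed partial derivatives
(`IsBoundedFourTimesDiff.exists_diffBound`). A map into a Hilbert space with bounded second
differences and weak partial derivatives has strong ones (`DiffBound.exists_partial`), so `φ` is
twice differentiable with Lipschitz continuous derivatives
(`IsBoundedFourTimesDiff.exists_hasLipDeriv₂`).

For a path `X` of bounded variation let `V_X Y = ∫ Y · dX` be the Volterra operator on continuous
paths in the tensor algebra. The Riemann–Stieltjes integral exists because the sums over two fine
partitions can be compared as double sums over pairs of intervals (`norm_sum_sub_sum_le`). Four
estimates are used: `‖V_X Y‖ ≤ |X|₁ ‖Y‖`; the variation of `V_X Y` is at most `|X|₁ ‖Y‖`; by parts,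
`‖V_X Y‖ ≤ ‖X‖₀ (2 ‖Y‖ + |Y|₁)`; and `‖V_X ^ n‖ ≤ 2 ^ (-n) exp (2 |X|₁)`, from a norm weighted by
the exponential of the variation. By the last one the Neumann series gives the resolvent
`R_X = (1 - V_X)⁻¹`, which solves linear controlled equations. The signature is
`S = R_X 1` (`sig_eq_sigPath`), as comparing levels shows.

With `X = φ(γ)`, `X_η = Dφ(γ)η` and `X_ηη' = D²φ(γ)(η', η)`, put `S_η = R_X V_{X_η} S` and
`S_ηη' = R_X (V_{X_η'} S_η + V_{X_η} S_η' + V_{X_ηη'} S)`. Differences of solutions for two paths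
`γ`, `γ'` solve linear equations again (`volterraResolvent_sub`), for instance
`S(γ') - S(γ) = R_X V_{φ(γ') - φ(γ)} S(γ')`. The differences of lifted paths and the Taylor
remainders of `φ` enter only as drivers of integrals of paths of bounded variation, so that by parts
only their uniform norms matter. This yields the Lipschitz estimates in the uniform norm, and
remainders of order `‖η‖₁ ‖η‖₀`, which make `S_η` and `S_ηη'` the Fréchet derivatives.
-/

/-! ### Controls -/

section Control

variable {t T : ℝ} {E : Type*} [NormedAddCommGroup E]

/-- `w` controls `f` if the increments of `f` are dominated by those of `w`; the variation function
of a path of bounded variation is the typical control. -/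
def Controls (w : Icc t T → ℝ) (f : Icc t T → E) : Prop :=
  ∀ a b, a ≤ b → ‖f b - f a‖ ≤ w b - w a

theorem Controls.monotone {w : Icc t T → ℝ} {f : Icc t T → E} (h : Controls w f) : Monotone w :=
  fun a b hab => sub_nonneg.1 ((norm_nonneg _).trans (h a b hab))

/-- The increment of `X` over the intersection of `[a, b]` and `[c, d]` is dominated by that of a
control. -/
theorem Controls.min_min {X : Icc t T → E} {w : Icc t T → ℝ} (hw : Controls w X)
    {a b c d : Icc t T} (hab : a ≤ b) (hcd : c ≤ d) :
    ‖(X (min b d) - X (min b c)) - (X (min a d) - X (min a c))‖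
      ≤ (w (min b d) - w (min b c)) - (w (min a d) - w (min a c)) := by
  rcases le_total b c with h | h
  · simp [min_eq_left h, min_eq_left (h.trans hcd), min_eq_left (hab.trans h),
      min_eq_left (hab.trans (h.trans hcd))]
  rcases le_total a c with h' | h'
  · rw [min_eq_right h, min_eq_left h', min_eq_left (h'.trans hcd)]
    simpa using hw _ _ (le_min h hcd)
  · rw [min_eq_right h, min_eq_right h']
    have := hw _ _ (min_le_min_right d hab)
    calc _ = ‖X (min b d) - X (min a d)‖ := by congr 1; abel
      _ ≤ _ := this
      _ = _ := by ring

theorem sub_min_min_eq_zero (X : Icc t T → E) {a b c d : Icc t T} (hab : a ≤ b) (hcd : c ≤ d)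
    (h : b ≤ c ∨ d ≤ a) : (X (min b d) - X (min b c)) - (X (min a d) - X (min a c)) = 0 := by
  rcases h with h | h
  · simp [min_eq_left h, min_eq_left (h.trans hcd), min_eq_left (hab.trans h),
      min_eq_left (hab.trans (h.trans hcd))]
  · simp [min_eq_right h, min_eq_right (h.trans hab), min_eq_right (hcd.trans h),
      min_eq_right ((hcd.trans h).trans hab)]

theorem dist_min_min_le (a b s : Icc t T) : dist (min a s) (min b s) ≤ dist a b := by
  simp only [Subtype.dist_eq, Real.dist_eq]
  have h : ∀ c : Icc t T, ((min c s : Icc t T) : ℝ) = min (c : ℝ) s := fun c =>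
    (Subtype.mono_coe (Icc t T)).map_min
  rw [h, h]
  exact abs_min_sub_min_le_max _ _ _ _ |>.trans (by simp)

theorem exists_modulus {Y : Icc t T → E} (hY : Continuous Y) {ε : ℝ} (hε : 0 < ε) :
    ∃ δ > 0, ∀ r s, dist r s < 2 * δ → ‖Y r - Y s‖ ≤ ε := by
  obtain ⟨δ, hδ, h⟩ := Metric.uniformContinuous_iff.1
    (CompactSpace.uniformContinuous_of_continuous hY) ε hε
  refine ⟨δ / 2, by positivity, fun r s hrs => ?_⟩
  rw [← dist_eq_norm]
  exact (h (by linarith)).le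

variable [Fact (t ≤ T)]

/-- The variation of `f` on `[t, T]` is at most `c`, expressed by the existence of a control of
total mass at most `c`. -/
def VarLE (f : Icc t T → E) (c : ℝ) : Prop :=
  ∃ w : Icc t T → ℝ, Controls w f ∧ w ⊥ = 0 ∧ w ⊤ ≤ c

theorem VarLE.mono {f : Icc t T → E} {c d : ℝ} (h : VarLE f c) (hcd : c ≤ d) : VarLE f d :=
  let ⟨w, h₁, h₂, h₃⟩ := h
  ⟨w, h₁, h₂, h₃.trans hcd⟩

theorem VarLE.nonneg {f : Icc t T → E} {c : ℝ} (h : VarLE f c) : 0 ≤ c := by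
  obtain ⟨w, h₁, h₂, h₃⟩ := h
  linarith [h₁.monotone (bot_le : (⊥ : Icc t T) ≤ ⊤)]

theorem VarLE.add {f g : Icc t T → E} {c d : ℝ} (hf : VarLE f c) (hg : VarLE g d) :
    VarLE (fun u => f u + g u) (c + d) := by
  obtain ⟨w, h₁, h₂, h₃⟩ := hf
  obtain ⟨v, k₁, k₂, k₃⟩ := hg
  refine ⟨fun u => w u + v u, fun a b hab => ?_, by simp [h₂, k₂], add_le_add h₃ k₃⟩
  calc ‖f b + g b - (f a + g a)‖ = ‖(f b - f a) + (g b - g a)‖ := by congr 1; abel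
    _ ≤ ‖f b - f a‖ + ‖g b - g a‖ := norm_add_le _ _
    _ ≤ _ := by linarith [h₁ a b hab, k₁ a b hab]

theorem varLE_const (c : E) : VarLE (fun _ : Icc t T => c) 0 :=
  ⟨fun _ => 0, fun _ _ _ => by simp, rfl, le_rfl⟩

theorem VarLE.sum_le {f : Icc t T → E} {c : ℝ} (h : VarLE f c) (n : ℕ) {p : ℕ → Icc t T}
    (hp : Monotone p) : ∑ k ∈ Finset.range n, ‖f (p (k + 1)) - f (p k)‖ ≤ c := by
  obtain ⟨w, h₁, h₂, h₃⟩ := h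
  calc ∑ k ∈ Finset.range n, ‖f (p (k + 1)) - f (p k)‖
      ≤ ∑ k ∈ Finset.range n, (w (p (k + 1)) - w (p k)) :=
        Finset.sum_le_sum fun k _ => h₁ _ _ (hp k.le_succ)
    _ = w (p n) - w (p 0) := Finset.sum_range_sub (fun k => w (p k)) n
    _ ≤ c := by linarith [h₁.monotone (bot_le : ⊥ ≤ p 0), h₁.monotone (le_top : p n ≤ ⊤)]

theorem VarLE.eVariationOn_le {f : Icc t T → E} {c : ℝ} (h : VarLE f c) :
    eVariationOn f univ ≤ ENNReal.ofReal c := by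
  refine iSup_le fun p => ?_
  simp only [edist_eq_enorm_sub, ← ofReal_norm]
  rw [← ENNReal.ofReal_sum_of_nonneg fun _ _ => norm_nonneg _]
  exact ENNReal.ofReal_le_ofReal (h.sum_le p.1 p.2.2.1)

theorem VarLE.boundedVariationOn {f : Icc t T → E} {c : ℝ} (h : VarLE f c) :
    BoundedVariationOn f univ :=
  ne_top_of_le_ne_top ENNReal.ofReal_ne_top h.eVariationOn_le

/-- A path of bounded variation is controlled by its variation function. -/
theorem varLE_of_boundedVariationOn {f : Icc t T → E} (h : BoundedVariationOn f univ) :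
    VarLE f (eVariationOn f univ).toReal := by
  refine ⟨variationOnFromTo f univ ⊥, fun a b hab => ?_, variationOnFromTo.self f univ ⊥, ?_⟩
  · have hl := h.locallyBoundedVariationOn
    have h₁ := variationOnFromTo.add hl (mem_univ (⊥ : Icc t T)) (mem_univ a) (mem_univ b)
    have h₂ : ‖f b - f a‖ ≤ variationOnFromTo f univ a b := by
      rw [variationOnFromTo.eq_of_le f univ hab, ← dist_eq_norm]
      exact (h.mono (inter_subset_left (t := Icc a b))).dist_le
        ⟨mem_univ _, hab, le_rfl⟩ ⟨mem_univ _, le_rfl, hab⟩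
    linarith
  · rw [variationOnFromTo.eq_of_le f univ bot_le]
    exact ENNReal.toReal_mono h (eVariationOn.mono f inter_subset_left)

end Control

/-! ### Existence of the Riemann–Stieltjes integral -/

section Existence

variable {t T : ℝ} [Fact (t ≤ T)] {F H K : Type*} [NormedAddCommGroup H] [NormedAddCommGroup K]

/-- `p`, with tags `ξ`, is a partition of `[t, u]` into `n` intervals shorter than `δ`. -/
structure IsFinePartition (p ξ : ℕ → Icc t T) (n : ℕ) (u : Icc t T) (δ : ℝ) : Prop where
  mono : Monotone p
  zero : p 0 = ⊥
  last : p n = u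
  tag : ∀ k < n, p k ≤ ξ k ∧ ξ k ≤ p (k + 1) ∧ dist (p k) (p (k + 1)) < δ

theorem IsFinePartition.of_le {p ξ : ℕ → Icc t T} {n : ℕ} {u : Icc t T} {δ δ' : ℝ}
    (h : IsFinePartition p ξ n u δ) (hδ : δ ≤ δ') : IsFinePartition p ξ n u δ' :=
  ⟨h.mono, h.zero, h.last, fun k hk =>
    ⟨(h.tag k hk).1, (h.tag k hk).2.1, (h.tag k hk).2.2.trans_le hδ⟩⟩

/-- A fine partition of `[t, u]`, stopped at `s ≤ u`, is a fine partition of `[t, s]`. -/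
theorem IsFinePartition.truncate {p : ℕ → Icc t T} {n : ℕ} {u s : Icc t T} {δ : ℝ}
    (h : IsFinePartition p p n u δ) (hs : s ≤ u) :
    IsFinePartition (fun k => min (p k) s) (fun k => min (p k) s) n s δ where
  mono a b hab := min_le_min_right s (h.mono hab)
  zero := by simp [h.zero]
  last := by simp [h.last, hs]
  tag k hk := ⟨le_rfl, min_le_min_right s (h.mono k.le_succ),
    (dist_min_min_le _ _ _).trans_lt (h.tag k hk).2.2⟩

variable (t T) in
theorem exists_isFinePartition_top {δ : ℝ} (hδ : 0 < δ) :
    ∃ (p : ℕ → Icc t T) (n : ℕ), IsFinePartition p p n ⊤ δ := by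
  have hT : t ≤ T := Fact.out
  obtain ⟨n, hn⟩ := exists_nat_gt ((T - t) / δ)
  have hn0 : (0 : ℝ) < n := lt_of_le_of_lt (div_nonneg (sub_nonneg.2 hT) hδ.le) hn
  have hstep : 0 ≤ (T - t) / n := div_nonneg (sub_nonneg.2 hT) hn0.le
  have hmono : Monotone fun k : ℕ => projIcc t T hT (t + k * ((T - t) / n)) := fun a b hab =>
    monotone_projIcc hT (by gcongr)
  refine ⟨fun k => projIcc t T hT (t + k * ((T - t) / n)), n, hmono, ?_, ?_, fun k _ =>
    ⟨le_rfl, hmono k.le_succ, ?_⟩⟩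
  · simp only [Nat.cast_zero, zero_mul, add_zero]
    exact projIcc_left hT
  · have : t + n * ((T - t) / n) = T := by field_simp; ring
    simp only [this]
    exact projIcc_right hT
  · have h₁ : dist (projIcc t T hT (t + k * ((T - t) / n)))
        (projIcc t T hT (t + (k + 1 : ℕ) * ((T - t) / n))) ≤ (T - t) / n := by
      refine ((LipschitzWith.projIcc hT).dist_le_mul _ _).trans ?_
      rw [NNReal.coe_one, one_mul, Real.dist_eq, abs_le]
      push_cast
      constructor <;> linarith
    refine h₁.trans_lt ?_
    rw [div_lt_iff₀ hn0]
    rw [div_lt_iff₀ hδ] at hn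
    linarith

theorem exists_isFinePartition (u : Icc t T) {δ : ℝ} (hδ : 0 < δ) :
    ∃ (p : ℕ → Icc t T) (n : ℕ), IsFinePartition p p n u δ := by
  obtain ⟨p, n, h⟩ := exists_isFinePartition_top t T hδ
  exact ⟨_, n, h.truncate le_top⟩

/-- An increment of `X` over an interval of a partition `p`, distributed over the intervals of a
second partition `q`. -/
theorem IsFinePartition.increment_eq_sum {p ξ q ζ : ℕ → Icc t T} {n m : ℕ} {u : Icc t T} {δ : ℝ}
    (hp : IsFinePartition p ξ n u δ) (hq : IsFinePartition q ζ m u δ) (X : Icc t T → H) {k : ℕ}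
    (hk : k < n) :
    X (p (k + 1)) - X (p k) = ∑ j ∈ Finset.range m,
      ((X (min (q (j + 1)) (p (k + 1))) - X (min (q (j + 1)) (p k)))
        - (X (min (q j) (p (k + 1))) - X (min (q j) (p k)))) := by
  rw [Finset.sum_range_sub (fun j => X (min (q j) (p (k + 1))) - X (min (q j) (p k)))]
  have h₁ : p (k + 1) ≤ u := hp.last ▸ hp.mono hk
  have h₂ : p k ≤ u := hp.last ▸ hp.mono hk.le
  simp [hq.zero, hq.last, h₁, h₂]

theorem IsRSIntegral.unique {B : F → H → K} {X : Icc t T → H} {Y : Icc t T → F} {u : Icc t T}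
    {I J : K} (hI : IsRSIntegral B Y X u I) (hJ : IsRSIntegral B Y X u J) : I = J := by
  by_contra hne
  have hpos : 0 < ‖I - J‖ := norm_pos_iff.2 (sub_ne_zero.2 hne)
  obtain ⟨δ₁, h₁, k₁⟩ := hI (‖I - J‖ / 2) (by linarith)
  obtain ⟨δ₂, h₂, k₂⟩ := hJ (‖I - J‖ / 2) (by linarith)
  obtain ⟨p, n, hp⟩ := exists_isFinePartition u (lt_min h₁ h₂)
  have hp₁ := hp.of_le (min_le_left δ₁ δ₂)
  have hp₂ := hp.of_le (min_le_right δ₁ δ₂)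
  have a₁ := k₁ n p p hp.mono hp.zero hp.last hp₁.tag
  have a₂ := k₂ n p p hp.mono hp.zero hp.last hp₂.tag
  have := norm_sub_le_norm_sub_add_norm_sub I
    (∑ k ∈ Finset.range n, B (Y (p k)) (X (p (k + 1)) - X (p k))) J
  rw [norm_sub_rev I (Finset.sum _ _)] at this
  linarith

theorem IsRSIntegral.rsIntegral_eq {B : F → H → K} {X : Icc t T → H} {Y : Icc t T → F}
    {u : Icc t T} {I : K} (hI : IsRSIntegral B Y X u I) : rsIntegral B Y X u = I := by
  have h : ∃ I, IsRSIntegral B Y X u I := ⟨I, hI⟩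
  rw [rsIntegral, dif_pos h]
  exact h.choose_spec.unique hI

variable [NormedAddCommGroup F] [NormedSpace ℝ F] [NormedSpace ℝ H] [NormedSpace ℝ K]

/-- The two sums over a pair of partitions with tags that are close on overlapping intervals differ
little: write both as double sums over pairs of intervals. -/
theorem norm_sum_sub_sum_le {B : F →L[ℝ] H →L[ℝ] K} (hB : ∀ a h, ‖B a h‖ ≤ ‖a‖ * ‖h‖)
    {X : Icc t T → H} {w : Icc t T → ℝ} (hw : Controls w X) {Y : Icc t T → F}
    {p ξ q ζ : ℕ → Icc t T} {n m : ℕ} {u : Icc t T} {δ ε : ℝ}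
    (hp : IsFinePartition p ξ n u δ) (hq : IsFinePartition q ζ m u δ)
    (hY : ∀ r s, dist r s < 2 * δ → ‖Y r - Y s‖ ≤ ε) :
    ‖∑ k ∈ Finset.range n, B (Y (ξ k)) (X (p (k + 1)) - X (p k))
      - ∑ j ∈ Finset.range m, B (Y (ζ j)) (X (q (j + 1)) - X (q j))‖ ≤ ε * (w u - w ⊥) := by
  set D : ℕ → ℕ → H := fun j k => (X (min (q (j + 1)) (p (k + 1))) - X (min (q (j + 1)) (p k)))
        - (X (min (q j) (p (k + 1))) - X (min (q j) (p k))) with hD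
  set Dw : ℕ → ℕ → ℝ := fun j k => (w (min (q (j + 1)) (p (k + 1))) - w (min (q (j + 1)) (p k)))
        - (w (min (q j) (p (k + 1))) - w (min (q j) (p k))) with hDw
  have e₁ : ∑ k ∈ Finset.range n, B (Y (ξ k)) (X (p (k + 1)) - X (p k))
      = ∑ k ∈ Finset.range n, ∑ j ∈ Finset.range m, B (Y (ξ k)) (D j k) :=
    Finset.sum_congr rfl fun k hk => by
      rw [hp.increment_eq_sum hq X (Finset.mem_range.1 hk), map_sum]
  have e₂ : ∑ j ∈ Finset.range m, B (Y (ζ j)) (X (q (j + 1)) - X (q j))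
      = ∑ k ∈ Finset.range n, ∑ j ∈ Finset.range m, B (Y (ζ j)) (D j k) := by
    rw [Finset.sum_comm]
    refine Finset.sum_congr rfl fun j hj => ?_
    rw [hq.increment_eq_sum hp X (Finset.mem_range.1 hj), map_sum]
    refine Finset.sum_congr rfl fun k _ => ?_
    simp only [hD, min_comm (p _)]
    congr 1
    abel
  have e₃ : ∑ k ∈ Finset.range n, ∑ j ∈ Finset.range m, Dw j k = w u - w ⊥ := by
    calc ∑ k ∈ Finset.range n, ∑ j ∈ Finset.range m, Dw j k
        = ∑ k ∈ Finset.range n, (w (p (k + 1)) - w (p k)) :=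
          Finset.sum_congr rfl fun k hk =>
            (hp.increment_eq_sum hq w (Finset.mem_range.1 hk)).symm
      _ = w u - w ⊥ := by
          rw [Finset.sum_range_sub (fun k => w (p k)), hp.zero, hp.last]
  rw [e₁, e₂, ← Finset.sum_sub_distrib, ← e₃, Finset.mul_sum]
  refine norm_sum_le_of_le _ fun k hk => ?_
  rw [← Finset.sum_sub_distrib, Finset.mul_sum]
  refine norm_sum_le_of_le _ fun j hj => ?_
  rw [← sub_apply, ← map_sub]
  have hq' := hq.mono j.le_succ
  have hp' := hp.mono k.le_succ
  have hDle : ‖D j k‖ ≤ Dw j k := hw.min_min hq' hp'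
  by_cases h : q (j + 1) ≤ p k ∨ p (k + 1) ≤ q j
  · have h₁ : D j k = 0 := sub_min_min_eq_zero X hq' hp' h
    have h₂ : Dw j k = 0 := sub_min_min_eq_zero w hq' hp' h
    simp [h₁, h₂]
  · push Not at h
    have hε : ‖Y (ξ k) - Y (ζ j)‖ ≤ ε := by
      apply hY
      obtain ⟨a₁, a₂, a₃⟩ := hp.tag k (Finset.mem_range.1 hk)
      obtain ⟨b₁, b₂, b₃⟩ := hq.tag j (Finset.mem_range.1 hj)
      have c₁ : (p k : ℝ) < q (j + 1) := h.1
      have c₂ : (q j : ℝ) < p (k + 1) := h.2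
      have a₁' : (p k : ℝ) ≤ ξ k := a₁
      have a₂' : (ξ k : ℝ) ≤ p (k + 1) := a₂
      have b₁' : (q j : ℝ) ≤ ζ j := b₁
      have b₂' : (ζ j : ℝ) ≤ q (j + 1) := b₂
      rw [Subtype.dist_eq, Real.dist_eq, abs_lt] at a₃ b₃ ⊢
      constructor <;> linarith
    exact (hB _ _).trans (mul_le_mul hε hDle (norm_nonneg _) ((norm_nonneg _).trans hε))

/-- The Riemann–Stieltjes sums converge, uniformly in the endpoint `u`. -/
theorem exists_isRSIntegral_uniform [CompleteSpace K] {B : F →L[ℝ] H →L[ℝ] K}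
    (hB : ∀ a h, ‖B a h‖ ≤ ‖a‖ * ‖h‖) {X : Icc t T → H} {c : ℝ} (hX : VarLE X c)
    {Y : Icc t T → F} (hY : Continuous Y) :
    ∃ J : Icc t T → K, ∀ ε > 0, ∃ δ > 0, ∀ u p ξ n, IsFinePartition p ξ n u δ →
      ‖∑ k ∈ Finset.range n, B (Y (ξ k)) (X (p (k + 1)) - X (p k)) - J u‖ < ε := by
  obtain ⟨w, hw, hw₀, hwc⟩ := hX
  have hcauchy : ∀ ε > 0, ∃ δ > 0, ∀ (u : Icc t T) p ξ n q ζ m, IsFinePartition p ξ n u δ →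
      IsFinePartition q ζ m u δ →
      ‖∑ k ∈ Finset.range n, B (Y (ξ k)) (X (p (k + 1)) - X (p k))
        - ∑ j ∈ Finset.range m, B (Y (ζ j)) (X (q (j + 1)) - X (q j))‖ < ε := by
    intro ε hε
    have hc : 0 ≤ c := VarLE.nonneg ⟨w, hw, hw₀, hwc⟩
    obtain ⟨δ, hδ, h⟩ := exists_modulus hY (ε := ε / (c + 1)) (by positivity)
    refine ⟨δ, hδ, fun u p ξ n q ζ m hp hq =>
      (norm_sum_sub_sum_le hB hw hp hq h).trans_lt ?_⟩
    calc ε / (c + 1) * (w u - w ⊥) ≤ ε / (c + 1) * c := by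
          gcongr
          linarith [hw.monotone (le_top : u ≤ ⊤)]
      _ < ε / (c + 1) * (c + 1) := by gcongr; linarith
      _ = ε := by field_simp
  choose p n hp using fun (u : Icc t T) (N : ℕ) =>
    exists_isFinePartition u (δ := 1 / ((N : ℝ) + 1)) (by positivity)
  set S : Icc t T → ℕ → K := fun u N => ∑ k ∈ Finset.range (n u N),
    B (Y (p u N k)) (X (p u N (k + 1)) - X (p u N k)) with hS
  have hfine : ∀ δ > 0, ∃ N₀ : ℕ, ∀ N ≥ N₀, ∀ u, IsFinePartition (p u N) (p u N) (n u N) u δ := by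
    intro δ hδ
    obtain ⟨N₀, hN₀⟩ := exists_nat_one_div_lt hδ
    exact ⟨N₀, fun N hN u => (hp u N).of_le
      ((one_div_le_one_div_of_le (by positivity) (by gcongr)).trans hN₀.le)⟩
  have hlim : ∀ u, ∃ J, Tendsto (S u) atTop (𝓝 J) := fun u => by
    refine cauchySeq_tendsto_of_complete (Metric.cauchySeq_iff.2 fun ε hε => ?_)
    obtain ⟨δ, hδ, h⟩ := hcauchy ε hε
    obtain ⟨N₀, hN₀⟩ := hfine δ hδ
    refine ⟨N₀, fun a ha b hb => ?_⟩
    rw [dist_eq_norm]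
    exact h u _ _ _ _ _ _ (hN₀ a ha u) (hN₀ b hb u)
  choose J hJ using hlim
  refine ⟨J, fun ε hε => ?_⟩
  obtain ⟨δ, hδ, h⟩ := hcauchy (ε / 2) (by positivity)
  obtain ⟨N₀, hN₀⟩ := hfine δ hδ
  refine ⟨δ, hδ, fun u q ζ m hq => lt_of_le_of_lt ?_ (half_lt_self hε)⟩
  have hlim' := (tendsto_const_nhds (x := ∑ k ∈ Finset.range m,
    B (Y (ζ k)) (X (q (k + 1)) - X (q k)))).sub (hJ u)
  refine le_of_tendsto hlim'.norm (eventually_atTop.2 ⟨N₀, fun N hN => ?_⟩)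
  exact (h u _ _ _ _ _ _ hq (hN₀ N hN u)).le

/-- The Riemann–Stieltjes sums of a continuous integrand against a path of bounded variation
converge to `rsIntegral`, uniformly in the endpoint `u`. -/
theorem rsIntegral_uniform [CompleteSpace K] {B : F →L[ℝ] H →L[ℝ] K}
    (hB : ∀ a h, ‖B a h‖ ≤ ‖a‖ * ‖h‖) {X : Icc t T → H} {c : ℝ} (hX : VarLE X c)
    {Y : Icc t T → F} (hY : Continuous Y) :
    ∀ ε > 0, ∃ δ > 0, ∀ u p ξ n, IsFinePartition p ξ n u δ →
      ‖∑ k ∈ Finset.range n, B (Y (ξ k)) (X (p (k + 1)) - X (p k))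
        - rsIntegral (fun a h => B a h) Y X u‖ < ε := by
  obtain ⟨J, hJ⟩ := exists_isRSIntegral_uniform hB hX hY
  have hJ' : ∀ u, rsIntegral (fun a h => B a h) Y X u = J u := fun u => by
    refine IsRSIntegral.rsIntegral_eq fun ε hε => ?_
    obtain ⟨δ, hδ, h⟩ := hJ ε hε
    exact ⟨δ, hδ, fun n p ξ h₁ h₂ h₃ h₄ => h u p ξ n ⟨h₁, h₂, h₃, h₄⟩⟩
  simpa only [hJ'] using hJ

theorem isRSIntegral_rsIntegral [CompleteSpace K] {B : F →L[ℝ] H →L[ℝ] K}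
    (hB : ∀ a h, ‖B a h‖ ≤ ‖a‖ * ‖h‖) {X : Icc t T → H} {c : ℝ} (hX : VarLE X c)
    {Y : Icc t T → F} (hY : Continuous Y) (u : Icc t T) :
    IsRSIntegral (fun a h => B a h) Y X u (rsIntegral (fun a h => B a h) Y X u) := by
  intro ε hε
  obtain ⟨δ, hδ, h⟩ := rsIntegral_uniform hB hX hY ε hε
  exact ⟨δ, hδ, fun n p ξ h₁ h₂ h₃ h₄ => h u p ξ n ⟨h₁, h₂, h₃, h₄⟩⟩

end Existence

/-! ### Estimates for the Riemann–Stieltjes integral -/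

section Estimates

variable {t T : ℝ} [Fact (t ≤ T)] {F H K : Type*} [NormedAddCommGroup H] [NormedAddCommGroup K]

/-- A bound for all left-point sums is a bound for the integral. -/
theorem IsRSIntegral.norm_le {B : F → H → K} {X : Icc t T → H} {Y : Icc t T → F} {u : Icc t T}
    {I : K} {C : ℝ} (hI : IsRSIntegral B Y X u I)
    (hC : ∀ n p, Monotone p → p 0 = ⊥ → p n = u →
      ‖∑ k ∈ Finset.range n, B (Y (p k)) (X (p (k + 1)) - X (p k))‖ ≤ C) : ‖I‖ ≤ C := by
  refine le_of_forall_pos_le_add fun ε hε => ?_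
  obtain ⟨δ, hδ, h⟩ := hI ε hε
  obtain ⟨p, n, hp⟩ := exists_isFinePartition u hδ
  have h₁ := h n p p hp.mono hp.zero hp.last hp.tag
  have h₂ := hC n p hp.mono hp.zero hp.last
  set s := ∑ k ∈ Finset.range n, B (Y (p k)) (X (p (k + 1)) - X (p k))
  have h₃ := norm_le_norm_add_norm_sub s I
  linarith

/-- Riemann–Stieltjes integrals are mapped to each other by a continuous linear map that intertwines
the integrands. -/
theorem IsRSIntegral.map [NormedSpace ℝ K] {F' H' K' : Type*} [NormedAddCommGroup H']
    [NormedAddCommGroup K'] [NormedSpace ℝ K'] {A : F → H → K} {A' : F' → H' → K'}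
    {X : Icc t T → H} {Y : Icc t T → F}
    {X' : Icc t T → H'} {Y' : Icc t T → F'} {u : Icc t T} {I : K}
    (hI : IsRSIntegral A Y X u I) (P : K →L[ℝ] K')
    (hP : ∀ r a b, P (A (Y r) (X b - X a)) = A' (Y' r) (X' b - X' a)) :
    IsRSIntegral A' Y' X' u (P I) := by
  intro ε hε
  obtain ⟨δ, hδ, h⟩ := hI (ε / (‖P‖ + 1)) (by positivity)
  refine ⟨δ, hδ, fun n p ξ hp h0 hn ht => ?_⟩
  have h₁ := h n p ξ hp h0 hn ht
  simp only [← hP]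
  rw [← map_sum, ← map_sub]
  calc ‖P _‖ ≤ ‖P‖ * ‖_‖ := P.le_opNorm _
    _ ≤ (‖P‖ + 1) * ‖_‖ := by gcongr; linarith
    _ < (‖P‖ + 1) * (ε / (‖P‖ + 1)) := by gcongr
    _ = ε := by field_simp

variable [NormedAddCommGroup F] [NormedSpace ℝ F] [NormedSpace ℝ H] [NormedSpace ℝ K]
  {B : F →L[ℝ] H →L[ℝ] K}

theorem IsRSIntegral.add_left {X : Icc t T → H} {Y Z : Icc t T → F} {u : Icc t T} {I J : K}
    (hI : IsRSIntegral (fun a h => B a h) Y X u I) (hJ : IsRSIntegral (fun a h => B a h) Z X u J) :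
    IsRSIntegral (fun a h => B a h) (fun r => Y r + Z r) X u (I + J) := by
  intro ε hε
  obtain ⟨δ₁, h₁, k₁⟩ := hI (ε / 2) (by linarith)
  obtain ⟨δ₂, h₂, k₂⟩ := hJ (ε / 2) (by linarith)
  refine ⟨min δ₁ δ₂, lt_min h₁ h₂, fun n p ξ hp h0 hn ht => ?_⟩
  have a₁ := k₁ n p ξ hp h0 hn fun k hk =>
    ⟨(ht k hk).1, (ht k hk).2.1, (ht k hk).2.2.trans_le (min_le_left _ _)⟩
  have a₂ := k₂ n p ξ hp h0 hn fun k hk =>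
    ⟨(ht k hk).1, (ht k hk).2.1, (ht k hk).2.2.trans_le (min_le_right _ _)⟩
  simp only [map_add, add_apply, Finset.sum_add_distrib]
  rw [add_sub_add_comm]
  exact (norm_add_le _ _).trans_lt (by linarith)

theorem IsRSIntegral.add_right {X Z : Icc t T → H} {Y : Icc t T → F} {u : Icc t T} {I J : K}
    (hI : IsRSIntegral (fun a h => B a h) Y X u I) (hJ : IsRSIntegral (fun a h => B a h) Y Z u J) :
    IsRSIntegral (fun a h => B a h) Y (fun r => X r + Z r) u (I + J) := by
  intro ε hε
  obtain ⟨δ₁, h₁, k₁⟩ := hI (ε / 2) (by linarith)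
  obtain ⟨δ₂, h₂, k₂⟩ := hJ (ε / 2) (by linarith)
  refine ⟨min δ₁ δ₂, lt_min h₁ h₂, fun n p ξ hp h0 hn ht => ?_⟩
  have a₁ := k₁ n p ξ hp h0 hn fun k hk =>
    ⟨(ht k hk).1, (ht k hk).2.1, (ht k hk).2.2.trans_le (min_le_left _ _)⟩
  have a₂ := k₂ n p ξ hp h0 hn fun k hk =>
    ⟨(ht k hk).1, (ht k hk).2.1, (ht k hk).2.2.trans_le (min_le_right _ _)⟩
  simp only [add_sub_add_comm, map_add, Finset.sum_add_distrib]
  exact (norm_add_le _ _).trans_lt (by linarith)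

theorem IsRSIntegral.const_smul_left {X : Icc t T → H} {Y : Icc t T → F} {u : Icc t T} {I : K}
    (hI : IsRSIntegral (fun a h => B a h) Y X u I) (c : ℝ) :
    IsRSIntegral (fun a h => B a h) (fun r => c • Y r) X u (c • I) :=
  hI.map (c • ContinuousLinearMap.id ℝ K) fun r a b => by simp

theorem IsRSIntegral.const_smul_right {X : Icc t T → H} {Y : Icc t T → F} {u : Icc t T} {I : K}
    (hI : IsRSIntegral (fun a h => B a h) Y X u I) (c : ℝ) :
    IsRSIntegral (fun a h => B a h) Y (fun r => c • X r) u (c • I) :=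
  hI.map (c • ContinuousLinearMap.id ℝ K) fun r a b => by simp [smul_sub]

/-- If `‖Y‖ ≤ f(w)` with `f` the derivative of `Φ` and `f` increasing, then
`‖∫_t^u Y dX‖ ≤ Φ(w(u)) - Φ(w(t))`. -/
theorem IsRSIntegral.norm_le_of_control (hB : ∀ a h, ‖B a h‖ ≤ ‖a‖ * ‖h‖) {X : Icc t T → H}
    {w : Icc t T → ℝ} (hw : Controls w X) {Y : Icc t T → F} {f Φ : ℝ → ℝ}
    (hf : ∀ x y, x ≤ y → f x * (y - x) ≤ Φ y - Φ x) (hY : ∀ r, ‖Y r‖ ≤ f (w r)) {u : Icc t T}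
    {I : K} (hI : IsRSIntegral (fun a h => B a h) Y X u I) : ‖I‖ ≤ Φ (w u) - Φ (w ⊥) := by
  refine hI.norm_le fun n p hp h0 hn => ?_
  calc ‖∑ k ∈ Finset.range n, B (Y (p k)) (X (p (k + 1)) - X (p k))‖
      ≤ ∑ k ∈ Finset.range n, (Φ (w (p (k + 1))) - Φ (w (p k))) :=
        norm_sum_le_of_le _ fun k _ => by
          have h₁ := hw _ _ (hp k.le_succ)
          have h₂ := hw.monotone (hp k.le_succ)
          exact ((hB _ _).trans (mul_le_mul (hY _) h₁ (norm_nonneg _)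
            ((norm_nonneg _).trans (hY _)))).trans (hf _ _ h₂)
    _ = Φ (w u) - Φ (w ⊥) := by
        rw [Finset.sum_range_sub (fun k => Φ (w (p k))), h0, hn]

theorem IsRSIntegral.norm_le_mul (hB : ∀ a h, ‖B a h‖ ≤ ‖a‖ * ‖h‖) {X : Icc t T → H}
    {c : ℝ} (hX : VarLE X c) {Y : Icc t T → F} {M : ℝ} (hY : ∀ r, ‖Y r‖ ≤ M) {u : Icc t T}
    {I : K} (hI : IsRSIntegral (fun a h => B a h) Y X u I) : ‖I‖ ≤ c * M := by
  obtain ⟨w, hw, h0, hc⟩ := hX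
  have hM : 0 ≤ M := (norm_nonneg _).trans (hY u)
  have := hI.norm_le_of_control hB hw (f := fun _ => M) (Φ := fun x => x * M)
    (fun x y _ => by linarith) hY
  have h₁ := hw.monotone (le_top : u ≤ ⊤)
  rw [h0] at this
  nlinarith

/-- Integration by parts in the form of an estimate: the integral is bounded by the uniform norm of
the integrator if the integrand has bounded variation. -/
theorem IsRSIntegral.norm_le_sup_mul (hB : ∀ a h, ‖B a h‖ ≤ ‖a‖ * ‖h‖) {X : Icc t T → H}
    {c M s : ℝ} {Y : Icc t T → F} (hYc : VarLE Y c) (hY : ∀ r, ‖Y r‖ ≤ M) (hX : ∀ r, ‖X r‖ ≤ s)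
    {u : Icc t T} {I : K} (hI : IsRSIntegral (fun a h => B a h) Y X u I) :
    ‖I‖ ≤ s * (2 * M + c) := by
  refine hI.norm_le fun n p hp _ _ => ?_
  have hparts : ∀ m, ∑ k ∈ Finset.range m, B (Y (p k)) (X (p (k + 1)) - X (p k))
      = B (Y (p m)) (X (p m)) - B (Y (p 0)) (X (p 0))
        - ∑ k ∈ Finset.range m, B (Y (p (k + 1)) - Y (p k)) (X (p (k + 1))) := by
    intro m
    induction m with
    | zero => simp
    | succ m ih =>
      rw [Finset.sum_range_succ, ih, Finset.sum_range_succ]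
      simp only [map_sub, sub_apply]
      abel
  have hs : 0 ≤ s := (norm_nonneg _).trans (hX u)
  have hM : 0 ≤ M := (norm_nonneg _).trans (hY u)
  have hBle : ∀ r, ‖B (Y r) (X r)‖ ≤ M * s := fun r =>
    (hB _ _).trans (mul_le_mul (hY r) (hX r) (norm_nonneg _) hM)
  have hsum : ‖∑ k ∈ Finset.range n, B (Y (p (k + 1)) - Y (p k)) (X (p (k + 1)))‖ ≤ c * s := by
    calc _ ≤ ∑ k ∈ Finset.range n, ‖Y (p (k + 1)) - Y (p k)‖ * s :=
          norm_sum_le_of_le _ fun k _ => (hB _ _).trans (by gcongr; exact hX _)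
      _ = (∑ k ∈ Finset.range n, ‖Y (p (k + 1)) - Y (p k)‖) * s := (Finset.sum_mul _ _ _).symm
      _ ≤ c * s := by gcongr; exact hYc.sum_le n hp
  rw [hparts]
  calc _ ≤ ‖B (Y (p n)) (X (p n))‖ + ‖B (Y (p 0)) (X (p 0))‖ + _ :=
        (norm_sub_le _ _).trans (add_le_add_left (norm_sub_le _ _) _)
    _ ≤ M * s + M * s + c * s := by gcongr <;> apply_rules
    _ = s * (2 * M + c) := by ring

/-- The increments of the indefinite integral. -/
theorem IsRSIntegral.norm_sub_le (hB : ∀ a h, ‖B a h‖ ≤ ‖a‖ * ‖h‖) {X : Icc t T → H}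
    {w : Icc t T → ℝ} (hw : Controls w X) {Y : Icc t T → F} {M : ℝ} (hY : ∀ r, ‖Y r‖ ≤ M)
    {s u : Icc t T} (hsu : s ≤ u) {I J : K} (hI : IsRSIntegral (fun a h => B a h) Y X s I)
    (hJ : IsRSIntegral (fun a h => B a h) Y X u J) : ‖J - I‖ ≤ M * (w u - w s) := by
  refine le_of_forall_pos_le_add fun ε hε => ?_
  obtain ⟨δ₁, h₁, k₁⟩ := hI (ε / 2) (by linarith)
  obtain ⟨δ₂, h₂, k₂⟩ := hJ (ε / 2) (by linarith)
  obtain ⟨p, n, hp⟩ := exists_isFinePartition u (lt_min h₁ h₂)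
  have hp₂ := hp.of_le (min_le_right δ₁ δ₂)
  have hp₁ := (hp.of_le (min_le_left δ₁ δ₂)).truncate hsu
  have a₁ := k₁ n _ _ hp₁.mono hp₁.zero hp₁.last hp₁.tag
  have a₂ := k₂ n p p hp₂.mono hp₂.zero hp₂.last hp₂.tag
  -- the tag of the stopped partition may be replaced by `p k`: beyond `s` its increments vanish
  have htag : ∀ k, B (Y (min (p k) s)) (X (min (p (k + 1)) s) - X (min (p k) s))
      = B (Y (p k)) (X (min (p (k + 1)) s) - X (min (p k) s)) := fun k => by
    rcases le_total (p k) s with h | h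
    · rw [min_eq_left h]
    · rw [min_eq_right h, min_eq_right (h.trans (hp.mono k.le_succ))]
      simp
  have hle : ∀ k ∈ Finset.range n, p (k + 1) ≤ u ∧ p k ≤ u := fun k hk =>
    ⟨hp.last ▸ hp.mono (Finset.mem_range.1 hk), hp.last ▸ hp.mono (Finset.mem_range.1 hk).le⟩
  have hM : 0 ≤ M := (norm_nonneg _).trans (hY u)
  have hdiff : ‖∑ k ∈ Finset.range n, B (Y (p k)) (X (p (k + 1)) - X (p k))
      - ∑ k ∈ Finset.range n, B (Y (min (p k) s)) (X (min (p (k + 1)) s) - X (min (p k) s))‖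
      ≤ M * (w u - w s) := by
    have e : w u - w s = ∑ k ∈ Finset.range n,
        ((w (p (k + 1)) - w (min (p (k + 1)) s)) - (w (p k) - w (min (p k) s))) := by
      rw [Finset.sum_range_sub (fun k => w (p k) - w (min (p k) s)), hp.last, hp.zero]
      simp [hsu]
    rw [← Finset.sum_sub_distrib, e, Finset.mul_sum]
    refine norm_sum_le_of_le _ fun k hk => ?_
    rw [htag, ← map_sub]
    refine (hB _ _).trans (mul_le_mul (hY _) ?_ (norm_nonneg _) hM)
    have := hw.min_min hsu (hp.mono k.le_succ)
    rw [min_eq_right (hle k hk).1, min_eq_right (hle k hk).2, min_comm s, min_comm s] at this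
    linarith
  set P := ∑ k ∈ Finset.range n, B (Y (p k)) (X (p (k + 1)) - X (p k))
  set Q := ∑ k ∈ Finset.range n, B (Y (min (p k) s)) (X (min (p (k + 1)) s) - X (min (p k) s))
  calc ‖J - I‖ = ‖(P - Q) - (P - J) + (Q - I)‖ := by congr 1; abel
    _ ≤ ‖P - Q‖ + ‖P - J‖ + ‖Q - I‖ :=
        (norm_add_le _ _).trans (add_le_add_left (_root_.norm_sub_le _ _) _)
    _ ≤ M * (w u - w s) + ε := by linarith

/-- The indefinite integral of a continuous path against a continuous path of bounded variation is
continuous: it is a uniform limit of continuous sums. -/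
theorem continuous_rsIntegral [CompleteSpace K] (hB : ∀ a h, ‖B a h‖ ≤ ‖a‖ * ‖h‖)
    {X : Icc t T → H} {c : ℝ} (hX : VarLE X c) (hXc : Continuous X) {Y : Icc t T → F}
    (hY : Continuous Y) : Continuous (rsIntegral (fun a h => B a h) Y X) := by
  choose p n hp using fun N : ℕ =>
    exists_isFinePartition_top t T (δ := 1 / ((N : ℝ) + 1)) (by positivity)
  have hlim : TendstoUniformly (fun N u => ∑ k ∈ Finset.range (n N),
      B (Y (min (p N k) u)) (X (min (p N (k + 1)) u) - X (min (p N k) u)))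
      (rsIntegral (fun a h => B a h) Y X) atTop := by
    rw [Metric.tendstoUniformly_iff]
    intro ε hε
    obtain ⟨δ, hδ, h⟩ := rsIntegral_uniform hB hX hY ε hε
    obtain ⟨N₀, hN₀⟩ := exists_nat_one_div_lt hδ
    refine eventually_atTop.2 ⟨N₀, fun N hN u => ?_⟩
    rw [dist_comm, dist_eq_norm]
    exact h u _ _ _ (((hp N).of_le ((one_div_le_one_div_of_le (by positivity)
      (by gcongr)).trans hN₀.le)).truncate le_top)
  refine hlim.continuous (Frequently.of_forall fun N => ?_)
  fun_prop

end Estimates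

/-! ### Neumann series -/

section Neumann

variable {E : Type*} [NormedAddCommGroup E] [NormedSpace ℝ E] [CompleteSpace E] {A : E →L[ℝ] E}
  {C : ℝ}

theorem summable_pow_of_norm_le (hA : ∀ n y, ‖(A ^ n) y‖ ≤ (1 / 2) ^ n * (C * ‖y‖)) :
    Summable fun n => A ^ n := by
  refine Summable.of_norm_bounded (g := fun n => (1 / 2 : ℝ) ^ n * |C|)
    ((summable_geometric_of_lt_one (by norm_num) (by norm_num)).mul_right _) fun n => ?_
  refine ContinuousLinearMap.opNorm_le_bound _ (by positivity) fun y => (hA n y).trans ?_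
  rw [mul_assoc]
  gcongr
  exact le_abs_self C

theorem tsum_pow_apply_eq (hA : ∀ n y, ‖(A ^ n) y‖ ≤ (1 / 2) ^ n * (C * ‖y‖)) (z : E) :
    (∑' n, A ^ n) z = z + A ((∑' n, A ^ n) z) := by
  have h := congrArg (fun P => P z) (summable_pow_of_norm_le hA).one_sub_mul_tsum_pow
  simp only [sub_mul, one_mul, sub_apply, mul_apply_eq_comp,
    one_apply_eq_self] at h
  rwa [sub_eq_iff_eq_add] at h

theorem eq_tsum_pow_apply (hA : ∀ n y, ‖(A ^ n) y‖ ≤ (1 / 2) ^ n * (C * ‖y‖)) {y z : E}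
    (h : y = z + A y) : y = (∑' n, A ^ n) z := by
  have h₁ := congrArg (fun P => P y) (summable_pow_of_norm_le hA).tsum_pow_mul_one_sub
  simp only [sub_apply, mul_apply_eq_comp,
    one_apply_eq_self] at h₁
  rw [← h₁, sub_eq_of_eq_add h]

theorem norm_tsum_pow_apply_le (hA : ∀ n y, ‖(A ^ n) y‖ ≤ (1 / 2) ^ n * (C * ‖y‖)) (z : E) :
    ‖(∑' n, A ^ n) z‖ ≤ 2 * C * ‖z‖ := by
  have h₁ : HasSum (fun n => (A ^ n) z) ((∑' n, A ^ n) z) :=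
    (summable_pow_of_norm_le hA).hasSum.mapL (ContinuousLinearMap.apply ℝ _ z)
  have h₂ : HasSum (fun n : ℕ => (1 / 2 : ℝ) ^ n * (C * ‖z‖)) (2 * (C * ‖z‖)) :=
    hasSum_geometric_two.mul_right _
  rw [mul_assoc, ← h₁.tsum_eq]
  exact tsum_of_norm_bounded h₂ fun n => hA n z

end Neumann

/-! ### The Volterra operator of a path -/

theorem BVPath.varLE {t T : ℝ} {E : Type*} [NormedAddCommGroup E] [NormedSpace ℝ E]
    [Fact (t ≤ T)] (γ : BVPath t T E) : VarLE γ γ.var :=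
  varLE_of_boundedVariationOn γ.property

section Volterra

variable {t T : ℝ} [Fact (t ≤ T)] {F H : Type*} [NormedAddCommGroup H]
  [NormedAddCommGroup F] [NormedSpace ℝ F] [NormedSpace ℝ H] [CompleteSpace F]

/-- The operator `Y ↦ ∫_t^· B(Y_r, dX_r)` on continuous paths. -/
noncomputable def volterra (B : F →L[ℝ] H →L[ℝ] F) (hB : ∀ a h, ‖B a h‖ ≤ ‖a‖ * ‖h‖)
    (X : BVPath t T H) : C(Icc t T, F) →L[ℝ] C(Icc t T, F) :=
  LinearMap.mkContinuous
    { toFun := fun Y => ⟨rsIntegral (fun a h => B a h) Y X,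
        continuous_rsIntegral hB X.varLE X.toCM.continuous Y.continuous⟩
      map_add' := fun Y Z => by
        ext u
        exact ((isRSIntegral_rsIntegral hB X.varLE Y.continuous u).add_left
          (isRSIntegral_rsIntegral hB X.varLE Z.continuous u)).rsIntegral_eq
      map_smul' := fun c Y => by
        ext u
        exact ((isRSIntegral_rsIntegral hB X.varLE Y.continuous u).const_smul_left
          c).rsIntegral_eq }
    X.var fun Y => (ContinuousMap.norm_le _ (by positivity)).2 fun u =>
      (isRSIntegral_rsIntegral hB X.varLE Y.continuous u).norm_le_mul hB X.varLE Y.norm_coe_le_norm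

variable {B : F →L[ℝ] H →L[ℝ] F} (hB : ∀ a h, ‖B a h‖ ≤ ‖a‖ * ‖h‖)

theorem isRSIntegral_volterra (X : BVPath t T H) (Y : C(Icc t T, F)) (u : Icc t T) :
    IsRSIntegral (fun a h => B a h) Y X u (volterra B hB X Y u) :=
  isRSIntegral_rsIntegral hB X.varLE Y.continuous u

theorem volterra_add (X Z : BVPath t T H) :
    volterra B hB (X + Z) = volterra B hB X + volterra B hB Z := by
  ext Y u
  exact ((isRSIntegral_volterra hB X Y u).add_right (isRSIntegral_volterra hB Z Y u)).rsIntegral_eq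

theorem volterra_smul (c : ℝ) (X : BVPath t T H) :
    volterra B hB (c • X) = c • volterra B hB X := by
  ext Y u
  exact ((isRSIntegral_volterra hB X Y u).const_smul_right c).rsIntegral_eq

theorem volterra_sub (X Z : BVPath t T H) :
    volterra B hB (X - Z) = volterra B hB X - volterra B hB Z := by
  rw [eq_sub_iff_add_eq, ← volterra_add, sub_add_cancel]

theorem norm_volterra_le {X : BVPath t T H} {c : ℝ} (hX : VarLE X c) (Y : C(Icc t T, F)) :
    ‖volterra B hB X Y‖ ≤ c * ‖Y‖ :=
  (ContinuousMap.norm_le _ (mul_nonneg hX.nonneg (norm_nonneg _))).2 fun u =>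
    (isRSIntegral_volterra hB X Y u).norm_le_mul hB hX Y.norm_coe_le_norm

theorem varLE_volterra {X : BVPath t T H} {c : ℝ} (hX : VarLE X c) (Y : C(Icc t T, F)) :
    VarLE (volterra B hB X Y) (c * ‖Y‖) := by
  obtain ⟨w, hw, h0, hc⟩ := hX
  refine ⟨fun u => ‖Y‖ * w u, fun a b hab => ?_, by simp [h0],
    by rw [mul_comm c]; exact mul_le_mul_of_nonneg_left hc (norm_nonneg _)⟩
  rw [← mul_sub]
  exact (isRSIntegral_volterra hB X Y a).norm_sub_le hB hw Y.norm_coe_le_norm hab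
    (isRSIntegral_volterra hB X Y b)

/-- The operator is bounded by the uniform norm of its driver on integrands of bounded variation. -/
theorem norm_volterra_le_sup (X : BVPath t T H) {Y : C(Icc t T, F)} {c M s : ℝ}
    (hs : X.supNorm ≤ s) (hY : VarLE Y c) (hM : ‖Y‖ ≤ M) :
    ‖volterra B hB X Y‖ ≤ s * (2 * M + c) := by
  have hs0 : 0 ≤ s := (norm_nonneg _).trans hs
  have hM0 : 0 ≤ M := (norm_nonneg _).trans hM
  have hc := hY.nonneg
  exact (ContinuousMap.norm_le _ (by positivity)).2 fun u =>
    (isRSIntegral_volterra hB X Y u).norm_le_sup_mul hB hY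
      (fun r => (Y.norm_coe_le_norm r).trans hM)
      fun r => (X.toCM.norm_coe_le_norm r).trans hs

/-- The powers decay geometrically: in the norm weighted by `exp(-2w)`, for a control `w` of the
driver, the operator has norm at most `1/2`. -/
theorem norm_volterra_pow_le {X : BVPath t T H} {c : ℝ} (hX : VarLE X c) (n : ℕ)
    (Y : C(Icc t T, F)) :
    ‖(volterra B hB X ^ n) Y‖ ≤ (1 / 2) ^ n * (Real.exp (2 * c) * ‖Y‖) := by
  obtain ⟨w, hw, h0, hc⟩ := hX
  have hw0 : ∀ r, 0 ≤ w r := fun r => h0 ▸ hw.monotone bot_le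
  have key : ∀ n r, ‖(volterra B hB X ^ n) Y r‖ ≤ (1 / 2) ^ n * Real.exp (2 * w r) * ‖Y‖ := by
    intro n
    induction n with
    | zero =>
      intro r
      have h₁ : 1 ≤ Real.exp (2 * w r) := Real.one_le_exp (by linarith [hw0 r])
      have h₂ := Y.norm_coe_le_norm r
      simp only [pow_zero, one_mul]
      exact h₂.trans (le_mul_of_one_le_left (norm_nonneg _) h₁)
    | succ n ih =>
      intro r
      have h := (isRSIntegral_volterra hB X ((volterra B hB X ^ n) Y) r).norm_le_of_control hB hw
        (f := fun x => (1 / 2) ^ n * Real.exp (2 * x) * ‖Y‖)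
        (Φ := fun x => (1 / 2) ^ (n + 1) * Real.exp (2 * x) * ‖Y‖)
        (fun x y _ => by
          have h₁ := Real.add_one_le_exp (2 * y - 2 * x)
          rw [Real.exp_sub, le_div_iff₀ (Real.exp_pos _)] at h₁
          have h₂ : 0 ≤ (1 / 2 : ℝ) ^ (n + 1) * ‖Y‖ := by positivity
          calc (1 / 2) ^ n * Real.exp (2 * x) * ‖Y‖ * (y - x)
              = (1 / 2) ^ (n + 1) * ‖Y‖ * ((2 * y - 2 * x) * Real.exp (2 * x)) := by ring
            _ ≤ (1 / 2) ^ (n + 1) * ‖Y‖ * (Real.exp (2 * y) - Real.exp (2 * x)) := by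
                gcongr; linarith
            _ = _ := by ring) ih
      rw [pow_succ', mul_apply_eq_comp]
      refine h.trans (sub_le_self _ (by positivity))
  refine (ContinuousMap.norm_le _ (by positivity)).2 fun r => (key n r).trans ?_
  rw [mul_assoc]
  have : w r ≤ c := (hw.monotone le_top).trans hc
  gcongr

/-- The resolvent `(1 - V)⁻¹` of the Volterra operator `V` of `X`, given by its Neumann series. It
maps `Z` to the solution of the linear controlled equation `Y = Z + ∫ B(Y, dX)`. -/
noncomputable def volterraResolvent (B : F →L[ℝ] H →L[ℝ] F) (hB : ∀ a h, ‖B a h‖ ≤ ‖a‖ * ‖h‖)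
    (X : BVPath t T H) : C(Icc t T, F) →L[ℝ] C(Icc t T, F) :=
  ∑' n, volterra B hB X ^ n

theorem volterraResolvent_eq (X : BVPath t T H) (Z : C(Icc t T, F)) :
    volterraResolvent B hB X Z = Z + volterra B hB X (volterraResolvent B hB X Z) :=
  tsum_pow_apply_eq (norm_volterra_pow_le hB X.varLE) Z

/-- The linear controlled equation has at most one solution. -/
theorem eq_volterraResolvent {X : BVPath t T H} {Y Z : C(Icc t T, F)}
    (h : Y = Z + volterra B hB X Y) : Y = volterraResolvent B hB X Z :=
  eq_tsum_pow_apply (norm_volterra_pow_le hB X.varLE) h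

theorem norm_volterraResolvent_le {X : BVPath t T H} {c : ℝ} (hX : VarLE X c)
    (Z : C(Icc t T, F)) : ‖volterraResolvent B hB X Z‖ ≤ 2 * Real.exp (2 * c) * ‖Z‖ :=
  norm_tsum_pow_apply_le (norm_volterra_pow_le hB hX) Z

end Volterra

/-! ### The signature as the solution of a linear controlled equation -/

section Tensor

variable {H : Type} [NormedAddCommGroup H] [InnerProductSpace ℝ H]

theorem tensorRight_add_left (n : ℕ) (a b : TensorLevel H n) (h : H) :
    tensorRight n (a + b) h = tensorRight n a h + tensorRight n b h :=
  (congrArg _ (TensorProduct.add_tmul a b h)).trans (UniformSpace.Completion.coe_add _ _)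

theorem tensorRight_add_right (n : ℕ) (a : TensorLevel H n) (h k : H) :
    tensorRight n a (h + k) = tensorRight n a h + tensorRight n a k :=
  (congrArg _ (TensorProduct.tmul_add a h k)).trans (UniformSpace.Completion.coe_add _ _)

theorem tensorRight_smul_left (n : ℕ) (c : ℝ) (a : TensorLevel H n) (h : H) :
    tensorRight n (c • a) h = c • tensorRight n a h :=
  (congrArg _ (TensorProduct.smul_tmul' c a h).symm).trans (UniformSpace.Completion.coe_smul _ _)

theorem tensorRight_smul_right (n : ℕ) (c : ℝ) (a : TensorLevel H n) (h : H) :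
    tensorRight n a (c • h) = c • tensorRight n a h :=
  (congrArg _ (TensorProduct.tmul_smul c a h)).trans (UniformSpace.Completion.coe_smul _ _)

theorem norm_mulVec_le (a : TensorHilbert H) (h : H) : ‖mulVec a h‖ ≤ 1 * ‖a‖ * ‖h‖ := by
  have h2 : (0 : ℝ) < (2 : ℝ≥0∞).toReal := by norm_num
  refine lp.norm_le_of_forall_sum_le h2 (by positivity) fun s => ?_
  have hs : s ⊆ Finset.range (s.sup id + 1) := fun i hi =>
    Finset.mem_range.2 (Nat.lt_succ_of_le (Finset.le_sup (f := id) hi))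
  refine (Finset.sum_le_sum_of_subset_of_nonneg hs fun _ _ _ => by positivity).trans ?_
  rw [Finset.sum_range_succ']
  have h0 : ‖mulVec a h 0‖ ^ (2 : ℝ≥0∞).toReal = 0 := by
    have : mulVec a h 0 = 0 := rfl
    rw [this, norm_zero, Real.zero_rpow h2.ne']
  have hk : ∀ k, ‖mulVec a h (k + 1)‖ ^ (2 : ℝ≥0∞).toReal
      = ‖a k‖ ^ (2 : ℝ≥0∞).toReal * ‖h‖ ^ (2 : ℝ≥0∞).toReal := fun k => by
    have : mulVec a h (k + 1) = tensorRight k (a k) h := rfl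
    rw [this, norm_tensorRight, Real.mul_rpow (norm_nonneg _) (norm_nonneg _)]
  rw [h0, add_zero, one_mul, Real.mul_rpow (norm_nonneg _) (norm_nonneg _)]
  simp only [hk]
  rw [← Finset.sum_mul]
  gcongr
  exact lp.sum_rpow_le_norm_rpow h2 a _

/-- The product `(a, h) ↦ a · h` as a bounded bilinear map. -/
noncomputable def mulVecL (H : Type) [NormedAddCommGroup H] [InnerProductSpace ℝ H] :
    TensorHilbert H →L[ℝ] H →L[ℝ] TensorHilbert H :=
  LinearMap.mkContinuous₂
    (LinearMap.mk₂ ℝ mulVec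
      (fun a b h => lp.ext (funext fun n => by
        cases n with
        | zero => exact (add_zero (0 : TensorLevel H 0)).symm
        | succ n => exact tensorRight_add_left n _ _ h))
      (fun c a h => lp.ext (funext fun n => by
        cases n with
        | zero => exact (smul_zero (A := TensorLevel H 0) c).symm
        | succ n => exact tensorRight_smul_left n c _ h))
      (fun a h k => lp.ext (funext fun n => by
        cases n with
        | zero => exact (add_zero (0 : TensorLevel H 0)).symm
        | succ n => exact tensorRight_add_right n _ h k))
      (fun c a h => lp.ext (funext fun n => by
        cases n with
        | zero => exact (smul_zero (A := TensorLevel H 0) c).symm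
        | succ n => exact tensorRight_smul_right n c _ h)))
    1 norm_mulVec_le

theorem norm_mulVecL_le (a : TensorHilbert H) (h : H) : ‖mulVecL H a h‖ ≤ ‖a‖ * ‖h‖ :=
  (norm_mulVec_le a h).trans_eq (by rw [one_mul])

variable {t T : ℝ}

/-- The constant path at the unit `(1, 0, 0, …)` of the tensor algebra. -/
noncomputable def unitPath (t T : ℝ) (H : Type) [NormedAddCommGroup H] [InnerProductSpace ℝ H] :
    C(Icc t T, TensorHilbert H) :=
  ContinuousMap.const _ (lp.single 2 0 (1 : ℝ))

theorem norm_unitPath_le : ‖unitPath t T H‖ ≤ 1 :=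
  (ContinuousMap.norm_le _ zero_le_one).2 fun _ =>
    (lp.norm_single (E := fun n => TensorLevel H n) (p := 2) (by norm_num) 0 (1 : ℝ)).trans_le
      (norm_one (α := ℝ)).le

variable [Fact (t ≤ T)]

theorem varLE_unitPath : VarLE (unitPath t T H) 0 :=
  varLE_const _

/-- The Volterra operator of the product of the tensor algebra. -/
noncomputable abbrev tensorVolterra (X : BVPath t T H) :
    C(Icc t T, TensorHilbert H) →L[ℝ] C(Icc t T, TensorHilbert H) :=
  volterra (mulVecL H) norm_mulVecL_le X

/-- The resolvent of the Volterra operator of the product of the tensor algebra. -/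
noncomputable abbrev tensorResolvent (X : BVPath t T H) :
    C(Icc t T, TensorHilbert H) →L[ℝ] C(Icc t T, TensorHilbert H) :=
  volterraResolvent (mulVecL H) norm_mulVecL_le X

/-- The signature path, as the solution of `S = 1 + ∫ S · dX`. -/
noncomputable def sigPath (X : BVPath t T H) : C(Icc t T, TensorHilbert H) :=
  tensorResolvent X (unitPath t T H)

theorem sigPath_eq (X : BVPath t T H) :
    sigPath X = unitPath t T H + tensorVolterra X (sigPath X) :=
  volterraResolvent_eq norm_mulVecL_le X _

theorem isRSIntegral_tensorVolterra (X : BVPath t T H) (Y : C(Icc t T, TensorHilbert H))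
    (u : Icc t T) : IsRSIntegral mulVec Y X u (tensorVolterra X Y u) :=
  isRSIntegral_volterra norm_mulVecL_le X Y u

theorem isRSIntegral_level (X : BVPath t T H) (n : ℕ) (u : Icc t T) :
    IsRSIntegral (tensorRight n) (fun r => sigPath X r n) X u (sigPath X u (n + 1)) := by
  have h := (isRSIntegral_tensorVolterra X (sigPath X) u).map
    (lp.evalCLM ℝ (fun n => TensorLevel H n) 2 (n + 1)) (A' := tensorRight n)
    (Y' := fun r => sigPath X r n) (X' := X) fun _ _ _ => rfl
  have e : lp.evalCLM ℝ (fun n => TensorLevel H n) 2 (n + 1) (tensorVolterra X (sigPath X) u)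
      = sigPath X u (n + 1) := by
    have h₁ := congrArg (fun Z : C(Icc t T, TensorHilbert H) => Z u (n + 1)) (sigPath_eq X)
    have h₂ : unitPath t T H u (n + 1) = 0 :=
      lp.single_apply_ne (E := fun n => TensorLevel H n) 2 0 (1 : ℝ) n.succ_ne_zero
    refine Eq.trans ?_ h₁.symm
    exact ((congrArg (· + _) h₂).trans (zero_add _)).symm
  rwa [e] at h

/-- The levels of the solution are the iterated integrals. -/
theorem sigPath_level (X : BVPath t T H) (n : ℕ) :
    (fun u => sigPath X u n) = sigLevel X n := by
  induction n with
  | zero =>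
    funext u
    have h₁ := congrArg (fun Z : C(Icc t T, TensorHilbert H) => Z u 0) (sigPath_eq X)
    have h₂ : unitPath t T H u 0 = (1 : ℝ) :=
      lp.single_apply_self (E := fun n => TensorLevel H n) 2 0 (1 : ℝ)
    have h₃ : tensorVolterra X (sigPath X) u 0 = 0 := by
      refine IsRSIntegral.unique (B := fun (_ : TensorHilbert H) (_ : H) => (0 : TensorLevel H 0))
        (X := X) (Y := sigPath X) (u := u) ?_ ?_
      · exact (isRSIntegral_tensorVolterra X (sigPath X) u).map
          (lp.evalCLM ℝ (fun n => TensorLevel H n) 2 0) fun _ _ _ => rfl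
      · exact fun ε hε => ⟨1, one_pos, fun n p ξ _ _ _ _ => by simpa using hε⟩
    exact h₁.trans ((congrArg₂ (· + ·) h₂ h₃).trans (add_zero (1 : ℝ)))
  | succ n ih =>
    funext u
    have h := isRSIntegral_level X n u
    rw [ih] at h
    exact h.rsIntegral_eq.symm

theorem sigWellDefined (X : BVPath t T H) : SigWellDefined (X : Icc t T → H) := by
  have h : ∀ n u, sigLevel X n u = sigPath X u n := fun n u => (congrFun (sigPath_level X n) u).symm
  refine ⟨fun n u => ?_, fun u => ?_⟩
  · rw [h, ← sigPath_level]
    exact isRSIntegral_level X n u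
  · simp only [h]
    exact lp.memℓp _

theorem sig_eq_sigPath (X : BVPath t T H) (u : Icc t T) :
    sig (X : Icc t T → H) u = sigPath X u := by
  rw [sig, dif_pos ((sigWellDefined X).2 u)]
  exact lp.ext (funext fun n => (congrFun (sigPath_level X n) u).symm)

end Tensor

/-! ### Iterated differences -/

section IteratedDifferences

variable {ι E K : Type*} [AddCommGroup E] [Module ℝ E] [NormedAddCommGroup K]

/-- The iterated difference of `f` with steps `h` in the directions `b i`, for the pairs `(i, h)` of
the list `L`. -/
def iterDiff (b : ι → E) (L : List (ι × ℝ)) (f : E → K) : E → K :=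
  L.foldr (fun p f x => f (x + p.2 • b p.1) - f x) f

theorem iterDiff_nil (b : ι → E) (f : E → K) : iterDiff b [] f = f := rfl

theorem iterDiff_cons (b : ι → E) (p : ι × ℝ) (L : List (ι × ℝ)) (f : E → K) (x : E) :
    iterDiff b (p :: L) f x = iterDiff b L f (x + p.2 • b p.1) - iterDiff b L f x := rfl

theorem iterDiff_append_singleton (b : ι → E) (p : ι × ℝ) (L : List (ι × ℝ)) (f : E → K) :
    iterDiff b (L ++ [p]) f = iterDiff b L (iterDiff b [p] f) :=
  List.foldr_append

/-- The product of the step sizes of an iterated difference. -/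
def stepProd (L : List (ι × ℝ)) : ℝ := (L.map fun p => |p.2|).prod

theorem stepProd_cons (p : ι × ℝ) (L : List (ι × ℝ)) : stepProd (p :: L) = |p.2| * stepProd L := by
  simp [stepProd]

theorem stepProd_append_singleton (p : ι × ℝ) (L : List (ι × ℝ)) :
    stepProd (L ++ [p]) = stepProd L * |p.2| := by
  simp [stepProd]

theorem stepProd_nonneg (L : List (ι × ℝ)) : 0 ≤ stepProd L := by
  refine List.prod_nonneg fun a ha => ?_
  obtain ⟨p, _, rfl⟩ := List.mem_map.1 ha
  exact abs_nonneg _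

theorem tendsto_iterDiff {α : Type*} {l : Filter α} {F : α → E → K} {f : E → K}
    (h : ∀ x, Tendsto (fun a => F a x) l (𝓝 (f x))) (b : ι → E) (L : List (ι × ℝ)) (x : E) :
    Tendsto (fun a => iterDiff b L (F a) x) l (𝓝 (iterDiff b L f x)) := by
  induction L generalizing x with
  | nil => exact h x
  | cons p L ih => exact (ih _).sub (ih _)

/-- All iterated differences of `f` of order at most `N` are bounded by `M` times the product of
their steps. -/
def DiffBound (b : ι → E) (M : ℝ) (N : ℕ) (f : E → K) : Prop :=
  ∀ L : List (ι × ℝ), L.length ≤ N → ∀ x, ‖iterDiff b L f x‖ ≤ M * stepProd L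

theorem DiffBound.norm_le {b : ι → E} {M : ℝ} {N : ℕ} {f : E → K} (h : DiffBound b M N f) (x : E) :
    ‖f x‖ ≤ M := by
  simpa [stepProd, iterDiff_nil] using h [] N.zero_le x

theorem DiffBound.norm_sub_le {b : ι → E} {M : ℝ} {N : ℕ} {f : E → K} (h : DiffBound b M N f)
    (hN : 1 ≤ N) (i : ι) (x : E) (s : ℝ) : ‖f (x + s • b i) - f x‖ ≤ M * |s| := by
  simpa [stepProd, iterDiff] using h [(i, s)] hN x

theorem DiffBound.norm_second_le {b : ι → E} {M : ℝ} {N : ℕ} {f : E → K} (h : DiffBound b M N f)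
    (hN : 2 ≤ N) (i : ι) (x : E) (s : ℝ) :
    ‖f (x + (2 * s) • b i) - f (x + s • b i) - (f (x + s • b i) - f x)‖ ≤ M * s ^ 2 := by
  have := h [(i, s), (i, s)] hN x
  simp only [stepProd, List.map_cons, List.map_nil, List.prod_cons, List.prod_nil, mul_one,
    abs_mul_abs_self, iterDiff, List.foldr, add_assoc, ← add_smul, ← two_mul] at this
  rwa [sq]

variable [NormedSpace ℝ K]

theorem iterDiff_map {K' : Type*} [NormedAddCommGroup K'] [NormedSpace ℝ K'] (A : K →ₗ[ℝ] K')
    (b : ι → E) (L : List (ι × ℝ)) (f : E → K) (x : E) :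
    iterDiff b L (fun y => A (f y)) x = A (iterDiff b L f x) := by
  induction L generalizing x with
  | nil => rfl
  | cons p L ih => rw [iterDiff_cons, iterDiff_cons, ih, ih, map_sub]

theorem hasLineDerivAt_comp_add {f : E → K} {f' : K} {x v c : E}
    (h : HasLineDerivAt ℝ f f' (x + c) v) : HasLineDerivAt ℝ (fun y => f (y + c)) f' x v := by
  simpa only [HasLineDerivAt, add_right_comm] using h

theorem hasLineDerivAt_iterDiff {f f' : E → K} {v : E} (h : ∀ x, HasLineDerivAt ℝ f (f' x) x v)
    (b : ι → E) (L : List (ι × ℝ)) (x : E) :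
    HasLineDerivAt ℝ (iterDiff b L f) (iterDiff b L f' x) x v := by
  induction L generalizing x with
  | nil => exact h x
  | cons p L ih => exact (hasLineDerivAt_comp_add (ih _)).sub (ih x)

theorem hasLineDerivAt_iterDiff_param {E' : Type*} [AddCommGroup E'] [Module ℝ E']
    {f f' : E → E' → K} {y v : E'} (h : ∀ x, HasLineDerivAt ℝ (f x) (f' x y) y v)
    (b : ι → E) (L : List (ι × ℝ)) (x : E) :
    HasLineDerivAt ℝ (fun y => iterDiff b L (fun z => f z y) x)
      (iterDiff b L (fun z => f' z y) x) y v := by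
  induction L generalizing x with
  | nil => exact h x
  | cons p L ih => exact (ih _).sub (ih x)

theorem norm_sub_le_of_hasLineDerivAt {f f' : E → K} {v : E} {C : ℝ}
    (h : ∀ x, HasLineDerivAt ℝ f (f' x) x v) (hC : ∀ x, ‖f' x‖ ≤ C) (x : E) (s : ℝ) :
    ‖f (x + s • v) - f x‖ ≤ C * |s| := by
  have hd : ∀ r : ℝ, HasDerivAt (fun r : ℝ => f (x + r • v)) (f' (x + r • v)) r := fun r => by
    have h₁ : HasDerivAt (fun s : ℝ => f (x + r • v + s • v)) (f' (x + r • v)) (r - r) := by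
      rw [sub_self]
      exact h _
    have h₂ := h₁.comp_sub_const r r
    refine h₂.congr_of_eventuallyEq (Eventually.of_forall fun a => ?_)
    simp only [add_assoc, ← add_smul, add_sub_cancel]
  have := convex_univ.norm_image_sub_le_of_norm_hasDerivWithin_le
    (fun r _ => (hd r).hasDerivWithinAt) (fun r _ => hC _) (mem_univ (0 : ℝ)) (mem_univ s)
  simpa using this

/-- The mean value inequality for iterated differences of a function with iterated partial
derivatives. -/
theorem norm_iterDiff_le_of_hasLineDerivAt {b : ι → E} {f : List ι → E → K} {N : ℕ} {C : ℝ}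
    (hf : ∀ I, I.length < N → ∀ i x, HasLineDerivAt ℝ (f I) (f (i :: I) x) x (b i))
    (hC : ∀ I, I.length ≤ N → ∀ x, ‖f I x‖ ≤ C) (L : List (ι × ℝ)) (I : List ι)
    (hN : I.length + L.length ≤ N) (x : E) : ‖iterDiff b L (f I) x‖ ≤ C * stepProd L := by
  induction L generalizing I x with
  | nil => simpa [stepProd, iterDiff_nil] using hC I (by simpa using hN) x
  | cons p L ih =>
    simp only [List.length_cons] at hN
    rw [iterDiff_cons, stepProd_cons]
    refine (norm_sub_le_of_hasLineDerivAt
      (hasLineDerivAt_iterDiff (hf I (by omega) p.1) b L)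
      (fun y => ih (p.1 :: I) (by simp only [List.length_cons]; omega) y) x p.2).trans_eq ?_
    ring

/-- The limit of the difference quotients of a function with bounded iterated differences has
bounded iterated differences, of one order less. -/
theorem DiffBound.of_remainder {b : ι → E} {M : ℝ} {N : ℕ} {f f' : E → K}
    (h : DiffBound b M (N + 1) f) (i : ι)
    (hf' : ∀ x s, ‖f (x + s • b i) - f x - s • f' x‖ ≤ M * s ^ 2) : DiffBound b M N f' := by
  intro L hL x
  set r : ℕ → ℝ := fun n => 1 / ((n : ℝ) + 1) with hr
  have hr0 : ∀ n, 0 < r n := fun n => by positivity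
  have hrlim : Tendsto r atTop (𝓝 0) := tendsto_one_div_add_atTop_nhds_zero_nat
  have hlim : ∀ y, Tendsto (fun n => (r n)⁻¹ • iterDiff b [(i, r n)] f y) atTop (𝓝 (f' y)) := by
    intro y
    rw [tendsto_iff_norm_sub_tendsto_zero]
    refine squeeze_zero (fun _ => norm_nonneg _) (g := fun n => M * r n) (fun n => ?_)
      (by simpa using hrlim.const_mul M)
    have e : (r n)⁻¹ • iterDiff b [(i, r n)] f y - f' y
        = (r n)⁻¹ • (f (y + r n • b i) - f y - r n • f' y) := by
      rw [smul_sub (r n)⁻¹ (f (y + r n • b i) - f y), inv_smul_smul₀ (hr0 n).ne']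
      rfl
    rw [e, norm_smul, norm_inv, Real.norm_of_nonneg (hr0 n).le]
    calc (r n)⁻¹ * ‖_‖ ≤ (r n)⁻¹ * (M * r n ^ 2) := by
          gcongr
          exact hf' y (r n)
      _ = M * r n := by field_simp [(hr0 n).ne']
  refine le_of_tendsto (tendsto_iterDiff hlim b L x).norm (Eventually.of_forall fun n => ?_)
  have e := iterDiff_map ((r n)⁻¹ • (LinearMap.id : K →ₗ[ℝ] K)) b L (iterDiff b [(i, r n)] f) x
  simp only [LinearMap.smul_apply, LinearMap.id_apply] at e
  rw [e, ← iterDiff_append_singleton, norm_smul, norm_inv, Real.norm_of_nonneg (hr0 n).le]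
  calc (r n)⁻¹ * ‖_‖ ≤ (r n)⁻¹ * (M * stepProd (L ++ [(i, r n)])) := by
        gcongr
        exact h _ (by simpa using hL) x
    _ = M * stepProd L := by
        rw [stepProd_append_singleton, abs_of_pos (hr0 n)]
        field_simp [(hr0 n).ne']

end IteratedDifferences

/-! ### Strong partial derivatives from weak ones -/

section WeakDerivative

variable {ι E H X : Type*} [AddCommGroup E] [Module ℝ E] [NormedAddCommGroup H]
  [InnerProductSpace ℝ H] [CompleteSpace H]

/-- A map with bounded second differences into a Hilbert space, whose inner products with the
vectors of a total family `k` have partial derivatives, has partial derivatives. The dyadic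
difference quotients are Cauchy sequences, and testing them against `k` shows that the limit does
not depend on the step. -/
theorem DiffBound.exists_partial {b : ι → E} {M : ℝ} {N : ℕ} {f : E → H}
    (hf : DiffBound b M (N + 2) f) {k : X → H} (hk : ∀ v, (∀ z, inner ℝ (k z) v = 0) → v = 0)
    (i : ι) {a : X → E → ℝ}
    (ha : ∀ z y, HasLineDerivAt ℝ (fun y => inner ℝ (k z) (f y)) (a z y) y (b i)) :
    ∃ f' : E → H, (∀ z y, inner ℝ (k z) (f' y) = a z y) ∧
      (∀ x s, ‖f (x + s • b i) - f x - s • f' x‖ ≤ M * s ^ 2) ∧ DiffBound b M (N + 1) f' := by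
  have hlim : ∀ y, ∀ s : ℝ, s ≠ 0 → ∃ v : H, (∀ z, inner ℝ (k z) v = a z y) ∧
      ‖f (y + s • b i) - f y - s • v‖ ≤ M * s ^ 2 := by
    intro y s hs
    set r : ℕ → ℝ := fun n => s / 2 ^ n with hr
    have hr0 : ∀ n, r n ≠ 0 := fun n => by positivity
    have hrs : ∀ n, r n = 2 * r (n + 1) := fun n => by simp only [hr, pow_succ]; field_simp
    have hrlim : Tendsto r atTop (𝓝[≠] 0) := by
      refine tendsto_nhdsWithin_iff.2 ⟨?_, Eventually.of_forall hr0⟩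
      have := (tendsto_pow_atTop_nhds_zero_of_lt_one (r := (1 / 2 : ℝ)) (by norm_num)
        (by norm_num)).const_mul s
      simpa [hr, div_eq_mul_inv] using this
    set q : ℕ → H := fun n => (r n)⁻¹ • (f (y + r n • b i) - f y) with hq
    have hstep : ∀ n, dist (q n) (q (n + 1)) ≤ M * |s| / 2 / 2 ^ n := by
      intro n
      have e : q n - q (n + 1) = (r n)⁻¹ • (f (y + (2 * r (n + 1)) • b i)
          - f (y + r (n + 1) • b i) - (f (y + r (n + 1) • b i) - f y)) := by
        have h₂ : (r (n + 1))⁻¹ = 2 * (r n)⁻¹ := by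
          rw [hrs n]; field_simp [hr0 (n + 1)]
        simp only [hq, h₂, ← hrs n]
        module
      rw [dist_eq_norm, e, norm_smul, norm_inv, Real.norm_eq_abs]
      have habs : 0 < |r n| := abs_pos.2 (hr0 n)
      have hMnn : 0 ≤ M := (norm_nonneg _).trans (hf.norm_le y)
      calc |r n|⁻¹ * ‖_‖ ≤ |r n|⁻¹ * (M * r (n + 1) ^ 2) := by
            gcongr
            exact hf.norm_second_le (by omega) i y _
        _ = M * |r n| / 4 := by
            have : r (n + 1) = r n / 2 := by rw [hrs n]; ring
            rw [this, div_pow, ← sq_abs]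
            field_simp
            norm_num
        _ = M * |s| / 4 / 2 ^ n := by
            simp only [hr, abs_div, abs_pow, abs_two]
            ring
        _ ≤ M * |s| / 2 / 2 ^ n := by
            gcongr
            norm_num
    obtain ⟨v, hv⟩ := cauchySeq_tendsto_of_complete (cauchySeq_of_le_geometric_two hstep)
    refine ⟨v, fun z => ?_, ?_⟩
    · have h₁ : Tendsto (fun n => inner ℝ (k z) (q n)) atTop (𝓝 (inner ℝ (k z) v)) :=
        tendsto_const_nhds.inner hv
      have h₂ := (hasDerivAt_iff_tendsto_slope_zero.1 (ha z y)).comp hrlim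
      refine tendsto_nhds_unique h₁ (h₂.congr fun n => ?_)
      simp [hq, inner_smul_right, inner_sub_right]
    · have h₁ := dist_le_of_le_geometric_two_of_tendsto₀ hstep hv
      have e : f (y + s • b i) - f y - s • v = s • (q 0 - v) := by
        simp [hq, hr, smul_sub, smul_inv_smul₀ hs]
      rw [dist_eq_norm] at h₁
      rw [e, norm_smul, Real.norm_eq_abs]
      calc |s| * ‖q 0 - v‖ ≤ |s| * (M * |s|) := by gcongr
        _ = M * |s| ^ 2 := by ring
        _ = M * s ^ 2 := by rw [sq_abs]
  choose f' hf' _ using fun y => hlim y 1 one_ne_zero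
  have hrem : ∀ x s, ‖f (x + s • b i) - f x - s • f' x‖ ≤ M * s ^ 2 := by
    intro x s
    rcases eq_or_ne s 0 with rfl | hs
    · simp
    · obtain ⟨v, hv, hle⟩ := hlim x s hs
      have : v = f' x := sub_eq_zero.1 (hk _ fun z => by
        rw [inner_sub_right, hv, hf', sub_self])
      rwa [← this]
  exact ⟨f', fun z y => hf' y z, hrem, hf.of_remainder i hrem⟩

end WeakDerivative

/-! ### Regularity of the feature map of the kernel -/

section Coordinates

variable {e : ℕ} {K : Type*} [NormedAddCommGroup K]

/-- The `i`-th vector of the standard basis. -/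
noncomputable def stdVec (e : ℕ) (i : Fin e) : EuclideanSpace ℝ (Fin e) :=
  EuclideanSpace.single i 1

theorem sum_abs_le (v : EuclideanSpace ℝ (Fin e)) : ∑ i, |v i| ≤ e * ‖v‖ := by
  refine (Finset.sum_le_card_nsmul _ _ ‖v‖ fun i _ => ?_).trans_eq (by simp)
  exact PiLp.norm_apply_le v i

theorem sum_smul_stdVec (v : EuclideanSpace ℝ (Fin e)) : ∑ i, v i • stdVec e i = v := by
  have := (EuclideanSpace.basisFun (Fin e) ℝ).sum_repr v
  simpa [stdVec] using this

theorem norm_sub_le_of_coord {f : EuclideanSpace ℝ (Fin e) → K} {M : ℝ} (hM : 0 ≤ M)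
    (hf : ∀ i x s, ‖f (x + s • stdVec e i) - f x‖ ≤ M * |s|) (x v : EuclideanSpace ℝ (Fin e)) :
    ‖f (x + v) - f x‖ ≤ M * e * ‖v‖ := by
  have key : ∀ S : Finset (Fin e), ‖f (x + ∑ i ∈ S, v i • stdVec e i) - f x‖
      ≤ M * ∑ i ∈ S, |v i| := by
    intro S
    induction S using Finset.induction_on with
    | empty => simp
    | insert j S hj ih =>
      rw [Finset.sum_insert hj, Finset.sum_insert hj]
      have h₁ := hf j (x + ∑ i ∈ S, v i • stdVec e i) (v j)
      rw [add_comm (v j • stdVec e j), ← add_assoc]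
      linarith [norm_sub_le_norm_sub_add_norm_sub
        (f (x + ∑ i ∈ S, v i • stdVec e i + v j • stdVec e j))
        (f (x + ∑ i ∈ S, v i • stdVec e i)) (f x)]
  have h := key Finset.univ
  rw [sum_smul_stdVec] at h
  calc _ ≤ _ := h
    _ ≤ M * (e * ‖v‖) := by gcongr; exact sum_abs_le v
    _ = _ := by ring

variable [NormedSpace ℝ K]

/-- The linear map on `ℝᵉ` with prescribed values on the standard basis. -/
noncomputable def coordMap (a : Fin e → K) : EuclideanSpace ℝ (Fin e) →L[ℝ] K :=
  ∑ i, (EuclideanSpace.proj i : EuclideanSpace ℝ (Fin e) →L[ℝ] ℝ).smulRight (a i)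

theorem coordMap_apply (a : Fin e → K) (v : EuclideanSpace ℝ (Fin e)) :
    coordMap a v = ∑ i, v i • a i := by
  simp [coordMap, sum_apply]

theorem coordMap_sub (a b : Fin e → K) : coordMap a - coordMap b = coordMap fun i => a i - b i := by
  ext v
  simp [coordMap_apply, smul_sub]

theorem coordMap_smul (c : ℝ) (a : Fin e → K) : c • coordMap a = coordMap fun i => c • a i := by
  ext v
  simp [coordMap_apply, Finset.smul_sum, smul_comm c]

theorem norm_coordMap_le {a : Fin e → K} {C : ℝ} (hC : 0 ≤ C) (ha : ∀ i, ‖a i‖ ≤ C) :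
    ‖coordMap a‖ ≤ e * C := by
  refine ContinuousLinearMap.opNorm_le_bound _ (by positivity) fun v => ?_
  rw [coordMap_apply]
  calc ‖∑ i, v i • a i‖ ≤ ∑ i, |v i| * C := norm_sum_le_of_le _ fun i _ => by
        rw [norm_smul, Real.norm_eq_abs]
        gcongr
        exact ha i
    _ = (∑ i, |v i|) * C := (Finset.sum_mul _ _ _).symm
    _ ≤ e * ‖v‖ * C := by gcongr; exact sum_abs_le v
    _ = e * C * ‖v‖ := by ring

/-- A first-order expansion from expansions in the coordinate directions, with remainder of second
order. -/
theorem norm_sub_sub_coordMap_le {f : EuclideanSpace ℝ (Fin e) → K}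
    {f' : Fin e → EuclideanSpace ℝ (Fin e) → K} {M : ℝ} (hM : 0 ≤ M)
    (hrem : ∀ i x s, ‖f (x + s • stdVec e i) - f x - s • f' i x‖ ≤ M * s ^ 2)
    (hlip : ∀ i j x s, ‖f' i (x + s • stdVec e j) - f' i x‖ ≤ M * |s|)
    (x v : EuclideanSpace ℝ (Fin e)) :
    ‖f (x + v) - f x - coordMap (fun i => f' i x) v‖ ≤ M * e ^ 2 * ‖v‖ ^ 2 := by
  have hlip' : ∀ i (S : Finset (Fin e)), ‖f' i (x + ∑ i ∈ S, v i • stdVec e i) - f' i x‖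
      ≤ M * ∑ i ∈ S, |v i| := by
    intro i S
    induction S using Finset.induction_on with
    | empty => simp
    | insert j S hj ih =>
      rw [Finset.sum_insert hj, Finset.sum_insert hj]
      have h₁ := hlip i j (x + ∑ i ∈ S, v i • stdVec e i) (v j)
      rw [add_comm (v j • stdVec e j), ← add_assoc]
      linarith [norm_sub_le_norm_sub_add_norm_sub
        (f' i (x + ∑ i ∈ S, v i • stdVec e i + v j • stdVec e j))
        (f' i (x + ∑ i ∈ S, v i • stdVec e i)) (f' i x)]
  have key : ∀ S : Finset (Fin e), ‖f (x + ∑ i ∈ S, v i • stdVec e i) - f x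
      - ∑ i ∈ S, v i • f' i x‖ ≤ M * (∑ i ∈ S, |v i|) ^ 2 := by
    intro S
    induction S using Finset.induction_on with
    | empty => simp
    | insert j S hj ih =>
      rw [Finset.sum_insert hj, Finset.sum_insert hj, Finset.sum_insert hj]
      set y := x + ∑ i ∈ S, v i • stdVec e i with hy
      have h₁ := hrem j y (v j)
      have h₂ := hlip' j S
      rw [← hy] at h₂
      rw [add_comm (v j • stdVec e j), ← add_assoc, ← hy]
      have hs : 0 ≤ ∑ i ∈ S, |v i| := Finset.sum_nonneg fun _ _ => abs_nonneg _
      calc ‖f (y + v j • stdVec e j) - f x - (v j • f' j x + ∑ i ∈ S, v i • f' i x)‖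
          = ‖(f (y + v j • stdVec e j) - f y - v j • f' j y) + v j • (f' j y - f' j x)
            + (f y - f x - ∑ i ∈ S, v i • f' i x)‖ := by
            congr 1
            rw [smul_sub]
            abel
        _ ≤ M * v j ^ 2 + |v j| * (M * ∑ i ∈ S, |v i|) + M * (∑ i ∈ S, |v i|) ^ 2 := by
            refine norm_add₃_le.trans (add_le_add_three h₁ ?_ ih)
            rw [norm_smul, Real.norm_eq_abs]
            gcongr
        _ ≤ M * (|v j| + ∑ i ∈ S, |v i|) ^ 2 := by
            rw [← sq_abs (v j)]
            have : 0 ≤ M * (|v j| * ∑ i ∈ S, |v i|) := by positivity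
            linarith
  have h := key Finset.univ
  rw [sum_smul_stdVec] at h
  rw [coordMap_apply]
  calc _ ≤ _ := h
    _ ≤ M * (e * ‖v‖) ^ 2 := by
        have := sum_abs_le v
        have h0 : 0 ≤ ∑ i, |v i| := Finset.sum_nonneg fun _ _ => abs_nonneg _
        gcongr
    _ = _ := by ring

end Coordinates

/-- `φ` is of class `C²` with derivatives `φ₁` and `φ₂`; all of `φ₁`, `φ₂` and the Lipschitz
constants of `φ`, `φ₁`, `φ₂` are bounded by `L`, as are the constants of the second-order remainders
of `φ` and `φ₁`. -/
structure HasLipDeriv₂ {E K : Type*} [NormedAddCommGroup E] [NormedSpace ℝ E]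
    [NormedAddCommGroup K] [NormedSpace ℝ K] (φ : E → K) (φ₁ : E → E →L[ℝ] K)
    (φ₂ : E → E →L[ℝ] E →L[ℝ] K) (L : ℝ) : Prop where
  lip₀ : ∀ x y, ‖φ y - φ x‖ ≤ L * ‖y - x‖
  bound₁ : ∀ x, ‖φ₁ x‖ ≤ L
  lip₁ : ∀ x y, ‖φ₁ y - φ₁ x‖ ≤ L * ‖y - x‖
  bound₂ : ∀ x, ‖φ₂ x‖ ≤ L
  lip₂ : ∀ x y, ‖φ₂ y - φ₂ x‖ ≤ L * ‖y - x‖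
  rem₀ : ∀ x v, ‖φ (x + v) - φ x - φ₁ x v‖ ≤ L * ‖v‖ ^ 2
  rem₁ : ∀ x v, ‖φ₁ (x + v) - φ₁ x - φ₂ x v‖ ≤ L * ‖v‖ ^ 2

section KernelRegularity

variable {e : ℕ} {g : EuclideanSpace ℝ (Fin e) → EuclideanSpace ℝ (Fin e) → ℝ}

theorem IsBoundedFourTimesDiff.hasLineDerivAt_y (hg : IsBoundedFourTimesDiff g)
    {J : List (Fin e)} (hJ : J.length < 4) (i : Fin e) (x y : EuclideanSpace ℝ (Fin e)) :
    HasLineDerivAt ℝ (fun z => mixedPartial g [] J x z) (mixedPartial g [] (i :: J) x y) y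
      (stdVec e i) :=
  (hg.diffY J hJ i x y).hasLineDerivAt

theorem IsBoundedFourTimesDiff.hasLineDerivAt_x (hg : IsBoundedFourTimesDiff g)
    {I J : List (Fin e)} (hI : I.length < 4) (hJ : J.length ≤ 4) (i : Fin e)
    (x y : EuclideanSpace ℝ (Fin e)) :
    HasLineDerivAt ℝ (fun z => mixedPartial g I J z y) (mixedPartial g (i :: I) J x y) x
      (stdVec e i) :=
  (hg.diffX I J hI hJ i x y).hasLineDerivAt

theorem IsBoundedFourTimesDiff.exists_bound (hg : IsBoundedFourTimesDiff g) :
    ∃ C, ∀ I J : List (Fin e), I.length ≤ 4 → J.length ≤ 4 → ∀ x y,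
      ‖mixedPartial g I J x y‖ ≤ C := by
  have h : ∀ n m : ℕ, ∃ C, 0 ≤ C ∧ (n ≤ 4 → m ≤ 4 → ∀ (I : Fin n → Fin e) (J : Fin m → Fin e) x y,
      ‖mixedPartial g (List.ofFn I) (List.ofFn J) x y‖ ≤ C) := by
    intro n m
    by_cases hnm : n ≤ 4 ∧ m ≤ 4
    · obtain ⟨C, hC⟩ := hg.bounded n hnm.1 m hnm.2
      refine ⟨|C|, abs_nonneg _, fun _ _ I J x y => ?_⟩
      refine le_trans ?_ ((hC ⟨(x, y), rfl⟩).trans (le_abs_self C))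
      refine Real.le_sqrt_of_sq_le ?_
      refine le_trans ?_ (Finset.single_le_sum (f := fun I : Fin n → Fin e =>
        ∑ J : Fin m → Fin e, |mixedPartial g (List.ofFn I) (List.ofFn J) x y| ^ 2)
        (fun _ _ => by positivity) (Finset.mem_univ I))
      exact Finset.single_le_sum (f := fun J : Fin m → Fin e =>
        |mixedPartial g (List.ofFn I) (List.ofFn J) x y| ^ 2)
        (fun _ _ => by positivity) (Finset.mem_univ J)
    · exact ⟨0, le_rfl, fun h₁ h₂ => absurd ⟨h₁, h₂⟩ hnm⟩
  choose C hC0 hC using h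
  refine ⟨∑ n ∈ Finset.range 5, ∑ m ∈ Finset.range 5, C n m, fun I J hI hJ x y => ?_⟩
  have h₁ := hC I.length J.length hI hJ I.get J.get x y
  rw [List.ofFn_get, List.ofFn_get] at h₁
  calc _ ≤ C I.length J.length := h₁
    _ ≤ ∑ m ∈ Finset.range 5, C I.length m :=
        Finset.single_le_sum (f := fun m => C I.length m) (fun _ _ => hC0 _ _)
          (Finset.mem_range.2 (by omega))
    _ ≤ _ := Finset.single_le_sum (f := fun n => ∑ m ∈ Finset.range 5, C n m)
          (fun _ _ => Finset.sum_nonneg fun _ _ => hC0 _ _) (Finset.mem_range.2 (by omega))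

variable {H : Type} [NormedAddCommGroup H] [InnerProductSpace ℝ H]

/-- Iterated differences of the feature map: their Gram matrix consists of iterated differences of
the kernel in both variables, hence is bounded by the mixed partial derivatives. -/
theorem IsBoundedFourTimesDiff.exists_diffBound (hg : IsBoundedFourTimesDiff g)
    {φ : EuclideanSpace ℝ (Fin e) → H} (hφ : ∀ x y, inner ℝ (φ x) (φ y) = g x y) :
    ∃ M, 0 ≤ M ∧ DiffBound (stdVec e) M 4 φ := by
  obtain ⟨C, hC⟩ := hg.exists_bound
  refine ⟨√C, Real.sqrt_nonneg _, fun L hL x => ?_⟩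
  have h₁ : ∀ (J : List (Fin e)), J.length ≤ 4 → ∀ y,
      ‖iterDiff (stdVec e) L (fun z => mixedPartial g [] J z y) x‖ ≤ C * stepProd L :=
    fun J hJ y => norm_iterDiff_le_of_hasLineDerivAt (N := 4)
      (f := fun I z => mixedPartial g I J z y)
      (fun I hI i z => hg.hasLineDerivAt_x hI hJ i z y) (fun I hI z => hC I J hI hJ z y) L []
      (by simpa using hL) x
  have h₂ := norm_iterDiff_le_of_hasLineDerivAt (N := 4)
    (f := fun J y => iterDiff (stdVec e) L (fun z => mixedPartial g [] J z y) x)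
    (fun J hJ i y => hasLineDerivAt_iterDiff_param
      (f := fun z y => mixedPartial g [] J z y) (f' := fun z y => mixedPartial g [] (i :: J) z y)
      (fun z => hg.hasLineDerivAt_y hJ i z y) (stdVec e) L x)
    h₁ L [] (by simpa using hL) x
  have h₃ : iterDiff (stdVec e) L
      (fun y => iterDiff (stdVec e) L (fun z => mixedPartial g [] [] z y) x) x
      = inner ℝ (iterDiff (stdVec e) L φ x) (iterDiff (stdVec e) L φ x) := by
    rw [← innerₛₗ_apply_apply ℝ, ← iterDiff_map]
    congr 1
    funext y
    rw [innerₛₗ_apply_apply, real_inner_comm, ← innerₛₗ_apply_apply ℝ, ← iterDiff_map]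
    congr 1
    funext z
    rw [innerₛₗ_apply_apply, real_inner_comm, hφ]
    rfl
  rw [h₃, real_inner_self_eq_norm_sq, Real.norm_of_nonneg (sq_nonneg _)] at h₂
  have hs := stepProd_nonneg L
  have hCnn : 0 ≤ C := (norm_nonneg _).trans (hC [] [] (by simp) (by simp) x x)
  refine (sq_le_sq₀ (norm_nonneg _) (by positivity)).1 ?_
  rw [mul_pow, Real.sq_sqrt hCnn]
  linarith

variable [CompleteSpace H]

/-- The feature map of a kernel with bounded mixed partial derivatives is twice differentiable, with
Lipschitz continuous derivatives. -/
theorem IsBoundedFourTimesDiff.exists_hasLipDeriv₂ (hg : IsBoundedFourTimesDiff g)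
    {φ : EuclideanSpace ℝ (Fin e) → H} (hφ : ∀ x y, inner ℝ (φ x) (φ y) = g x y)
    (hsep : ∀ v, (∀ z, inner ℝ (φ z) v = 0) → v = 0) :
    ∃ φ₁ φ₂ L, 0 ≤ L ∧ HasLipDeriv₂ φ φ₁ φ₂ L := by
  obtain ⟨M, hM, h₀⟩ := hg.exists_diffBound hφ
  choose ψ hψ hψr hψb using fun i => h₀.exists_partial hsep i
    (a := fun z y => mixedPartial g [] [i] z y) fun z y => by
      simp only [hφ]
      exact hg.hasLineDerivAt_y (J := []) (by simp) i z y
  choose χ _ hχr hχb using fun j i => (hψb i).exists_partial hsep j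
    (a := fun z y => mixedPartial g [] [j, i] z y) fun z y => by
      simp only [hψ]
      exact hg.hasLineDerivAt_y (J := [i]) (by simp) j z y
  set n : ℝ := (e : ℝ) with hn
  have hn0 : 0 ≤ n := by positivity
  have hψl : ∀ i x v, ‖ψ i (x + v) - ψ i x‖ ≤ M * n * ‖v‖ := fun i =>
    norm_sub_le_of_coord hM fun j x s => (hψb i).norm_sub_le (by norm_num) j x s
  have hχl : ∀ j i x v, ‖χ j i (x + v) - χ j i x‖ ≤ M * n * ‖v‖ := fun j i =>
    norm_sub_le_of_coord hM fun k x s => (hχb j i).norm_sub_le (by norm_num) k x s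
  have hp₁ : n ≤ (1 + n) ^ 3 := by nlinarith [pow_nonneg hn0 2, pow_nonneg hn0 3]
  have hp₂ : n ^ 2 ≤ (1 + n) ^ 3 := by nlinarith [pow_nonneg hn0 2, pow_nonneg hn0 3]
  have hp₃ : n ^ 3 ≤ (1 + n) ^ 3 := by gcongr; linarith
  have hL₁ : M * n ≤ M * (1 + n) ^ 3 := by gcongr
  have hL₂ : M * n ^ 2 ≤ M * (1 + n) ^ 3 := by gcongr
  have hL₃ : M * n ^ 3 ≤ M * (1 + n) ^ 3 := by gcongr
  refine ⟨fun x => coordMap fun i => ψ i x, fun x => coordMap fun j => coordMap fun i => χ j i x,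
    M * (1 + n) ^ 3, by positivity, ?_, ?_, ?_, ?_, ?_, ?_, ?_⟩
  · intro x y
    have h := norm_sub_le_of_coord hM (fun i x s => h₀.norm_sub_le (by norm_num) i x s) x (y - x)
    rw [add_sub_cancel] at h
    exact h.trans (by gcongr)
  · intro x
    exact (norm_coordMap_le hM fun i => (hψb i).norm_le x).trans (by linarith)
  · intro x y
    rw [coordMap_sub]
    refine (norm_coordMap_le (C := M * n * ‖y - x‖) (by positivity) fun i => ?_).trans ?_
    · simpa using hψl i x (y - x)
    · calc n * (M * n * ‖y - x‖) = M * n ^ 2 * ‖y - x‖ := by ring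
        _ ≤ _ := by gcongr
  · intro x
    refine (norm_coordMap_le (C := n * M) (by positivity) fun j =>
      norm_coordMap_le hM fun i => (hχb j i).norm_le x).trans ?_
    linarith
  · intro x y
    rw [coordMap_sub]
    refine (norm_coordMap_le (C := n * (M * n * ‖y - x‖)) (by positivity) fun j => ?_).trans ?_
    · rw [coordMap_sub]
      exact norm_coordMap_le (by positivity) fun i => by simpa using hχl j i x (y - x)
    · calc n * (n * (M * n * ‖y - x‖)) = M * n ^ 3 * ‖y - x‖ := by ring
        _ ≤ _ := by gcongr
  · intro x v
    refine (norm_sub_sub_coordMap_le hM hψr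
      (fun i j x s => (hψb i).norm_sub_le (by norm_num) j x s) x v).trans ?_
    gcongr
  · intro x v
    refine (norm_sub_sub_coordMap_le (M := n * M) (by positivity)
      (f := fun x => coordMap fun i => ψ i x) (f' := fun j x => coordMap fun i => χ j i x)
      (fun j x s => ?_) (fun j k x s => ?_) x v).trans ?_
    · rw [coordMap_sub, coordMap_smul, coordMap_sub, mul_assoc]
      exact norm_coordMap_le (by positivity) fun i => hχr j i x s
    · rw [coordMap_sub, mul_assoc]
      exact norm_coordMap_le (by positivity) fun i => (hχb j i).norm_sub_le (by norm_num) k x s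
    · calc n * M * n ^ 2 * ‖v‖ ^ 2 = M * n ^ 3 * ‖v‖ ^ 2 := by ring
        _ ≤ _ := by gcongr

end KernelRegularity

/-! ### Lifted paths and their derivatives -/

namespace BVPath

variable {t T : ℝ} {E : Type*} [NormedAddCommGroup E] [NormedSpace ℝ E]

theorem norm_apply_le_supNorm (γ : BVPath t T E) (u : Icc t T) : ‖γ u‖ ≤ γ.supNorm :=
  γ.toCM.norm_coe_le_norm u

theorem supNorm_nonneg (γ : BVPath t T E) : 0 ≤ γ.supNorm :=
  norm_nonneg _

theorem supNorm_le {γ : BVPath t T E} {C : ℝ} (hC : 0 ≤ C) (h : ∀ u, ‖γ u‖ ≤ C) : γ.supNorm ≤ C :=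
  (ContinuousMap.norm_le _ hC).2 h

variable [Fact (t ≤ T)]

theorem var_le_norm (γ : BVPath t T E) : (γ.var : ℝ) ≤ ‖γ‖ := by
  rw [norm_def]
  linarith [norm_nonneg (γ ⊥)]

theorem supNorm_le_norm (γ : BVPath t T E) : γ.supNorm ≤ ‖γ‖ := by
  refine supNorm_le (norm_nonneg _) fun u => ?_
  obtain ⟨w, hw, h0, hc⟩ := γ.varLE
  have h₁ := hw ⊥ u bot_le
  have h₂ := hw.monotone (le_top : u ≤ ⊤)
  have h₃ := norm_le_norm_add_norm_sub (γ ⊥) (γ u)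
  rw [norm_sub_rev] at h₃
  rw [norm_def]
  linarith

theorem norm_apply_le (γ : BVPath t T E) (u : Icc t T) : ‖γ u‖ ≤ ‖γ‖ :=
  (γ.norm_apply_le_supNorm u).trans γ.supNorm_le_norm

end BVPath

theorem VarLE.of_norm_sub_le {t T : ℝ} [Fact (t ≤ T)] {E₁ E₂ E₃ F : Type*}
    [NormedAddCommGroup E₁] [NormedAddCommGroup E₂] [NormedAddCommGroup E₃] [NormedAddCommGroup F]
    {f₁ : Icc t T → E₁} {f₂ : Icc t T → E₂} {f₃ : Icc t T → E₃} {f : Icc t T → F}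
    {c₁ c₂ c₃ a₁ a₂ a₃ : ℝ} (h₁ : VarLE f₁ c₁) (h₂ : VarLE f₂ c₂) (h₃ : VarLE f₃ c₃)
    (ha₁ : 0 ≤ a₁) (ha₂ : 0 ≤ a₂) (ha₃ : 0 ≤ a₃)
    (h : ∀ r s, ‖f s - f r‖ ≤ a₁ * ‖f₁ s - f₁ r‖ + a₂ * ‖f₂ s - f₂ r‖ + a₃ * ‖f₃ s - f₃ r‖) :
    VarLE f (a₁ * c₁ + a₂ * c₂ + a₃ * c₃) := by
  obtain ⟨w₁, k₁, l₁, m₁⟩ := h₁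
  obtain ⟨w₂, k₂, l₂, m₂⟩ := h₂
  obtain ⟨w₃, k₃, l₃, m₃⟩ := h₃
  refine ⟨fun u => a₁ * w₁ u + a₂ * w₂ u + a₃ * w₃ u, fun r s hrs => (h r s).trans ?_,
    by simp [l₁, l₂, l₃],
    add_le_add_three (mul_le_mul_of_nonneg_left m₁ ha₁) (mul_le_mul_of_nonneg_left m₂ ha₂)
      (mul_le_mul_of_nonneg_left m₃ ha₃)⟩
  have := mul_le_mul_of_nonneg_left (k₁ r s hrs) ha₁
  have := mul_le_mul_of_nonneg_left (k₂ r s hrs) ha₂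
  have := mul_le_mul_of_nonneg_left (k₃ r s hrs) ha₃
  linarith

namespace HasLipDeriv₂

variable {E K : Type*} [NormedAddCommGroup E] [NormedSpace ℝ E] [NormedAddCommGroup K]
  [NormedSpace ℝ K] {φ : E → K} {φ₁ : E → E →L[ℝ] K} {φ₂ : E → E →L[ℝ] E →L[ℝ] K} {L : ℝ}

theorem nonneg (hφ : HasLipDeriv₂ φ φ₁ φ₂ L) : 0 ≤ L :=
  (norm_nonneg _).trans (hφ.bound₁ 0)

theorem norm_apply₁_sub_le (hφ : HasLipDeriv₂ φ φ₁ φ₂ L) (x y v w : E) :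
    ‖φ₁ y w - φ₁ x v‖ ≤ L * ‖y - x‖ * ‖w‖ + L * ‖w - v‖ := by
  calc ‖φ₁ y w - φ₁ x v‖ = ‖(φ₁ y - φ₁ x) w + φ₁ x (w - v)‖ := by
        congr 1; rw [sub_apply, map_sub]; abel
    _ ≤ _ := (norm_add_le _ _).trans (add_le_add
        (ContinuousLinearMap.le_of_opNorm_le _ (hφ.lip₁ x y) w)
        (ContinuousLinearMap.le_of_opNorm_le _ (hφ.bound₁ x) _))

theorem norm_apply₂_le (hφ : HasLipDeriv₂ φ φ₁ φ₂ L) (x v w : E) :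
    ‖φ₂ x w v‖ ≤ L * ‖w‖ * ‖v‖ :=
  ContinuousLinearMap.le_of_opNorm_le _
    (ContinuousLinearMap.le_of_opNorm_le _ (hφ.bound₂ x) w) v

theorem norm_apply₂_sub_le (hφ : HasLipDeriv₂ φ φ₁ φ₂ L) (x y v v' w w' : E) :
    ‖φ₂ y w' v' - φ₂ x w v‖
      ≤ L * ‖y - x‖ * ‖w'‖ * ‖v'‖ + L * ‖w' - w‖ * ‖v'‖ + L * ‖w‖ * ‖v' - v‖ := by
  calc ‖φ₂ y w' v' - φ₂ x w v‖
      = ‖(φ₂ y - φ₂ x) w' v' + φ₂ x (w' - w) v' + φ₂ x w (v' - v)‖ := by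
        congr 1; simp only [sub_apply, map_sub]; abel
    _ ≤ _ := norm_add₃_le.trans (add_le_add_three
        (ContinuousLinearMap.le_of_opNorm_le _
          (ContinuousLinearMap.le_of_opNorm_le _ (hφ.lip₂ x y) w') v')
        (hφ.norm_apply₂_le x v' (w' - w)) (hφ.norm_apply₂_le x (v' - v) w))

theorem continuous₀ (hφ : HasLipDeriv₂ φ φ₁ φ₂ L) : Continuous φ :=
  (LipschitzWith.of_dist_le_mul (K := ⟨L, hφ.nonneg⟩) fun x y => by
    rw [dist_eq_norm, dist_eq_norm]; exact hφ.lip₀ y x).continuous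

theorem continuous₁ (hφ : HasLipDeriv₂ φ φ₁ φ₂ L) : Continuous φ₁ :=
  (lipschitzWith_iff_norm_sub_le (C := ⟨L, hφ.nonneg⟩).2 fun x y => hφ.lip₁ y x).continuous

theorem continuous₂ (hφ : HasLipDeriv₂ φ φ₁ φ₂ L) : Continuous φ₂ := by
  have h : LipschitzWith ⟨L, hφ.nonneg⟩ φ₂ :=
    lipschitzWith_iff_norm_sub_le.2 fun x y => hφ.lip₂ y x
  exact h.continuous

variable {t T : ℝ} [Fact (t ≤ T)]

theorem varLE_lift₀ (hφ : HasLipDeriv₂ φ φ₁ φ₂ L) (γ : BVPath t T E) {r : ℝ} (hr : γ.var ≤ r) :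
    VarLE (fun u => φ (γ u)) (L * r) := by
  have hL := hφ.nonneg
  refine (VarLE.of_norm_sub_le γ.varLE γ.varLE γ.varLE hL le_rfl le_rfl
    fun u s => ?_).mono (by rw [zero_mul, add_zero, add_zero]; gcongr)
  simpa using hφ.lip₀ (γ u) (γ s)

theorem varLE_lift₁ (hφ : HasLipDeriv₂ φ φ₁ φ₂ L) (γ η : BVPath t T E) {r : ℝ} (hr : γ.var ≤ r) :
    VarLE (fun u => φ₁ (γ u) (η u)) (L * (1 + r) * ‖η‖) := by
  have hL := hφ.nonneg
  refine (VarLE.of_norm_sub_le γ.varLE η.varLE γ.varLE (a₁ := L * ‖η‖) (by positivity) hL le_rfl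
    fun u s => ?_).mono ?_
  · refine (hφ.norm_apply₁_sub_le (γ u) (γ s) (η u) (η s)).trans ?_
    have : L * ‖γ s - γ u‖ * ‖η s‖ ≤ L * ‖γ s - γ u‖ * ‖η‖ := by
      gcongr; exact η.norm_apply_le s
    linarith
  · have h₁ : L * ‖η‖ * γ.var ≤ L * ‖η‖ * r := by gcongr
    have h₂ : L * η.var ≤ L * ‖η‖ := by gcongr; exact η.var_le_norm
    linarith

theorem varLE_lift₂ (hφ : HasLipDeriv₂ φ φ₁ φ₂ L) (γ η η' : BVPath t T E) {r : ℝ} (hr : γ.var ≤ r) :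
    VarLE (fun u => φ₂ (γ u) (η' u) (η u)) (L * (2 + r) * (‖η‖ * ‖η'‖)) := by
  have hL := hφ.nonneg
  refine (VarLE.of_norm_sub_le γ.varLE η'.varLE η.varLE (a₁ := L * ‖η'‖ * ‖η‖) (a₂ := L * ‖η‖)
    (a₃ := L * ‖η'‖) (by positivity) (by positivity) (by positivity) fun u s => ?_).mono ?_
  · refine (hφ.norm_apply₂_sub_le (γ u) (γ s) (η u) (η s) (η' u) (η' s)).trans ?_
    have h₁ : L * ‖γ s - γ u‖ * ‖η' s‖ * ‖η s‖ ≤ L * ‖γ s - γ u‖ * ‖η'‖ * ‖η‖ := by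
      gcongr
      · exact η'.norm_apply_le s
      · exact η.norm_apply_le s
    have h₂ : L * ‖η' s - η' u‖ * ‖η s‖ ≤ L * ‖η' s - η' u‖ * ‖η‖ := by
      gcongr; exact η.norm_apply_le s
    have h₃ : L * ‖η' u‖ * ‖η s - η u‖ ≤ L * ‖η'‖ * ‖η s - η u‖ := by
      gcongr; exact η'.norm_apply_le u
    linarith
  · have h₁ : L * ‖η'‖ * ‖η‖ * γ.var ≤ L * ‖η'‖ * ‖η‖ * r := by gcongr
    have h₂ : L * ‖η‖ * η'.var ≤ L * ‖η‖ * ‖η'‖ := by gcongr; exact η'.var_le_norm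
    have h₃ : L * ‖η'‖ * η.var ≤ L * ‖η'‖ * ‖η‖ := by gcongr; exact η.var_le_norm
    linarith

variable (hφ : HasLipDeriv₂ φ φ₁ φ₂ L)

/-- The lifted path `φ(γ)`. -/
noncomputable def lift₀ (γ : BVPath t T E) : BVPath t T K :=
  ⟨⟨fun u => φ (γ u), hφ.continuous₀.comp γ.toCM.continuous⟩,
    (hφ.varLE_lift₀ γ le_rfl).boundedVariationOn⟩

/-- The derivative `Dφ(γ)η` of the lifted path. -/
noncomputable def lift₁ (γ η : BVPath t T E) : BVPath t T K :=
  ⟨⟨fun u => φ₁ (γ u) (η u),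
    (hφ.continuous₁.comp γ.toCM.continuous).clm_apply η.toCM.continuous⟩,
    (hφ.varLE_lift₁ γ η le_rfl).boundedVariationOn⟩

/-- The second derivative `D²φ(γ)(η', η)` of the lifted path. -/
noncomputable def lift₂ (γ η η' : BVPath t T E) : BVPath t T K :=
  ⟨⟨fun u => φ₂ (γ u) (η' u) (η u),
    ((hφ.continuous₂.comp γ.toCM.continuous).clm_apply η'.toCM.continuous).clm_apply
      η.toCM.continuous⟩, (hφ.varLE_lift₂ γ η η' le_rfl).boundedVariationOn⟩

theorem lift₁_add (γ η ζ : BVPath t T E) : hφ.lift₁ γ (η + ζ) = hφ.lift₁ γ η + hφ.lift₁ γ ζ :=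
  Subtype.ext (ContinuousMap.ext fun u => map_add (φ₁ (γ u)) (η u) (ζ u))

theorem lift₁_smul (c : ℝ) (γ η : BVPath t T E) : hφ.lift₁ γ (c • η) = c • hφ.lift₁ γ η :=
  Subtype.ext (ContinuousMap.ext fun u => map_smul (φ₁ (γ u)) c (η u))

theorem lift₂_add_left (γ η ζ η' : BVPath t T E) :
    hφ.lift₂ γ (η + ζ) η' = hφ.lift₂ γ η η' + hφ.lift₂ γ ζ η' :=
  Subtype.ext (ContinuousMap.ext fun u => map_add (φ₂ (γ u) (η' u)) (η u) (ζ u))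

theorem lift₂_smul_left (c : ℝ) (γ η η' : BVPath t T E) :
    hφ.lift₂ γ (c • η) η' = c • hφ.lift₂ γ η η' :=
  Subtype.ext (ContinuousMap.ext fun u => map_smul (φ₂ (γ u) (η' u)) c (η u))

theorem lift₂_add_right (γ η η' ζ' : BVPath t T E) :
    hφ.lift₂ γ η (η' + ζ') = hφ.lift₂ γ η η' + hφ.lift₂ γ η ζ' :=
  Subtype.ext (ContinuousMap.ext fun u => 
    congrArg (fun A : E →L[ℝ] K => A (η u)) (map_add (φ₂ (γ u)) (η' u) (ζ' u)))

theorem lift₂_smul_right (c : ℝ) (γ η η' : BVPath t T E) :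
    hφ.lift₂ γ η (c • η') = c • hφ.lift₂ γ η η' :=
  Subtype.ext (ContinuousMap.ext fun u =>
    congrArg (fun A : E →L[ℝ] K => A (η u)) (map_smul (φ₂ (γ u)) c (η' u)))

theorem supNorm_lift₀_sub_le (γ γ' : BVPath t T E) :
    (hφ.lift₀ γ' - hφ.lift₀ γ).supNorm ≤ L * (γ' - γ).supNorm := by
  have hL := hφ.nonneg
  have hd := (γ' - γ).supNorm_nonneg
  exact BVPath.supNorm_le (by positivity) fun u => (hφ.lip₀ (γ u) (γ' u)).trans
    (mul_le_mul_of_nonneg_left ((γ' - γ).norm_apply_le_supNorm u) hL)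

theorem supNorm_lift₁_sub_le (γ γ' η : BVPath t T E) :
    (hφ.lift₁ γ' η - hφ.lift₁ γ η).supNorm ≤ L * (γ' - γ).supNorm * ‖η‖ := by
  have hL := hφ.nonneg
  have hd := (γ' - γ).supNorm_nonneg
  refine BVPath.supNorm_le (by positivity) fun u =>
    (hφ.norm_apply₁_sub_le (γ u) (γ' u) (η u) (η u)).trans ?_
  rw [sub_self, norm_zero, mul_zero, add_zero]
  gcongr
  · exact (γ' - γ).norm_apply_le_supNorm u
  · exact η.norm_apply_le u

theorem supNorm_lift₂_sub_le (γ γ' η η' : BVPath t T E) :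
    (hφ.lift₂ γ' η η' - hφ.lift₂ γ η η').supNorm
      ≤ L * (γ' - γ).supNorm * (‖η‖ * ‖η'‖) := by
  have hL := hφ.nonneg
  have hd := (γ' - γ).supNorm_nonneg
  refine BVPath.supNorm_le (by positivity) fun u =>
    (hφ.norm_apply₂_sub_le (γ u) (γ' u) (η u) (η u) (η' u) (η' u)).trans ?_
  rw [sub_self, norm_zero, mul_zero, sub_self, norm_zero, mul_zero, zero_mul, add_zero, add_zero,
    mul_assoc _ ‖η' u‖, mul_comm ‖η' u‖]
  gcongr
  · exact (γ' - γ).norm_apply_le_supNorm u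
  · exact η.norm_apply_le u
  · exact η'.norm_apply_le u

theorem norm_apply_sq_le (η : BVPath t T E) (u : Icc t T) : ‖η u‖ ^ 2 ≤ ‖η‖ * η.supNorm := by
  rw [sq]
  exact mul_le_mul (η.norm_apply_le u) (η.norm_apply_le_supNorm u) (norm_nonneg _) (norm_nonneg _)

theorem supNorm_lift₀_rem_le (γ η : BVPath t T E) :
    (hφ.lift₀ (γ + η) - hφ.lift₀ γ - hφ.lift₁ γ η).supNorm ≤ L * (‖η‖ * η.supNorm) := by
  have hL := hφ.nonneg
  have hd := η.supNorm_nonneg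
  exact BVPath.supNorm_le (by positivity) fun u => (hφ.rem₀ (γ u) (η u)).trans
    (mul_le_mul_of_nonneg_left (norm_apply_sq_le η u) hL)

theorem supNorm_lift₁_rem_le (γ η η' : BVPath t T E) :
    (hφ.lift₁ (γ + η') η - hφ.lift₁ γ η - hφ.lift₂ γ η η').supNorm
      ≤ L * (‖η'‖ * η'.supNorm) * ‖η‖ := by
  have hL := hφ.nonneg
  have hd := η'.supNorm_nonneg
  refine BVPath.supNorm_le (by positivity) fun u =>
    (ContinuousLinearMap.le_of_opNorm_le _ (hφ.rem₁ (γ u) (η' u)) (η u)).trans ?_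
  gcongr
  · exact norm_apply_sq_le η' u
  · exact η.norm_apply_le u

end HasLipDeriv₂

/-! ### Perturbation of linear controlled equations -/

section Perturbation

variable {t T : ℝ} [Fact (t ≤ T)] {F H : Type*} [NormedAddCommGroup H]
  [NormedAddCommGroup F] [NormedSpace ℝ F] [NormedSpace ℝ H] [CompleteSpace F]
  {B : F →L[ℝ] H →L[ℝ] F} (hB : ∀ a h, ‖B a h‖ ≤ ‖a‖ * ‖h‖)

theorem volterra_apply_sub_apply (X Z : BVPath t T H) (Y W : C(Icc t T, F)) :
    volterra B hB X Y - volterra B hB Z W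
      = volterra B hB (X - Z) Y + volterra B hB Z (Y - W) := by
  rw [volterra_sub, sub_apply, map_sub]
  abel

/-- The difference of the solutions of two linear equations solves a linear equation, whose forcing
term contains the difference of the drivers only as the driver of an integral. -/
theorem volterraResolvent_sub (X X' : BVPath t T H) (Z Z' : C(Icc t T, F)) :
    volterraResolvent B hB X' Z' - volterraResolvent B hB X Z
      = volterraResolvent B hB X
        (volterra B hB (X' - X) (volterraResolvent B hB X' Z') + (Z' - Z)) := by
  apply eq_volterraResolvent
  have h := volterraResolvent_eq hB X Z
  have h' := volterraResolvent_eq hB X' Z'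
  set Y := volterraResolvent B hB X Z
  set Y' := volterraResolvent B hB X' Z'
  have h₁ : Y' - Y = (Z' - Z) + (volterra B hB X' Y' - volterra B hB X Y) := by
    rw [← add_sub_add_comm, ← h', ← h]
  refine h₁.trans ?_
  rw [volterra_apply_sub_apply]
  abel

theorem varLE_volterraResolvent {X : BVPath t T H} {c z : ℝ} (hX : VarLE X c)
    {Z : C(Icc t T, F)} (hZ : VarLE Z z) :
    VarLE (volterraResolvent B hB X Z) (z + c * ‖volterraResolvent B hB X Z‖) := by
  have h := hZ.add (varLE_volterra hB hX (volterraResolvent B hB X Z))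
  have e := congrArg (fun Y : C(Icc t T, F) => (Y : Icc t T → F)) (volterraResolvent_eq hB X Z)
  exact e ▸ h

end Perturbation

/-! ### Constants of the estimates -/

namespace SigConst

/-! In the following constants, `L` is the Lipschitz bound of the feature map and `r` a bound for
the 1-variation of the paths. For `k = 0, 1, 2`, the constant `cₖ` bounds the `k`-th derivative of
the signature in the uniform norm, `vₖ` is twice `cₖ` plus a bound for its variation, `dₖ` is its
Lipschitz constant in the path for the uniform norm, and `m₀`, `m₁` are the constants of the
second-order remainders of the signature and its derivative. -/

variable (L r : ℝ)

/-- Uniform bound for the signature, and for the resolvent of the Volterra operator. -/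
noncomputable def c₀ : ℝ := 2 * Real.exp (2 * (L * r))

/-- Twice the uniform bound plus the variation of the signature. -/
noncomputable def v₀ : ℝ := 2 * c₀ L r + L * r * c₀ L r

/-- Lipschitz constant of the signature. -/
noncomputable def d₀ : ℝ := c₀ L r * (L * v₀ L r)

/-- Uniform bound for the derivative of the signature. -/
noncomputable def c₁ : ℝ := c₀ L r * (L * (1 + r) * c₀ L r)

/-- Twice the uniform bound plus the variation of the derivative of the signature. -/
noncomputable def v₁ : ℝ := 2 * c₁ L r + (L * (1 + r) * c₀ L r + L * r * c₁ L r)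

/-- Lipschitz constant of the derivative of the signature. -/
noncomputable def d₁ : ℝ := c₀ L r * (L * v₁ L r + (L * v₀ L r + L * (1 + r) * d₀ L r))

/-- Uniform bound for the second derivative of the signature. -/
noncomputable def c₂ : ℝ := c₀ L r * (2 * (L * (1 + r) * c₁ L r) + L * (2 + r) * c₀ L r)

/-- Twice the uniform bound plus the variation of the second derivative of the signature. -/
noncomputable def v₂ : ℝ :=
  2 * c₂ L r + (2 * (L * (1 + r) * c₁ L r) + L * (2 + r) * c₀ L r + L * r * c₂ L r)

/-- Lipschitz constant of the second derivative of the signature. -/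
noncomputable def d₂ : ℝ :=
  c₀ L r * (L * v₂ L r + (2 * (L * v₁ L r + L * (1 + r) * d₁ L r)
    + (L * v₀ L r + L * (2 + r) * d₀ L r)))

/-- Remainder constant of the signature. -/
noncomputable def m₀ : ℝ := c₀ L r * (L * v₀ L r + L * (1 + r) * d₀ L r)

/-- Remainder constant of the derivative of the signature. -/
noncomputable def m₁ : ℝ :=
  c₀ L r * (L * v₁ L r + L * (1 + r) * d₁ L r + (L * v₀ L r + L * (2 + r) * d₀ L r)
    + L * (1 + r) * m₀ L r)

theorem continuous_c₀ : Continuous (c₀ L) := by unfold c₀; fun_prop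

theorem continuous_v₀ : Continuous (v₀ L) := by
  have := continuous_c₀ L
  unfold v₀; fun_prop

theorem continuous_d₀ : Continuous (d₀ L) := by
  have := continuous_c₀ L; have := continuous_v₀ L
  unfold d₀; fun_prop

theorem continuous_c₁ : Continuous (c₁ L) := by
  have := continuous_c₀ L
  unfold c₁; fun_prop

theorem continuous_v₁ : Continuous (v₁ L) := by
  have := continuous_c₀ L; have := continuous_c₁ L
  unfold v₁; fun_prop

theorem continuous_d₁ : Continuous (d₁ L) := by
  have := continuous_c₀ L; have := continuous_v₀ L; have := continuous_v₁ L
  have := continuous_d₀ L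
  unfold d₁; fun_prop

theorem continuous_c₂ : Continuous (c₂ L) := by
  have := continuous_c₀ L; have := continuous_c₁ L
  unfold c₂; fun_prop

theorem continuous_v₂ : Continuous (v₂ L) := by
  have := continuous_c₀ L; have := continuous_c₁ L; have := continuous_c₂ L
  unfold v₂; fun_prop

theorem continuous_d₂ : Continuous (d₂ L) := by
  have := continuous_c₀ L; have := continuous_v₀ L; have := continuous_v₁ L
  have := continuous_v₂ L; have := continuous_d₀ L; have := continuous_d₁ L
  unfold d₂; fun_prop

variable {L r}

theorem c₀_nonneg (L r : ℝ) : 0 ≤ c₀ L r := by unfold c₀; positivity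

theorem v₀_nonneg (hL : 0 ≤ L) (hr : 0 ≤ r) : 0 ≤ v₀ L r := by
  have := c₀_nonneg L r
  unfold v₀; positivity

theorem d₀_nonneg (hL : 0 ≤ L) (hr : 0 ≤ r) : 0 ≤ d₀ L r := by
  have := c₀_nonneg L r; have := v₀_nonneg hL hr
  unfold d₀; positivity

theorem c₁_nonneg (hL : 0 ≤ L) (hr : 0 ≤ r) : 0 ≤ c₁ L r := by
  have := c₀_nonneg L r
  unfold c₁; positivity

theorem v₁_nonneg (hL : 0 ≤ L) (hr : 0 ≤ r) : 0 ≤ v₁ L r := by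
  have := c₀_nonneg L r; have := c₁_nonneg hL hr
  unfold v₁; positivity

theorem d₁_nonneg (hL : 0 ≤ L) (hr : 0 ≤ r) : 0 ≤ d₁ L r := by
  have := c₀_nonneg L r; have := v₀_nonneg hL hr; have := v₁_nonneg hL hr
  have := d₀_nonneg hL hr
  unfold d₁; positivity

theorem m₀_nonneg (hL : 0 ≤ L) (hr : 0 ≤ r) : 0 ≤ m₀ L r := by
  have := c₀_nonneg L r; have := v₀_nonneg hL hr; have := d₀_nonneg hL hr
  unfold m₀; positivity

theorem m₁_nonneg (hL : 0 ≤ L) (hr : 0 ≤ r) : 0 ≤ m₁ L r := by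
  have := c₀_nonneg L r; have := v₀_nonneg hL hr; have := v₁_nonneg hL hr
  have := d₀_nonneg hL hr; have := d₁_nonneg hL hr; have := m₀_nonneg hL hr
  unfold m₁; positivity

end SigConst

/-! ### The signature of the lifted path and its derivatives -/

namespace HasLipDeriv₂

open SigConst

variable {E : Type*} [NormedAddCommGroup E] [NormedSpace ℝ E] {H : Type} [NormedAddCommGroup H]
  [InnerProductSpace ℝ H] {φ : E → H} {φ₁ : E → E →L[ℝ] H} {φ₂ : E → E →L[ℝ] E →L[ℝ] H} {L : ℝ}
  {t T : ℝ} [Fact (t ≤ T)] (hφ : HasLipDeriv₂ φ φ₁ φ₂ L)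

/-- The signature path of the lifted path. -/
noncomputable def sig₀ (γ : BVPath t T E) : C(Icc t T, TensorHilbert H) :=
  sigPath (hφ.lift₀ γ)

/-- The derivative of the signature in the direction `η`: the solution of the linear equation
`Y = ∫ S · d(Dφ(γ)η) + ∫ Y · dφ(γ)`. -/
noncomputable def sig₁ (γ η : BVPath t T E) : C(Icc t T, TensorHilbert H) :=
  tensorResolvent (hφ.lift₀ γ) (tensorVolterra (hφ.lift₁ γ η) (hφ.sig₀ γ))

/-- The second derivative of the signature in the directions `η` and `η'`, as the solution of a
linear equation. -/
noncomputable def sig₂ (γ η η' : BVPath t T E) : C(Icc t T, TensorHilbert H) :=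
  tensorResolvent (hφ.lift₀ γ) (tensorVolterra (hφ.lift₁ γ η') (hφ.sig₁ γ η)
    + tensorVolterra (hφ.lift₁ γ η) (hφ.sig₁ γ η') + tensorVolterra (hφ.lift₂ γ η η') (hφ.sig₀ γ))

theorem sig₁_eq (γ η : BVPath t T E) : hφ.sig₁ γ η
    = tensorVolterra (hφ.lift₀ γ) (hφ.sig₁ γ η) + tensorVolterra (hφ.lift₁ γ η) (hφ.sig₀ γ) :=
  (volterraResolvent_eq norm_mulVecL_le _ _).trans (add_comm _ _)

theorem sig₂_eq (γ η η' : BVPath t T E) : hφ.sig₂ γ η η'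
    = tensorVolterra (hφ.lift₀ γ) (hφ.sig₂ γ η η') + tensorVolterra (hφ.lift₁ γ η') (hφ.sig₁ γ η)
      + tensorVolterra (hφ.lift₁ γ η) (hφ.sig₁ γ η')
      + tensorVolterra (hφ.lift₂ γ η η') (hφ.sig₀ γ) := by
  refine (volterraResolvent_eq norm_mulVecL_le _ _).trans ?_
  rw [add_comm, ← add_assoc, ← add_assoc]
  rfl

theorem sig₁_add (γ η ζ : BVPath t T E) : hφ.sig₁ γ (η + ζ) = hφ.sig₁ γ η + hφ.sig₁ γ ζ := by
  simp only [sig₁, tensorVolterra, lift₁_add, volterra_add, add_apply, map_add]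

theorem sig₁_smul (c : ℝ) (γ η : BVPath t T E) : hφ.sig₁ γ (c • η) = c • hφ.sig₁ γ η := by
  simp only [sig₁, tensorVolterra, lift₁_smul, volterra_smul, smul_apply, map_smul]

theorem sig₂_add_left (γ η ζ η' : BVPath t T E) :
    hφ.sig₂ γ (η + ζ) η' = hφ.sig₂ γ η η' + hφ.sig₂ γ ζ η' := by
  simp only [sig₂, tensorVolterra, lift₁_add, lift₂_add_left, sig₁_add, volterra_add, add_apply,
    map_add]
  abel

theorem sig₂_smul_left (c : ℝ) (γ η η' : BVPath t T E) :
    hφ.sig₂ γ (c • η) η' = c • hφ.sig₂ γ η η' := by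
  simp only [sig₂, tensorVolterra, lift₁_smul, lift₂_smul_left, sig₁_smul, volterra_smul,
    smul_apply, map_smul, map_add, smul_add]

theorem sig₂_add_right (γ η η' ζ' : BVPath t T E) :
    hφ.sig₂ γ η (η' + ζ') = hφ.sig₂ γ η η' + hφ.sig₂ γ η ζ' := by
  simp only [sig₂, tensorVolterra, lift₁_add, lift₂_add_right, sig₁_add, volterra_add, add_apply,
    map_add]
  abel

theorem sig₂_smul_right (c : ℝ) (γ η η' : BVPath t T E) :
    hφ.sig₂ γ η (c • η') = c • hφ.sig₂ γ η η' := by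
  simp only [sig₂, tensorVolterra, lift₁_smul, lift₂_smul_right, sig₁_smul, volterra_smul,
    smul_apply, map_smul, map_add, smul_add]

/-! ### Bounds -/

variable {r : ℝ}

theorem varLE_coe_lift₀ {γ : BVPath t T E} (hγ : γ.var ≤ r) : VarLE (hφ.lift₀ γ) (L * r) :=
  hφ.varLE_lift₀ γ hγ

theorem varLE_coe_lift₁ {γ : BVPath t T E} (hγ : γ.var ≤ r) (η : BVPath t T E) :
    VarLE (hφ.lift₁ γ η) (L * (1 + r) * ‖η‖) :=
  hφ.varLE_lift₁ γ η hγ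

theorem varLE_coe_lift₂ {γ : BVPath t T E} (hγ : γ.var ≤ r) (η η' : BVPath t T E) :
    VarLE (hφ.lift₂ γ η η') (L * (2 + r) * (‖η‖ * ‖η'‖)) :=
  hφ.varLE_lift₂ γ η η' hγ

theorem norm_resolvent_le {γ : BVPath t T E} (hγ : γ.var ≤ r) {Z : C(Icc t T, TensorHilbert H)}
    {z : ℝ} (hz : ‖Z‖ ≤ z) : ‖tensorResolvent (hφ.lift₀ γ) Z‖ ≤ c₀ L r * z :=
  (norm_volterraResolvent_le norm_mulVecL_le (hφ.varLE_coe_lift₀ hγ) Z).trans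
    (mul_le_mul_of_nonneg_left hz (c₀_nonneg L r))

theorem norm_volterra_lift₁_le {γ : BVPath t T E} (hγ : γ.var ≤ r) (η : BVPath t T E)
    {Y : C(Icc t T, TensorHilbert H)} {y : ℝ} (hy : ‖Y‖ ≤ y) :
    ‖tensorVolterra (hφ.lift₁ γ η) Y‖ ≤ L * (1 + r) * ‖η‖ * y :=
  (norm_volterra_le norm_mulVecL_le (hφ.varLE_coe_lift₁ hγ η) Y).trans
    (mul_le_mul_of_nonneg_left hy (hφ.varLE_coe_lift₁ hγ η).nonneg)

theorem norm_volterra_lift₂_le {γ : BVPath t T E} (hγ : γ.var ≤ r) (η η' : BVPath t T E)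
    {Y : C(Icc t T, TensorHilbert H)} {y : ℝ} (hy : ‖Y‖ ≤ y) :
    ‖tensorVolterra (hφ.lift₂ γ η η') Y‖ ≤ L * (2 + r) * (‖η‖ * ‖η'‖) * y :=
  (norm_volterra_le norm_mulVecL_le (hφ.varLE_coe_lift₂ hγ η η') Y).trans
    (mul_le_mul_of_nonneg_left hy (hφ.varLE_coe_lift₂ hγ η η').nonneg)

theorem norm_sig₀_le {γ : BVPath t T E} (hγ : γ.var ≤ r) : ‖hφ.sig₀ γ‖ ≤ c₀ L r :=
  (hφ.norm_resolvent_le hγ norm_unitPath_le).trans_eq (mul_one _)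

theorem varLE_sig₀ {γ : BVPath t T E} (hγ : γ.var ≤ r) :
    VarLE (hφ.sig₀ γ) (L * r * c₀ L r) := by
  have h := varLE_volterraResolvent norm_mulVecL_le (hφ.varLE_coe_lift₀ hγ)
    (varLE_unitPath (t := t) (T := T) (H := H))
  refine h.mono ((zero_add _).trans_le ?_)
  exact mul_le_mul_of_nonneg_left (hφ.norm_sig₀_le hγ) (hφ.varLE_coe_lift₀ hγ).nonneg

/-- Integrals of the signature are controlled by the uniform norm of the integrator. -/
theorem norm_volterra_sig₀_le {γ : BVPath t T E} (hγ : γ.var ≤ r) {Z : BVPath t T H} {s : ℝ}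
    (hZ : Z.supNorm ≤ s) : ‖tensorVolterra Z (hφ.sig₀ γ)‖ ≤ s * v₀ L r :=
  norm_volterra_le_sup norm_mulVecL_le Z hZ (hφ.varLE_sig₀ hγ) (hφ.norm_sig₀_le hγ)

theorem norm_sig₁_le {γ : BVPath t T E} (hγ : γ.var ≤ r) (η : BVPath t T E) :
    ‖hφ.sig₁ γ η‖ ≤ c₁ L r * ‖η‖ :=
  (hφ.norm_resolvent_le hγ (hφ.norm_volterra_lift₁_le hγ η (hφ.norm_sig₀_le hγ))).trans_eq
    (by unfold c₁; ring)

theorem varLE_sig₁ {γ : BVPath t T E} (hγ : γ.var ≤ r) (η : BVPath t T E) :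
    VarLE (hφ.sig₁ γ η) ((L * (1 + r) * c₀ L r + L * r * c₁ L r) * ‖η‖) := by
  have h₁ := hφ.varLE_coe_lift₁ hγ η
  have h := varLE_volterraResolvent norm_mulVecL_le (hφ.varLE_coe_lift₀ hγ)
    (varLE_volterra norm_mulVecL_le (X := hφ.lift₁ γ η) h₁ (hφ.sig₀ γ))
  refine h.mono ((add_le_add (mul_le_mul_of_nonneg_left (hφ.norm_sig₀_le hγ) h₁.nonneg)
    (mul_le_mul_of_nonneg_left (hφ.norm_sig₁_le hγ η) (hφ.varLE_coe_lift₀ hγ).nonneg)).trans_eq ?_)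
  ring

theorem norm_volterra_sig₁_le {γ : BVPath t T E} (hγ : γ.var ≤ r) (η : BVPath t T E)
    {Z : BVPath t T H} {s : ℝ} (hZ : Z.supNorm ≤ s) :
    ‖tensorVolterra Z (hφ.sig₁ γ η)‖ ≤ s * (v₁ L r * ‖η‖) :=
  (norm_volterra_le_sup norm_mulVecL_le Z hZ (hφ.varLE_sig₁ hγ η)
    (hφ.norm_sig₁_le hγ η)).trans_eq (by unfold v₁; ring)

theorem norm_sig₂_le {γ : BVPath t T E} (hγ : γ.var ≤ r) (η η' : BVPath t T E) :
    ‖hφ.sig₂ γ η η'‖ ≤ c₂ L r * (‖η‖ * ‖η'‖) :=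
  (hφ.norm_resolvent_le hγ (norm_add₃_le.trans (add_le_add_three
    (hφ.norm_volterra_lift₁_le hγ η' (hφ.norm_sig₁_le hγ η))
    (hφ.norm_volterra_lift₁_le hγ η (hφ.norm_sig₁_le hγ η'))
    (hφ.norm_volterra_lift₂_le hγ η η' (hφ.norm_sig₀_le hγ))))).trans_eq (by unfold c₂; ring)

theorem varLE_sig₂ {γ : BVPath t T E} (hγ : γ.var ≤ r) (η η' : BVPath t T E) :
    VarLE (hφ.sig₂ γ η η') ((2 * (L * (1 + r) * c₁ L r) + L * (2 + r) * c₀ L r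
      + L * r * c₂ L r) * (‖η‖ * ‖η'‖)) := by
  have h₁ := hφ.varLE_coe_lift₁ hγ η
  have h₁' := hφ.varLE_coe_lift₁ hγ η'
  have h₂ := hφ.varLE_coe_lift₂ hγ η η'
  have h := varLE_volterraResolvent norm_mulVecL_le (hφ.varLE_coe_lift₀ hγ)
    (Z := tensorVolterra (hφ.lift₁ γ η') (hφ.sig₁ γ η)
      + tensorVolterra (hφ.lift₁ γ η) (hφ.sig₁ γ η')
      + tensorVolterra (hφ.lift₂ γ η η') (hφ.sig₀ γ))
    (((varLE_volterra norm_mulVecL_le (X := hφ.lift₁ γ η') h₁' (hφ.sig₁ γ η)).add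
      (varLE_volterra norm_mulVecL_le (X := hφ.lift₁ γ η) h₁ (hφ.sig₁ γ η'))).add
      (varLE_volterra norm_mulVecL_le (X := hφ.lift₂ γ η η') h₂ (hφ.sig₀ γ)))
  refine h.mono ((add_le_add (add_le_add_three
    (mul_le_mul_of_nonneg_left (hφ.norm_sig₁_le hγ η) h₁'.nonneg)
    (mul_le_mul_of_nonneg_left (hφ.norm_sig₁_le hγ η') h₁.nonneg)
    (mul_le_mul_of_nonneg_left (hφ.norm_sig₀_le hγ) h₂.nonneg))
    (mul_le_mul_of_nonneg_left (hφ.norm_sig₂_le hγ η η')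
      (hφ.varLE_coe_lift₀ hγ).nonneg)).trans_eq ?_)
  ring

theorem norm_volterra_sig₂_le {γ : BVPath t T E} (hγ : γ.var ≤ r) (η η' : BVPath t T E)
    {Z : BVPath t T H} {s : ℝ} (hZ : Z.supNorm ≤ s) :
    ‖tensorVolterra Z (hφ.sig₂ γ η η')‖ ≤ s * (v₂ L r * (‖η‖ * ‖η'‖)) :=
  (norm_volterra_le_sup norm_mulVecL_le Z hZ (hφ.varLE_sig₂ hγ η η')
    (hφ.norm_sig₂_le hγ η η')).trans_eq (by unfold v₂; ring)

/-! ### Lipschitz estimates in the uniform norm -/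

theorem norm_sig₀_sub_le {γ γ' : BVPath t T E} (hγ : γ.var ≤ r) (hγ' : γ'.var ≤ r) :
    ‖hφ.sig₀ γ' - hφ.sig₀ γ‖ ≤ d₀ L r * (γ' - γ).supNorm := by
  have e : hφ.sig₀ γ' - hφ.sig₀ γ = tensorResolvent (hφ.lift₀ γ)
      (tensorVolterra (hφ.lift₀ γ' - hφ.lift₀ γ) (hφ.sig₀ γ')) := by
    refine (volterraResolvent_sub norm_mulVecL_le _ _ _ _).trans ?_
    rw [sub_self, add_zero]
    rfl
  rw [e]
  exact (hφ.norm_resolvent_le hγ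
    (hφ.norm_volterra_sig₀_le hγ' (hφ.supNorm_lift₀_sub_le γ γ'))).trans_eq (by unfold d₀; ring)

theorem sig₁_sub_eq (γ γ' η : BVPath t T E) :
    hφ.sig₁ γ' η - hφ.sig₁ γ η = tensorResolvent (hφ.lift₀ γ)
      (tensorVolterra (hφ.lift₀ γ' - hφ.lift₀ γ) (hφ.sig₁ γ' η)
        + (tensorVolterra (hφ.lift₁ γ' η - hφ.lift₁ γ η) (hφ.sig₀ γ')
          + tensorVolterra (hφ.lift₁ γ η) (hφ.sig₀ γ' - hφ.sig₀ γ))) := by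
  refine (volterraResolvent_sub norm_mulVecL_le _ _ _ _).trans ?_
  rw [volterra_apply_sub_apply]
  rfl

theorem norm_sig₁_sub_le {γ γ' : BVPath t T E} (hγ : γ.var ≤ r) (hγ' : γ'.var ≤ r)
    (η : BVPath t T E) :
    ‖hφ.sig₁ γ' η - hφ.sig₁ γ η‖ ≤ d₁ L r * ‖η‖ * (γ' - γ).supNorm := by
  rw [sig₁_sub_eq]
  refine (hφ.norm_resolvent_le hγ ((norm_add_le _ _).trans (add_le_add
    (hφ.norm_volterra_sig₁_le hγ' η (hφ.supNorm_lift₀_sub_le γ γ'))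
    ((norm_add_le _ _).trans (add_le_add
      (hφ.norm_volterra_sig₀_le hγ' (hφ.supNorm_lift₁_sub_le γ γ' η))
      (hφ.norm_volterra_lift₁_le hγ η (hφ.norm_sig₀_sub_le hγ hγ'))))))).trans_eq ?_
  unfold d₁; ring

theorem sig₂_sub_eq (γ γ' η η' : BVPath t T E) :
    hφ.sig₂ γ' η η' - hφ.sig₂ γ η η' = tensorResolvent (hφ.lift₀ γ)
      (tensorVolterra (hφ.lift₀ γ' - hφ.lift₀ γ) (hφ.sig₂ γ' η η')
        + ((tensorVolterra (hφ.lift₁ γ' η' - hφ.lift₁ γ η') (hφ.sig₁ γ' η)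
            + tensorVolterra (hφ.lift₁ γ η') (hφ.sig₁ γ' η - hφ.sig₁ γ η))
          + (tensorVolterra (hφ.lift₁ γ' η - hφ.lift₁ γ η) (hφ.sig₁ γ' η')
            + tensorVolterra (hφ.lift₁ γ η) (hφ.sig₁ γ' η' - hφ.sig₁ γ η'))
          + (tensorVolterra (hφ.lift₂ γ' η η' - hφ.lift₂ γ η η') (hφ.sig₀ γ')
            + tensorVolterra (hφ.lift₂ γ η η') (hφ.sig₀ γ' - hφ.sig₀ γ)))) := by
  refine (volterraResolvent_sub norm_mulVecL_le _ _ _ _).trans ?_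
  rw [add_sub_add_comm (_ + _), add_sub_add_comm (tensorVolterra _ _),
    volterra_apply_sub_apply, volterra_apply_sub_apply, volterra_apply_sub_apply]
  rfl

theorem norm_sig₂_sub_le {γ γ' : BVPath t T E} (hγ : γ.var ≤ r) (hγ' : γ'.var ≤ r)
    (η η' : BVPath t T E) :
    ‖hφ.sig₂ γ' η η' - hφ.sig₂ γ η η'‖ ≤ d₂ L r * (‖η‖ * ‖η'‖) * (γ' - γ).supNorm := by
  rw [sig₂_sub_eq]
  refine (hφ.norm_resolvent_le hγ ((norm_add_le _ _).trans (add_le_add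
    (hφ.norm_volterra_sig₂_le hγ' η η' (hφ.supNorm_lift₀_sub_le γ γ'))
    (norm_add₃_le.trans (add_le_add_three
      ((norm_add_le _ _).trans (add_le_add
        (hφ.norm_volterra_sig₁_le hγ' η (hφ.supNorm_lift₁_sub_le γ γ' η'))
        (hφ.norm_volterra_lift₁_le hγ η' (hφ.norm_sig₁_sub_le hγ hγ' η))))
      ((norm_add_le _ _).trans (add_le_add
        (hφ.norm_volterra_sig₁_le hγ' η' (hφ.supNorm_lift₁_sub_le γ γ' η))
        (hφ.norm_volterra_lift₁_le hγ η (hφ.norm_sig₁_sub_le hγ hγ' η'))))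
      ((norm_add_le _ _).trans (add_le_add
        (hφ.norm_volterra_sig₀_le hγ' (hφ.supNorm_lift₂_sub_le γ γ' η η'))
        (hφ.norm_volterra_lift₂_le hγ η η' (hφ.norm_sig₀_sub_le hγ hγ'))))))))).trans_eq ?_
  unfold d₂; ring

/-! ### Second-order remainders -/

theorem norm_sig₀_rem_le {γ η : BVPath t T E} (hγ : γ.var ≤ r) (hγ' : (γ + η).var ≤ r) :
    ‖hφ.sig₀ (γ + η) - hφ.sig₀ γ - hφ.sig₁ γ η‖ ≤ m₀ L r * (‖η‖ * η.supNorm) := by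
  have e : hφ.sig₀ (γ + η) - hφ.sig₀ γ - hφ.sig₁ γ η = tensorResolvent (hφ.lift₀ γ)
      (tensorVolterra (hφ.lift₀ (γ + η) - hφ.lift₀ γ - hφ.lift₁ γ η) (hφ.sig₀ (γ + η))
        + tensorVolterra (hφ.lift₁ γ η) (hφ.sig₀ (γ + η) - hφ.sig₀ γ)) := by
    have h := volterraResolvent_sub norm_mulVecL_le (hφ.lift₀ γ) (hφ.lift₀ (γ + η))
      (unitPath t T H) (unitPath t T H)
    rw [sub_self, add_zero] at h
    refine (congrArg (· - hφ.sig₁ γ η) h).trans ((map_sub _ _ _).symm.trans ?_)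
    rw [← volterra_apply_sub_apply]
    rfl
  rw [e]
  have h₁ := hφ.norm_sig₀_sub_le hγ hγ'
  rw [add_sub_cancel_left] at h₁
  refine (hφ.norm_resolvent_le hγ ((norm_add_le _ _).trans (add_le_add
    (hφ.norm_volterra_sig₀_le hγ' (hφ.supNorm_lift₀_rem_le γ η))
    (hφ.norm_volterra_lift₁_le hγ η h₁)))).trans_eq ?_
  unfold m₀; ring

theorem norm_sig₁_rem_le {γ η' : BVPath t T E} (hγ : γ.var ≤ r) (hγ' : (γ + η').var ≤ r)
    (η : BVPath t T E) :
    ‖hφ.sig₁ (γ + η') η - hφ.sig₁ γ η - hφ.sig₂ γ η η'‖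
      ≤ m₁ L r * ‖η‖ * (‖η'‖ * η'.supNorm) := by
  have e : hφ.sig₁ (γ + η') η - hφ.sig₁ γ η - hφ.sig₂ γ η η' = tensorResolvent (hφ.lift₀ γ)
      ((tensorVolterra (hφ.lift₀ (γ + η') - hφ.lift₀ γ - hφ.lift₁ γ η') (hφ.sig₁ (γ + η') η)
          + tensorVolterra (hφ.lift₁ γ η') (hφ.sig₁ (γ + η') η - hφ.sig₁ γ η))
        + (tensorVolterra (hφ.lift₁ (γ + η') η - hφ.lift₁ γ η - hφ.lift₂ γ η η')
            (hφ.sig₀ (γ + η'))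
          + tensorVolterra (hφ.lift₂ γ η η') (hφ.sig₀ (γ + η') - hφ.sig₀ γ))
        + tensorVolterra (hφ.lift₁ γ η) (hφ.sig₀ (γ + η') - hφ.sig₀ γ - hφ.sig₁ γ η')) := by
    have h₁ := volterra_apply_sub_apply norm_mulVecL_le (hφ.lift₀ (γ + η') - hφ.lift₀ γ)
      (hφ.lift₁ γ η') (hφ.sig₁ (γ + η') η) (hφ.sig₁ γ η)
    have h₂ := volterra_apply_sub_apply norm_mulVecL_le (hφ.lift₁ (γ + η') η - hφ.lift₁ γ η)
      (hφ.lift₂ γ η η') (hφ.sig₀ (γ + η')) (hφ.sig₀ γ)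
    rw [← h₁, ← h₂, map_sub (tensorVolterra (hφ.lift₁ γ η)) (hφ.sig₀ (γ + η') - hφ.sig₀ γ),
      sig₁_sub_eq, sig₂, ← map_sub]
    congr 1
    abel
  rw [e]
  have h₁ := hφ.norm_sig₀_sub_le hγ hγ'
  have h₂ := hφ.norm_sig₁_sub_le hγ hγ' η
  rw [add_sub_cancel_left] at h₁ h₂
  refine (hφ.norm_resolvent_le hγ (norm_add₃_le.trans (add_le_add_three
    ((norm_add_le _ _).trans (add_le_add
      (hφ.norm_volterra_sig₁_le hγ' η (hφ.supNorm_lift₀_rem_le γ η'))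
      (hφ.norm_volterra_lift₁_le hγ η' h₂)))
    ((norm_add_le _ _).trans (add_le_add
      (hφ.norm_volterra_sig₀_le hγ' (hφ.supNorm_lift₁_rem_le γ η η'))
      (hφ.norm_volterra_lift₂_le hγ η η' h₁)))
    (hφ.norm_volterra_lift₁_le hγ η (hφ.norm_sig₀_rem_le hγ hγ'))))).trans_eq ?_
  unfold m₁; ring

end HasLipDeriv₂

/-! ### Fréchet derivatives -/

theorem hasFDerivAt_of_norm_le_sq {E F : Type*} [NormedAddCommGroup E] [NormedSpace ℝ E]
    [NormedAddCommGroup F] [NormedSpace ℝ F] {f : E → F} {A : E →L[ℝ] F} {x : E} {C : ℝ}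
    (h : ∀ v, ‖v‖ ≤ 1 → ‖f (x + v) - f x - A v‖ ≤ C * ‖v‖ ^ 2) : HasFDerivAt f A x := by
  rw [hasFDerivAt_iff_isLittleO_nhds_zero, Asymptotics.isLittleO_iff]
  intro c hc
  have hδ : 0 < min 1 (c / (|C| + 1)) := by positivity
  filter_upwards [Metric.ball_mem_nhds (0 : E) hδ] with v hv
  rw [mem_ball_zero_iff, lt_min_iff] at hv
  refine (h v hv.1.le).trans ?_
  have h₁ : |C| * ‖v‖ ≤ c := by
    have := (lt_div_iff₀ (by positivity)).1 hv.2
    nlinarith [norm_nonneg v]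
  calc C * ‖v‖ ^ 2 ≤ |C| * ‖v‖ ^ 2 := by gcongr; exact le_abs_self C
    _ = |C| * ‖v‖ * ‖v‖ := by ring
    _ ≤ c * ‖v‖ := by gcongr

namespace HasLipDeriv₂

open SigConst

theorem hasFDerivAt₀ {E K : Type*} [NormedAddCommGroup E] [NormedSpace ℝ E]
    [NormedAddCommGroup K] [NormedSpace ℝ K] {φ : E → K} {φ₁ : E → E →L[ℝ] K}
    {φ₂ : E → E →L[ℝ] E →L[ℝ] K} {L : ℝ} (hφ : HasLipDeriv₂ φ φ₁ φ₂ L) (x : E) :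
    HasFDerivAt φ (φ₁ x) x :=
  hasFDerivAt_of_norm_le_sq fun v _ => hφ.rem₀ x v

theorem hasFDerivAt₁ {E K : Type*} [NormedAddCommGroup E] [NormedSpace ℝ E]
    [NormedAddCommGroup K] [NormedSpace ℝ K] {φ : E → K} {φ₁ : E → E →L[ℝ] K}
    {φ₂ : E → E →L[ℝ] E →L[ℝ] K} {L : ℝ} (hφ : HasLipDeriv₂ φ φ₁ φ₂ L) (x : E) :
    HasFDerivAt φ₁ (φ₂ x) x :=
  hasFDerivAt_of_norm_le_sq fun v _ => hφ.rem₁ x v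

variable {E : Type*} [NormedAddCommGroup E] [NormedSpace ℝ E] {H : Type} [NormedAddCommGroup H]
  [InnerProductSpace ℝ H] {φ : E → H} {φ₁ : E → E →L[ℝ] H} {φ₂ : E → E →L[ℝ] E →L[ℝ] H} {L : ℝ}
  {t T : ℝ} [Fact (t ≤ T)] (hφ : HasLipDeriv₂ φ φ₁ φ₂ L)

/-- The first derivative of the signature at time `u` as a bounded linear map. -/
noncomputable def sigDeriv₁ (γ : BVPath t T E) (u : Icc t T) :
    BVPath t T E →L[ℝ] TensorHilbert H :=
  LinearMap.mkContinuous
    { toFun := fun η => hφ.sig₁ γ η u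
      map_add' := fun η ζ => by rw [sig₁_add]; rfl
      map_smul' := fun c η => by rw [sig₁_smul]; rfl }
    (c₁ L γ.var) fun η =>
      ((hφ.sig₁ γ η).norm_coe_le_norm u).trans (hφ.norm_sig₁_le le_rfl η)

/-- The second derivative of the signature at time `u` as a bounded bilinear map. -/
noncomputable def sigDeriv₂ (γ : BVPath t T E) (u : Icc t T) :
    BVPath t T E →L[ℝ] BVPath t T E →L[ℝ] TensorHilbert H :=
  LinearMap.mkContinuous₂
    (LinearMap.mk₂ ℝ (fun η' η => hφ.sig₂ γ η η' u)
      (fun η' ζ' η => by rw [sig₂_add_right]; rfl)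
      (fun c η' η => by rw [sig₂_smul_right]; rfl)
      (fun η' η ζ => by rw [sig₂_add_left]; rfl)
      (fun c η' η => by rw [sig₂_smul_left]; rfl))
    (c₂ L γ.var) fun η' η =>
      (((hφ.sig₂ γ η η').norm_coe_le_norm u).trans (hφ.norm_sig₂_le le_rfl η η')).trans_eq
        (by ring)

theorem var_add_le_of_norm_le_one {γ η : BVPath t T E} (hη : ‖η‖ ≤ 1) :
    ((γ + η).var : ℝ) ≤ γ.var + 1 := by
  have h : ((γ + η).var : ℝ) ≤ γ.var + η.var := by exact_mod_cast BVPath.var_add_le γ η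
  linarith [η.var_le_norm]

theorem norm_sig₁_rem_le_sq {γ η' : BVPath t T E} (hη' : ‖η'‖ ≤ 1) (η : BVPath t T E) :
    ‖hφ.sig₁ (γ + η') η - hφ.sig₁ γ η - hφ.sig₂ γ η η'‖
      ≤ m₁ L (γ.var + 1) * ‖η'‖ ^ 2 * ‖η‖ := by
  have hm := m₁_nonneg hφ.nonneg (r := γ.var + 1) (by positivity)
  refine (hφ.norm_sig₁_rem_le (r := γ.var + 1) (by linarith) (var_add_le_of_norm_le_one hη')
    η).trans ?_
  have h := mul_le_mul_of_nonneg_left η'.supNorm_le_norm (norm_nonneg η')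
  calc m₁ L (γ.var + 1) * ‖η‖ * (‖η'‖ * η'.supNorm)
      ≤ m₁ L (γ.var + 1) * ‖η‖ * (‖η'‖ * ‖η'‖) := by gcongr
    _ = _ := by ring

theorem hasFDerivAt_sig₀ (γ : BVPath t T E) (u : Icc t T) :
    HasFDerivAt (fun γ' => hφ.sig₀ γ' u) (hφ.sigDeriv₁ γ u) γ := by
  refine hasFDerivAt_of_norm_le_sq (C := m₀ L (γ.var + 1)) fun η hη => ?_
  have hm := m₀_nonneg hφ.nonneg (r := γ.var + 1) (by positivity)
  refine ((hφ.sig₀ (γ + η) - hφ.sig₀ γ - hφ.sig₁ γ η).norm_coe_le_norm u).trans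
    ((hφ.norm_sig₀_rem_le (r := γ.var + 1) (by linarith) (var_add_le_of_norm_le_one hη)).trans ?_)
  rw [sq]
  gcongr
  exact η.supNorm_le_norm

theorem hasFDerivAt_sig₁ (γ η : BVPath t T E) (u : Icc t T) :
    HasFDerivAt (fun γ' => hφ.sig₁ γ' η u) ((hφ.sigDeriv₂ γ u).flip η) γ := by
  refine hasFDerivAt_of_norm_le_sq (C := m₁ L (γ.var + 1) * ‖η‖) fun η' hη' => ?_
  refine ((hφ.sig₁ (γ + η') η - hφ.sig₁ γ η - hφ.sig₂ γ η η').norm_coe_le_norm u).trans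
    ((hφ.norm_sig₁_rem_le_sq hη' η).trans_eq ?_)
  ring

theorem hasFDerivAt_sigDeriv₁ (γ : BVPath t T E) (u : Icc t T) :
    HasFDerivAt (fun γ' => hφ.sigDeriv₁ γ' u) (hφ.sigDeriv₂ γ u) γ := by
  refine hasFDerivAt_of_norm_le_sq (f := fun γ' => hφ.sigDeriv₁ γ' u) (C := m₁ L (γ.var + 1))
    fun η' hη' => ?_
  have hm := m₁_nonneg hφ.nonneg (r := γ.var + 1) (by positivity)
  refine ContinuousLinearMap.opNorm_le_bound _ (by positivity) fun η => ?_
  exact ((hφ.sig₁ (γ + η') η - hφ.sig₁ γ η - hφ.sig₂ γ η η').norm_coe_le_norm u).trans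
    (hφ.norm_sig₁_rem_le_sq hη' η)

end HasLipDeriv₂

/-! ### Identification with the directional derivatives -/

section Identification

variable {e : ℕ} {H : Type} [NormedAddCommGroup H] [InnerProductSpace ℝ H] [CompleteSpace H]
  [RKHS ℝ H (EuclideanSpace ℝ (Fin e)) ℝ]

/-- The feature map `x ↦ g(x, ·)`. -/
noncomputable def featureMap (H : Type) [NormedAddCommGroup H] [InnerProductSpace ℝ H]
    [CompleteSpace H] [RKHS ℝ H (EuclideanSpace ℝ (Fin e)) ℝ] (x : EuclideanSpace ℝ (Fin e)) : H :=
  RKHS.kerFun H x 1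

theorem inner_featureMap (x y : EuclideanSpace ℝ (Fin e)) :
    inner ℝ (featureMap H x) (featureMap H y) = RKHS.kernel H x y 1 := by
  rw [featureMap, RKHS.kerFun_inner, featureMap, RKHS.kerFun_apply]
  simp

theorem eq_zero_of_inner_featureMap {v : H} (h : ∀ z, inner ℝ (featureMap H z) v = 0) : v = 0 := by
  refine RKHS.ext fun x => ?_
  have := h x
  rw [featureMap, RKHS.kerFun_inner] at this
  simpa using this

variable {φ₁ : EuclideanSpace ℝ (Fin e) → EuclideanSpace ℝ (Fin e) →L[ℝ] H}
  {φ₂ : EuclideanSpace ℝ (Fin e) →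
    EuclideanSpace ℝ (Fin e) →L[ℝ] EuclideanSpace ℝ (Fin e) →L[ℝ] H} {L : ℝ}
  {t T : ℝ} [Fact (t ≤ T)]
  (hφ : HasLipDeriv₂ (featureMap H) φ₁ φ₂ L)

theorem hasLineDerivAt_lift (γ η : BVPath t T (EuclideanSpace ℝ (Fin e))) (u : Icc t T) :
    HasLineDerivAt ℝ (fun γ' => lift H γ' u) (hφ.lift₁ γ η u) γ η :=
  (hφ.hasFDerivAt₀ (γ u)).hasLineDerivAt (η u)

theorem dLift_eq (γ η : BVPath t T (EuclideanSpace ℝ (Fin e))) : dLift H γ η = hφ.lift₁ γ η :=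
  funext fun u => (hasLineDerivAt_lift hφ γ η u).lineDeriv

theorem hasLineDerivAt_dLift (γ η η' : BVPath t T (EuclideanSpace ℝ (Fin e))) (u : Icc t T) :
    HasLineDerivAt ℝ (fun γ' => dLift H γ' η u) (hφ.lift₂ γ η η' u) γ η' := by
  simp only [dLift_eq hφ]
  exact ((ContinuousLinearMap.apply ℝ H (η u)).hasFDerivAt.comp (γ u)
    (hφ.hasFDerivAt₁ (γ u))).hasLineDerivAt (η' u)

theorem ddLift_eq (γ η η' : BVPath t T (EuclideanSpace ℝ (Fin e))) :
    ddLift H γ η η' = hφ.lift₂ γ η η' :=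
  funext fun u => (hasLineDerivAt_dLift hφ γ η η' u).lineDeriv

theorem liftSig_eq (γ : BVPath t T (EuclideanSpace ℝ (Fin e))) : liftSig H γ = hφ.sig₀ γ :=
  funext fun u => sig_eq_sigPath (hφ.lift₀ γ) u

theorem hasLineDerivAt_liftSig (γ η : BVPath t T (EuclideanSpace ℝ (Fin e))) (u : Icc t T) :
    HasLineDerivAt ℝ (fun γ' => liftSig H γ' u) (hφ.sig₁ γ η u) γ η := by
  simp only [liftSig_eq hφ]
  exact (hφ.hasFDerivAt_sig₀ γ u).hasLineDerivAt η

theorem dSig_eq (γ η : BVPath t T (EuclideanSpace ℝ (Fin e))) : dSig H γ η = hφ.sig₁ γ η :=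
  funext fun u => (hasLineDerivAt_liftSig hφ γ η u).lineDeriv

theorem hasLineDerivAt_dSig (γ η η' : BVPath t T (EuclideanSpace ℝ (Fin e))) (u : Icc t T) :
    HasLineDerivAt ℝ (fun γ' => dSig H γ' η u) (hφ.sig₂ γ η η' u) γ η' := by
  simp only [dSig_eq hφ]
  exact (hφ.hasFDerivAt_sig₁ γ η u).hasLineDerivAt η'

theorem ddSig_eq (γ η η' : BVPath t T (EuclideanSpace ℝ (Fin e))) :
    ddSig H γ η η' = hφ.sig₂ γ η η' :=
  funext fun u => (hasLineDerivAt_dSig hφ γ η η' u).lineDeriv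

end Identification

/-! ### Estimates of the signature of the lifted path -/

section Conclusion

open SigConst

variable {e : ℕ} {H : Type} [NormedAddCommGroup H] [InnerProductSpace ℝ H] [CompleteSpace H]
  [RKHS ℝ H (EuclideanSpace ℝ (Fin e)) ℝ]
  {φ₁ : EuclideanSpace ℝ (Fin e) → EuclideanSpace ℝ (Fin e) →L[ℝ] H}
  {φ₂ : EuclideanSpace ℝ (Fin e) →
    EuclideanSpace ℝ (Fin e) →L[ℝ] EuclideanSpace ℝ (Fin e) →L[ℝ] H} {L : ℝ}

/-- The estimates of the signature and its derivatives. -/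
theorem exists_sig_bounds (hφ : HasLipDeriv₂ (featureMap H) φ₁ φ₂ L) :
    ∃ (S₀ : ℝ≥0 → ℝ≥0) (S₁ : ℝ≥0 × ℝ≥0 → ℝ≥0) (S₂ : ℝ≥0 × ℝ≥0 × ℝ≥0 → ℝ≥0)
      (DS₀ : ℝ≥0 × ℝ≥0 → ℝ≥0) (DS₁ : ℝ≥0 × ℝ≥0 × ℝ≥0 → ℝ≥0)
      (DS₂ : ℝ≥0 × ℝ≥0 × ℝ≥0 × ℝ≥0 → ℝ≥0),
      Continuous S₀ ∧ Continuous S₁ ∧ Continuous S₂ ∧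
      Continuous DS₀ ∧ Continuous DS₁ ∧ Continuous DS₂ ∧
      ∀ (t T : ℝ) [Fact (t ≤ T)] (γ γ' η η' : BVPath t T (EuclideanSpace ℝ (Fin e)))
        (u : Icc t T),
        ‖liftSig H γ u‖ ≤ S₀ γ.var ∧
        ‖liftSig H γ u - liftSig H γ' u‖ ≤ (γ - γ').supNorm * DS₀ (γ.var, γ'.var) ∧
        ‖dSig H γ η u‖ ≤ S₁ (γ.var, ‖η‖₊) ∧
        ‖dSig H γ η u - dSig H γ' η u‖ ≤ (γ - γ').supNorm * DS₁ (γ.var, γ'.var, ‖η‖₊) ∧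
        ‖ddSig H γ η η' u‖ ≤ S₂ (γ.var, ‖η‖₊, ‖η'‖₊) ∧
        ‖ddSig H γ η η' u - ddSig H γ' η η' u‖
          ≤ (γ - γ').supNorm * DS₂ (γ.var, γ'.var, ‖η‖₊, ‖η'‖₊) := by
  have k₀ := continuous_c₀ L
  have k₁ := continuous_c₁ L
  have k₂ := continuous_c₂ L
  have l₀ := continuous_d₀ L
  have l₁ := continuous_d₁ L
  have l₂ := continuous_d₂ L
  refine ⟨fun a => (c₀ L a).toNNReal, fun a => (c₁ L a.1).toNNReal * a.2,
    fun a => (c₂ L a.1).toNNReal * (a.2.1 * a.2.2), fun a => (d₀ L (a.1 + a.2 : ℝ≥0)).toNNReal,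
    fun a => (d₁ L (a.1 + a.2.1 : ℝ≥0)).toNNReal * a.2.2,
    fun a => (d₂ L (a.1 + a.2.1 : ℝ≥0)).toNNReal * (a.2.2.1 * a.2.2.2),
    by fun_prop, by fun_prop, by fun_prop, by fun_prop, by fun_prop, by fun_prop,
    fun t T _ γ γ' η η' u => ?_⟩
  have hγ : (γ.var : ℝ) ≤ (γ.var + γ'.var : ℝ≥0) := by push_cast; simp
  have hγ' : (γ'.var : ℝ) ≤ (γ.var + γ'.var : ℝ≥0) := by push_cast; simp
  have hd := (γ - γ').supNorm_nonneg
  rw [liftSig_eq hφ, liftSig_eq hφ, dSig_eq hφ, dSig_eq hφ, ddSig_eq hφ, ddSig_eq hφ]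
  refine ⟨?_, ?_, ?_, ?_, ?_, ?_⟩
  · exact ((hφ.sig₀ γ).norm_coe_le_norm u).trans
      ((hφ.norm_sig₀_le le_rfl).trans (Real.le_coe_toNNReal _))
  · refine ((hφ.sig₀ γ - hφ.sig₀ γ').norm_coe_le_norm u).trans
      ((hφ.norm_sig₀_sub_le hγ' hγ).trans ?_)
    rw [mul_comm]
    gcongr
    exact Real.le_coe_toNNReal _
  · refine ((hφ.sig₁ γ η).norm_coe_le_norm u).trans ((hφ.norm_sig₁_le le_rfl η).trans ?_)
    rw [NNReal.coe_mul, coe_nnnorm]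
    gcongr
    exact Real.le_coe_toNNReal _
  · refine ((hφ.sig₁ γ η - hφ.sig₁ γ' η).norm_coe_le_norm u).trans
      ((hφ.norm_sig₁_sub_le hγ' hγ η).trans ?_)
    rw [mul_comm, NNReal.coe_mul, coe_nnnorm]
    gcongr
    exact Real.le_coe_toNNReal _
  · refine ((hφ.sig₂ γ η η').norm_coe_le_norm u).trans ((hφ.norm_sig₂_le le_rfl η η').trans ?_)
    rw [NNReal.coe_mul, NNReal.coe_mul, coe_nnnorm, coe_nnnorm]
    gcongr
    exact Real.le_coe_toNNReal _
  · refine ((hφ.sig₂ γ η η' - hφ.sig₂ γ' η η').norm_coe_le_norm u).trans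
      ((hφ.norm_sig₂_sub_le hγ' hγ η η').trans ?_)
    rw [mul_comm, NNReal.coe_mul, NNReal.coe_mul, coe_nnnorm, coe_nnnorm]
    gcongr
    exact Real.le_coe_toNNReal _

theorem tendstoUniformly_of_norm_sub_le {α F : Type*} [NormedAddCommGroup F] {f : ℕ → α → F}
    {f₀ : α → F} {a : ℕ → ℝ} {C : ℝ} (ha : Tendsto a atTop (𝓝 0))
    (h : ∀ n u, ‖f n u - f₀ u‖ ≤ C * a n) : TendstoUniformly f f₀ atTop := by
  rw [Metric.tendstoUniformly_iff]
  intro ε hε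
  have hC : Tendsto (fun n => C * a n) atTop (𝓝 0) := by simpa using ha.const_mul C
  filter_upwards [hC.eventually_lt_const hε] with n hn u
  rw [dist_comm, dist_eq_norm]
  exact (h n u).trans_lt hn

/-- A second-order remainder is small with respect to the uniform norm. -/
theorem exists_sig_remainder (hφ : HasLipDeriv₂ (featureMap H) φ₁ φ₂ L) {t T : ℝ} [Fact (t ≤ T)]
    (γ : BVPath t T (EuclideanSpace ℝ (Fin e))) {ε : ℝ} (hε : 0 < ε) :
    ∃ δ > (0 : ℝ), ∀ (u : Icc t T) (η η' : BVPath t T (EuclideanSpace ℝ (Fin e))), ‖η'‖ < δ →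
      ‖hφ.sig₀ (γ + η') u - hφ.sig₀ γ u - hφ.sig₁ γ η' u‖ ≤ ε * η'.supNorm ∧
      ‖hφ.sig₁ (γ + η') η u - hφ.sig₁ γ η u - hφ.sig₂ γ η η' u‖ ≤ ε * ‖η‖ * η'.supNorm := by
  have h₀ := m₀_nonneg hφ.nonneg (r := γ.var + 1) (by positivity)
  have h₁ := m₁_nonneg hφ.nonneg (r := γ.var + 1) (by positivity)
  set M := m₀ L (γ.var + 1) + m₁ L (γ.var + 1) + 1 with hM
  have hM0 : 0 < M := by positivity
  refine ⟨min 1 (ε / M), by positivity, fun u η η' hη' => ?_⟩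
  obtain ⟨hη₁, hη₂⟩ := lt_min_iff.1 hη'
  have hMε : M * ‖η'‖ ≤ ε := by
    have := ((lt_div_iff₀ hM0).1 hη₂).le
    linarith
  have hs := η'.supNorm_nonneg
  have hm₀ : m₀ L (γ.var + 1) * ‖η'‖ ≤ ε := le_trans (by gcongr; linarith) hMε
  have hm₁ : m₁ L (γ.var + 1) * ‖η'‖ ≤ ε := le_trans (by gcongr; linarith) hMε
  constructor
  · calc _ ≤ m₀ L (γ.var + 1) * (‖η'‖ * η'.supNorm) :=
          ((hφ.sig₀ (γ + η') - hφ.sig₀ γ - hφ.sig₁ γ η').norm_coe_le_norm u).trans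
            (hφ.norm_sig₀_rem_le (by linarith)
              (HasLipDeriv₂.var_add_le_of_norm_le_one hη₁.le))
      _ = m₀ L (γ.var + 1) * ‖η'‖ * η'.supNorm := by ring
      _ ≤ _ := by gcongr
  · calc _ ≤ m₁ L (γ.var + 1) * ‖η‖ * (‖η'‖ * η'.supNorm) :=
          ((hφ.sig₁ (γ + η') η - hφ.sig₁ γ η - hφ.sig₂ γ η η').norm_coe_le_norm u).trans
            (hφ.norm_sig₁_rem_le (by linarith)
              (HasLipDeriv₂.var_add_le_of_norm_le_one hη₁.le) η)
      _ = m₁ L (γ.var + 1) * ‖η'‖ * ‖η‖ * η'.supNorm := by ring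
      _ ≤ _ := by gcongr

end Conclusion

theorem mainTheorem6 {e : ℕ}
    (g : EuclideanSpace ℝ (Fin e) → EuclideanSpace ℝ (Fin e) → ℝ)
    (hg : IsBoundedFourTimesDiff g)
    (H : Type) [NormedAddCommGroup H] [InnerProductSpace ℝ H] [CompleteSpace H]
    [RKHS ℝ H (EuclideanSpace ℝ (Fin e)) ℝ]
    (hH : ∀ x y, RKHS.kernel H x y 1 = g x y) :
    -- well-posedness, differentiability, and the equations of the derivatives
    (∀ (t T : ℝ) [Fact (t ≤ T)] (γ η η' : BVPath t T (EuclideanSpace ℝ (Fin e))),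
      (Continuous (lift H γ) ∧ BoundedVariationOn (lift H γ) univ ∧ SigWellDefined (lift H γ)) ∧
      (∀ u,
        HasLineDerivAt ℝ (fun γ' => lift H γ' u) (dLift H γ η u) γ η ∧
        HasLineDerivAt ℝ (fun γ' => dLift H γ' η u) (ddLift H γ η η' u) γ η' ∧
        HasLineDerivAt ℝ (fun γ' => liftSig H γ' u) (dSig H γ η u) γ η ∧
        HasLineDerivAt ℝ (fun γ' => dSig H γ' η u) (ddSig H γ η η' u) γ η') ∧
      (∀ u, ∃ I₁ I₂,
        IsRSIntegral mulVec (dSig H γ η) (lift H γ) u I₁ ∧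
        IsRSIntegral mulVec (liftSig H γ) (dLift H γ η) u I₂ ∧
        dSig H γ η u = I₁ + I₂) ∧
      (∀ u, ∃ I₁ I₂ I₃ I₄,
        IsRSIntegral mulVec (ddSig H γ η η') (lift H γ) u I₁ ∧
        IsRSIntegral mulVec (dSig H γ η) (dLift H γ η') u I₂ ∧
        IsRSIntegral mulVec (dSig H γ η') (dLift H γ η) u I₃ ∧
        IsRSIntegral mulVec (liftSig H γ) (ddLift H γ η η') u I₄ ∧
        ddSig H γ η η' u = I₁ + I₂ + I₃ + I₄)) ∧
    -- the estimates
    (∃ (S₀ : ℝ≥0 → ℝ≥0) (S₁ : ℝ≥0 × ℝ≥0 → ℝ≥0) (S₂ : ℝ≥0 × ℝ≥0 × ℝ≥0 → ℝ≥0)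
      (DS₀ : ℝ≥0 × ℝ≥0 → ℝ≥0) (DS₁ : ℝ≥0 × ℝ≥0 × ℝ≥0 → ℝ≥0)
      (DS₂ : ℝ≥0 × ℝ≥0 × ℝ≥0 × ℝ≥0 → ℝ≥0),
      Continuous S₀ ∧ Continuous S₁ ∧ Continuous S₂ ∧
      Continuous DS₀ ∧ Continuous DS₁ ∧ Continuous DS₂ ∧
      ∀ (t T : ℝ) [Fact (t ≤ T)] (γ γ' η η' : BVPath t T (EuclideanSpace ℝ (Fin e)))
        (u : Icc t T),
        ‖liftSig H γ u‖ ≤ S₀ γ.var ∧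
        ‖liftSig H γ u - liftSig H γ' u‖ ≤ (γ - γ').supNorm * DS₀ (γ.var, γ'.var) ∧
        ‖dSig H γ η u‖ ≤ S₁ (γ.var, ‖η‖₊) ∧
        ‖dSig H γ η u - dSig H γ' η u‖ ≤ (γ - γ').supNorm * DS₁ (γ.var, γ'.var, ‖η‖₊) ∧
        ‖ddSig H γ η η' u‖ ≤ S₂ (γ.var, ‖η‖₊, ‖η'‖₊) ∧
        ‖ddSig H γ η η' u - ddSig H γ' η η' u‖
          ≤ (γ - γ').supNorm * DS₂ (γ.var, γ'.var, ‖η‖₊, ‖η'‖₊)) ∧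
    -- continuity in the uniform norm on sets of bounded 1-variation
    (∀ (t T : ℝ) [Fact (t ≤ T)] (γ η η' : BVPath t T (EuclideanSpace ℝ (Fin e)))
      (γs : ℕ → BVPath t T (EuclideanSpace ℝ (Fin e))) (R : ℝ≥0),
      (∀ n, (γs n).var ≤ R) → Tendsto (fun n => (γs n - γ).supNorm) atTop (𝓝 0) →
      TendstoUniformly (fun n => liftSig H (γs n)) (liftSig H γ) atTop ∧
      TendstoUniformly (fun n => dSig H (γs n) η) (dSig H γ η) atTop ∧
      TendstoUniformly (fun n => ddSig H (γs n) η η') (ddSig H γ η η') atTop) ∧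
    -- the directional derivatives are Fréchet derivatives
    (∀ (t T : ℝ) [Fact (t ≤ T)] (γ : BVPath t T (EuclideanSpace ℝ (Fin e))),
      (∀ u, ∃ (D₁ : BVPath t T (EuclideanSpace ℝ (Fin e)) →L[ℝ] TensorHilbert H)
        (D₂ : BVPath t T (EuclideanSpace ℝ (Fin e)) →L[ℝ]
          BVPath t T (EuclideanSpace ℝ (Fin e)) →L[ℝ] TensorHilbert H),
        HasFDerivAt (fun γ' => liftSig H γ' u) D₁ γ ∧
        HasFDerivAt (fderiv ℝ (fun γ' => liftSig H γ' u)) D₂ γ ∧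
        (∀ η, D₁ η = dSig H γ η u) ∧ ∀ η η', D₂ η' η = ddSig H γ η η' u) ∧
      (∀ ε > (0 : ℝ), ∃ δ > (0 : ℝ), ∀ (u : Icc t T)
        (η η' : BVPath t T (EuclideanSpace ℝ (Fin e))), ‖η'‖ < δ →
        ‖liftSig H (γ + η') u - liftSig H γ u - dSig H γ η' u‖ ≤ ε * η'.supNorm ∧
        ‖dSig H (γ + η') η u - dSig H γ η u - ddSig H γ η η' u‖ ≤ ε * ‖η‖ * η'.supNorm)) := by
  obtain ⟨φ₁, φ₂, L, -, hφ⟩ := hg.exists_hasLipDeriv₂ (φ := featureMap H)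
    (fun x y => (inner_featureMap x y).trans (hH x y)) fun _ => eq_zero_of_inner_featureMap
  refine ⟨fun t T _ γ η η' => ⟨⟨(hφ.lift₀ γ).toCM.continuous, (hφ.lift₀ γ).property,
    sigWellDefined (hφ.lift₀ γ)⟩, fun u => ?_, fun u => ?_, fun u => ?_⟩, exists_sig_bounds hφ,
    fun t T _ γ η η' γs R hR hlim => ?_, fun t T _ γ => ⟨fun u => ?_, fun ε hε => ?_⟩⟩
  · rw [dLift_eq hφ, ddLift_eq hφ, dSig_eq hφ, ddSig_eq hφ]
    exact ⟨hasLineDerivAt_lift hφ γ η u, hasLineDerivAt_dLift hφ γ η η' u,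
      hasLineDerivAt_liftSig hφ γ η u, hasLineDerivAt_dSig hφ γ η η' u⟩
  · rw [dLift_eq hφ, dSig_eq hφ, liftSig_eq hφ]
    exact ⟨_, _, isRSIntegral_tensorVolterra (hφ.lift₀ γ) (hφ.sig₁ γ η) u,
      isRSIntegral_tensorVolterra (hφ.lift₁ γ η) (hφ.sig₀ γ) u,
      congrArg (fun Y : C(Icc t T, TensorHilbert H) => Y u) (hφ.sig₁_eq γ η)⟩
  · rw [dLift_eq hφ, dLift_eq hφ, ddLift_eq hφ, dSig_eq hφ, dSig_eq hφ, ddSig_eq hφ, liftSig_eq hφ]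
    exact ⟨_, _, _, _, isRSIntegral_tensorVolterra (hφ.lift₀ γ) (hφ.sig₂ γ η η') u,
      isRSIntegral_tensorVolterra (hφ.lift₁ γ η') (hφ.sig₁ γ η) u,
      isRSIntegral_tensorVolterra (hφ.lift₁ γ η) (hφ.sig₁ γ η') u,
      isRSIntegral_tensorVolterra (hφ.lift₂ γ η η') (hφ.sig₀ γ) u,
      congrArg (fun Y : C(Icc t T, TensorHilbert H) => Y u) (hφ.sig₂_eq γ η η')⟩
  · have hγ : (γ.var : ℝ) ≤ (γ.var + R : ℝ≥0) := by push_cast; simp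
    have hγs : ∀ n, ((γs n).var : ℝ) ≤ (γ.var + R : ℝ≥0) := fun n =>
      NNReal.coe_le_coe.2 ((hR n).trans le_add_self)
    simp only [liftSig_eq hφ, dSig_eq hφ, ddSig_eq hφ]
    exact ⟨tendstoUniformly_of_norm_sub_le hlim fun n u =>
        ((hφ.sig₀ (γs n) - hφ.sig₀ γ).norm_coe_le_norm u).trans
          (hφ.norm_sig₀_sub_le hγ (hγs n)),
      tendstoUniformly_of_norm_sub_le hlim fun n u =>
        ((hφ.sig₁ (γs n) η - hφ.sig₁ γ η).norm_coe_le_norm u).trans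
          (hφ.norm_sig₁_sub_le hγ (hγs n) η),
      tendstoUniformly_of_norm_sub_le hlim fun n u =>
        ((hφ.sig₂ (γs n) η η' - hφ.sig₂ γ η η').norm_coe_le_norm u).trans
          (hφ.norm_sig₂_sub_le hγ (hγs n) η η')⟩
  · have h : fderiv ℝ (fun γ' : BVPath t T (EuclideanSpace ℝ (Fin e)) => hφ.sig₀ γ' u)
        = fun γ' => hφ.sigDeriv₁ γ' u :=
      funext fun γ' => (hφ.hasFDerivAt_sig₀ γ' u).fderiv
    simp only [liftSig_eq hφ, dSig_eq hφ, ddSig_eq hφ]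
    rw [h]
    exact ⟨hφ.sigDeriv₁ γ u, hφ.sigDeriv₂ γ u, hφ.hasFDerivAt_sig₀ γ u,
      hφ.hasFDerivAt_sigDeriv₁ γ u, fun _ => rfl, fun _ _ => rfl⟩
  · simp only [liftSig_eq hφ, dSig_eq hφ, ddSig_eq hφ]
    exact exists_sig_remainder hφ γ hε
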